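/- Let $\Bbbk$ be an algebraically closed field of characteristic $0$, $G$ a finite group, and $V$ a quantum linear space with a principal realization over $\Bbbk G$: $V$ has a basis $x_1,\dots,x_\theta$, and there are central elements $g_i\in G$ and characters $\chi_i:G\to\Bbbk^\times$ such that $h\cdot x_i=\chi_i(h)x_i$ and $x_i$ has coaction $g_i\otimes x_i$; with $q_{ij}=\chi_j(g_i)$ one has $q_{ii}\neq1$ and $q_{ij}q_{ji}=1$ for $i\ne j$. Put $N_i=\operatorname{ord}(q_{ii})$ and $\Gamma=\langle g_1,\dots,g_\theta\rangle\le Z(G)$. Let $\mathfrak B(V)$ denote the Nichols algebra. Fix the following data. (i) A subgroup $F$ with $\Gamma\le F\le G$. (ii) An $F$-stable subobject $W\subseteq V$ in ${}^{\Gamma}_{\Gamma}\mathcal{YD}$. (iii) Scalars $\mathcal D=(\xi_i)_i\cup(a_{ij})_{i\neq j}$ such that: if $\xi_i\ne0$, then $x_i\in W$, $g_i^{N_i}=1$ and $\chi_i^{N_i}|_F=1$; if $a_{ij}\neq 0$, then $x_i,x_j\in W$, $g_ig_j=1$ and $\chi_i\chi_j|_F=1$. (iv) A twist $J_F\in\Bbbk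 F\otimes\Bbbk F$. Here a twist for a Hopf algebra $H$ is an invertible $J\in H\otimes H$ with $(1\otimes J)(\operatorname{id}\otimes\Delta)(J)=(J\otimes1)(\Delta\otimes\operatorname{id})(J)$ and $(\operatorname{id}\otimes\epsilon)(J)=(\epsilon\otimes\operatorname{id})(J)=1$; then $H^J$ is the algebra $H$ with comultiplication $J\Delta J^{-1}$. A braided twist for a Hopf algebra $R$ in a category of Yetter-Drinfeld modules is an element of the braided tensor square of $R$ that is invariant, coinvariant and satisfies the same conditions there; it defines $R^J$ in the same way. In the braided tensor square of $\mathfrak B(V)$ put $$\mathcal J_{\mathcal D}=\prod_i\Big(1\otimes1+\xi_i\sum_{n=1}^{N_i-1}\frac{1}{(N_i-n)_{q_{ii}}!\,(n)_{q_{ii}}!}\,x_i^n\otimes x_i^{N_i-n}\Big)\prod_{i\ne j}\exp_{q_{ij}}(a_{ij}x_i\otimes x_j),$$ where $\exp_{q_{ij}}(u)=\sum_{n=0}^{N_i-1}u^n/(n)_{q_{ij}}!$. Let $\mathcal R(V,G)$ be the Hopf algebra in ${}^{\Gamma}_{\Gamma}\mathcal{YD}$ with underlying space $\mathfrak B(V)\otimes\Bbbk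 G$ (elements $v\sharp g$), product $(v\sharp g)(v'\sharp g')=v(g\cdot v')\sharp gg'$, coproduct $\Delta(v\sharp g)=v_{(1)}\sharp g\otimes v_{(2)}\sharp g$, and with the action and coaction of $\Gamma$ on the factor $\mathfrak B(V)$ only. Put $\mathcal J_{\mathcal D,F}=(1\sharp J_F^1\otimes 1\sharp J_F^2)(\mathcal J_{\mathcal D}^1\sharp1\otimes\mathcal J_{\mathcal D}^2\sharp1)$, a product in the braided tensor square, and $$A(V,G,W,F,J_F,\mathcal D)=\big(\mathcal R(V,G)^{\mathcal J_{\mathcal D,F}}\#\Bbbk\Gamma\big)/\langle 1\sharp h\#1-1\sharp1\#h : h\in\Gamma\rangle .$$ Then $\mathcal J_{\mathcal D,F}$ is a braided twist for $\mathcal R(V,G)$, the quotient $A(V,G,W,F,J_F,\mathcal D)$ inherits comultiplication and counit, and there is a normalized Hopf 2-cocycle $\sigma$ on the dual Hopf algebra $(\mathfrak B(W)\#\Bbbk\Gamma)^*\simeq\mathfrak B(W^*)\#\Bbbk^\Gamma$, balanced over $\Bbbk^\Gamma$ (so that $\sigma|_{\Bbbk^\Gamma\otimes\Bbbk^\Gamma}=\epsilon\otimes\epsilon$),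 with the following property. Let $\mathcal J(\sigma)\in\mathfrak B(W)\otimes\mathfrak B(W)$ be given by $\langle f\otimes g,\mathcal J(\sigma)\rangle=\sigma(f\#1,g\#1)$ for $f,g\in\mathfrak B(W)^*$, regard it as an element of $\mathfrak B(V)\otimes\mathfrak B(V)$ through the algebra map $\mathfrak B(W)\to\mathfrak B(V)$ extending $W\subseteq V$, and put $$\mathcal J(\sigma)\#J_F=J_F\cdot\big(\mathcal J(\sigma)^1\#\mathcal J(\sigma)^2_{(-1)}\otimes\mathcal J(\sigma)^2_{(0)}\#1\big).$$ Then $\mathcal J(\sigma)\#J_F$ is a twist for $\mathfrak B(V)\#\Bbbk G$ and $$A(V,G,W,F,J_F,\mathcal D)=\big(\mathfrak B(V)\#\Bbbk G\big)^{\mathcal J(\sigma)\#J_F},$$ that is, the class of $v\sharp g\#h\mapsto v\#gh$ is a well-defined isomorphism of algebras that respects comultiplication and counit. -/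

import Mathlib

open scoped TensorProduct

noncomputable section

namespace QLS

/-! ### Smash products with group algebras -/

section Smash

variable {k G R : Type*} [Field k] [Group G] [Ring R] [Algebra k R]

/-- The vector space `R ⊗ k[G]` underlying the smash product `R # k[G]`, for an action `φ` of `G` on
the algebra `R`; the element `r # g` is `Smash.inc φ g r`. -/
def Smash (_φ : G →* (R →ₐ[k] R)) : Type _ := G →₀ R

variable (φ : G →* (R →ₐ[k] R))

instance : AddCommGroup (Smash φ) := inferInstanceAs (AddCommGroup (G →₀ R))
instance : Module k (Smash φ) := inferInstanceAs (Module k (G →₀ R))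

/-- `r ↦ r # g` -/
def Smash.inc (g : G) : R →ₗ[k] Smash φ := Finsupp.lsingle g

/-- The linear map on `R # k[G]` with prescribed values on the elements `r # g`. -/
def Smash.lift {N : Type*} [AddCommGroup N] [Module k N] (f : G → R →ₗ[k] N) :
    Smash φ →ₗ[k] N := Finsupp.lsum k f

theorem Smash.lift_inc {N : Type*} [AddCommGroup N] [Module k N] (f : G → R →ₗ[k] N) (g : G)
    (r : R) : Smash.lift φ f (Smash.inc φ g r) = f g r :=
  Finsupp.lsum_single k f g r

theorem Smash.hom_ext {N : Type*} [AddCommGroup N] [Module k N] {f f' : Smash φ →ₗ[k] N}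
    (h : ∀ g r, f (Smash.inc φ g r) = f' (Smash.inc φ g r)) : f = f' :=
  Finsupp.lhom_ext h

theorem Smash.induction {p : Smash φ → Prop} (x : Smash φ) (h0 : p 0)
    (hadd : ∀ x y, p x → p y → p (x + y)) (hinc : ∀ g r, p (Smash.inc φ g r)) : p x :=
  Finsupp.induction_linear (motive := p) x h0 hadd hinc

/-- The multiplication `(r # g)(s # h) = r (g · s) # gh`. -/
def Smash.mulLin : Smash φ →ₗ[k] Smash φ →ₗ[k] Smash φ :=
  Smash.lift φ fun g => LinearMap.mk₂ k
    (fun r y => Smash.lift φ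
      (fun h => Smash.inc φ (g * h) ∘ₗ LinearMap.mulLeft k r ∘ₗ (φ g).toLinearMap) y)
    (fun r r' y => by
      rw [← LinearMap.add_apply]; congr 1; apply Smash.hom_ext; intro h s
      simp [Smash.lift_inc, add_mul])
    (fun c r y => by
      rw [← LinearMap.smul_apply]; congr 1; apply Smash.hom_ext; intro h s
      simp [Smash.lift_inc])
    (fun r y y' => map_add _ _ _)
    (fun c r y => map_smul _ _ _)

theorem Smash.mulLin_inc (g h : G) (r s : R) :
    Smash.mulLin φ (Smash.inc φ g r) (Smash.inc φ h s) = Smash.inc φ (g * h) (r * φ g s) := by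
  simp [Smash.mulLin, Smash.lift_inc]

instance : Ring (Smash φ) :=
  { (inferInstance : AddCommGroup (Smash φ)) with
    mul := fun x y => Smash.mulLin φ x y
    one := Smash.inc φ 1 1
    left_distrib := fun x y z => map_add (Smash.mulLin φ x) y z
    right_distrib := fun x y z => LinearMap.map_add₂ (Smash.mulLin φ) x y z
    zero_mul := fun x => LinearMap.map_zero₂ (Smash.mulLin φ) x
    mul_zero := fun x => map_zero (Smash.mulLin φ x)
    one_mul := fun x => by
      have : Smash.mulLin φ (Smash.inc φ 1 1) = LinearMap.id :=
        Smash.hom_ext φ fun g r => by simp [Smash.mulLin_inc]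
      exact LinearMap.congr_fun this x
    mul_one := fun x => by
      have : (Smash.mulLin φ).flip (Smash.inc φ 1 1) = LinearMap.id :=
        Smash.hom_ext φ fun g r => by simp [Smash.mulLin_inc]
      exact LinearMap.congr_fun this x
    mul_assoc := fun x y z => by
      change Smash.mulLin φ (Smash.mulLin φ x y) z = Smash.mulLin φ x (Smash.mulLin φ y z)
      induction x using Smash.induction with
      | h0 => simp
      | hadd a b ha hb => simp [ha, hb]
      | hinc g r =>
        induction y using Smash.induction with
        | h0 => simp
        | hadd a b ha hb => simp [ha, hb]
        | hinc h s =>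
          induction z using Smash.induction with
          | h0 => simp
          | hadd a b ha hb => simp [ha, hb]
          | hinc l t => simp [Smash.mulLin_inc, mul_assoc] }

theorem Smash.inc_mul_inc (g h : G) (r s : R) :
    Smash.inc φ g r * Smash.inc φ h s = Smash.inc φ (g * h) (r * φ g s) :=
  Smash.mulLin_inc φ g h r s

theorem Smash.one_def : (1 : Smash φ) = Smash.inc φ 1 1 := rfl

instance : Algebra k (Smash φ) :=
  Algebra.ofModule (fun c x y => LinearMap.map_smul₂ (Smash.mulLin φ) c x y)
    (fun c x y => map_smul (Smash.mulLin φ x) c y)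

end Smash

/-! ### Braided objects over a group algebra

For a group algebra, a comodule is the same as a `G`-graded space. A coaction is recorded through
the projections `pr g` onto the homogeneous components:
`v₍₋₁₎ ⊗ v₍₀₎ = ∑ g, g ⊗ pr g v`. All groups below are finite. -/

/-- A Yetter-Drinfeld module over the group algebra of a finite group. -/
structure YDModule (k G V : Type*) [Field k] [Group G] [AddCommGroup V] [Module k V] where
  act : G →* Module.End k V
  pr : G → Module.End k V
  pr_pr_self : ∀ g v, pr g (pr g v) = pr g v
  pr_pr_ne : ∀ g h v, g ≠ h → pr g (pr h v) = 0
  sum_pr : ∀ v, ∑ᶠ g, pr g v = v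
  act_pr : ∀ g h v, act h (pr g v) = pr (h * g * h⁻¹) (act h v)

/-- The structure maps, besides the multiplication, of a Hopf algebra `R` in the category of
Yetter-Drinfeld modules over `k[G]`: action, coaction, comultiplication and counit. (The antipode is
determined by the other maps.) -/
structure BraidedData (k G R : Type*) [Field k] [Group G] [Ring R] [Algebra k R] where
  act : G →* (R →ₐ[k] R)
  pr : G → R →ₗ[k] R
  comul : R →ₗ[k] R ⊗[k] R
  counit : R →ₗ[k] k

namespace BraidedData

variable {k G R : Type*} [Field k] [Group G] [Ring R] [Algebra k R] (D : BraidedData k G R)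

/-- The multiplication of the braided tensor square of `R`,
`(r ⊗ s)(r' ⊗ s') = r (s₍₋₁₎ · r') ⊗ s₍₀₎ s'`. -/
def braidedMul : R ⊗[k] R →ₗ[k] R ⊗[k] R →ₗ[k] R ⊗[k] R :=
  ∑ᶠ g : G, TensorProduct.map₂ ((LinearMap.mul k R).compl₂ (D.act g).toLinearMap)
    ((LinearMap.mul k R).comp (D.pr g))

/-- `K` is the inverse of `J` in the braided tensor square. -/
def IsBraidedInverse (J K : R ⊗[k] R) : Prop :=
  D.braidedMul J K = 1 ⊗ₜ 1 ∧ D.braidedMul K J = 1 ⊗ₜ 1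

open Classical in
/-- The inverse of `J` in the braided tensor square (`0` if `J` is not invertible). -/
def braidedInv (J : R ⊗[k] R) : R ⊗[k] R :=
  if h : ∃ K, D.IsBraidedInverse J K then h.choose else 0

/-- Braided twists for `R`: invertible, invariant and coinvariant elements `J` of the braided tensor
square with `(1 ⊗ J)(id ⊗ Δ)(J) = (J ⊗ 1)(Δ ⊗ id)(J)` and `(ε ⊗ id)(J) = (id ⊗ ε)(J) = 1`. -/
structure IsBraidedTwist (J : R ⊗[k] R) : Prop where
  invariant : ∀ g, TensorProduct.map (D.act g).toLinearMap (D.act g).toLinearMap J = J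
  coinvariant_one : ∑ᶠ a : G, TensorProduct.map (D.pr a) (D.pr a⁻¹) J = J
  coinvariant_ne : ∀ g : G, g ≠ 1 → ∑ᶠ a : G, TensorProduct.map (D.pr a) (D.pr (a⁻¹ * g)) J = 0
  invertible : ∃ K, D.IsBraidedInverse J K
  twist : (D.braidedMul J ∘ₗ D.comul).lTensor R J =
    TensorProduct.assoc k R R R ((D.braidedMul J ∘ₗ D.comul).rTensor R J)
  counit_right : TensorProduct.rid k R (D.counit.lTensor R J) = 1
  counit_left : TensorProduct.lid k R (D.counit.rTensor R J) = 1

/-- The braided Hopf algebra `R^J`: the same algebra, with comultiplication `J Δ J⁻¹`. -/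
def twisted (J : R ⊗[k] R) : BraidedData k G R :=
  { D with comul := D.braidedMul J ∘ₗ (D.braidedMul.flip (D.braidedInv J)) ∘ₗ D.comul }

/-- The comultiplication of the bosonization `R # k[G]`,
`Δ(r # h) = r₍₁₎ # r₍₂₎₍₋₁₎ h ⊗ r₍₂₎₍₀₎ # h`. -/
def bosComul : Smash D.act →ₗ[k] Smash D.act ⊗[k] Smash D.act :=
  Smash.lift D.act fun h =>
    (∑ᶠ g : G, TensorProduct.map (Smash.inc D.act (g * h)) (Smash.inc D.act h ∘ₗ D.pr g)) ∘ₗ D.comul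

/-- The counit of the bosonization `R # k[G]`. -/
def bosCounit : Smash D.act →ₗ[k] k := Smash.lift D.act fun _ => D.counit

/-- `J # 1 = J¹ # J²₍₋₁₎ ⊗ J²₍₀₎ # 1` -/
def bosTensor : R ⊗[k] R →ₗ[k] Smash D.act ⊗[k] Smash D.act :=
  ∑ᶠ g : G, TensorProduct.map (Smash.inc D.act g) (Smash.inc D.act 1 ∘ₗ D.pr g)

/-- The inclusion of `k[F]` in `R # k[G]` for a subgroup `F` of `G`, `f ↦ 1 # f`. -/
def ofGroup (F : Subgroup G) : MonoidAlgebra k F →ₗ[k] Smash D.act :=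
  (MonoidAlgebra.lift k (Smash D.act) F
    { toFun := fun f => Smash.inc D.act (f : G) 1
      map_one' := rfl
      map_mul' := fun f f' => by simp [Smash.inc_mul_inc] }).toLinearMap

/-- The action of a central subgroup `Γ` on the coefficients of `R # k[G]`. -/
def coeffAct (Γ : Subgroup G) (hΓ : Γ ≤ Subgroup.center G) :
    Γ →* (Smash D.act →ₐ[k] Smash D.act) where
  toFun h := AlgHom.ofLinearMap
    (Smash.lift D.act fun g => Smash.inc D.act g ∘ₗ (D.act (h : G)).toLinearMap)
    (by simp [Smash.one_def, Smash.lift_inc])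
    (fun x y => by
      induction x using Smash.induction with
      | h0 => simp
      | hadd a b ha hb => simp [add_mul, ha, hb]
      | hinc g r =>
        induction y using Smash.induction with
        | h0 => simp
        | hadd a b ha hb => simp [mul_add, ha, hb]
        | hinc g' s =>
          have hc : (h : G) * g = g * (h : G) := ((Subgroup.mem_center_iff.mp (hΓ h.2)) g).symm
          have := congrArg (fun u => D.act u s) hc
          simp only [map_mul, AlgHom.mul_apply] at this
          simp [Smash.inc_mul_inc, Smash.lift_inc, this])
  map_one' := AlgHom.toLinearMap_injective <| Smash.hom_ext D.act fun g r => by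
    simp [Smash.lift_inc]
  map_mul' h h' := AlgHom.toLinearMap_injective <| Smash.hom_ext D.act fun g r => by
    simp [Smash.lift_inc]

/-- For a central subgroup `Γ` of `G` that contains the support of the coaction of `R`, the braided
Hopf algebra over `k[Γ]` that is the algebra `R # k[G]`, with elements `r ♯ g` and multiplication
`(r ♯ g)(s ♯ h) = r (g · s) ♯ gh`, where `Γ` acts on and coacts on the factor `R` only, and `Δ(r ♯ g) = r₍₁₎ ♯ g ⊗ r₍₂₎ ♯ g`. -/
def overCentral (Γ : Subgroup G) (hΓ : Γ ≤ Subgroup.center G) : BraidedData k Γ (Smash D.act) where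
  act := D.coeffAct Γ hΓ
  pr h := Smash.lift D.act fun g => Smash.inc D.act g ∘ₗ D.pr (h : G)
  comul := Smash.lift D.act fun g =>
    TensorProduct.map (Smash.inc D.act g) (Smash.inc D.act g) ∘ₗ D.comul
  counit := Smash.lift D.act fun _ => D.counit

end BraidedData

/-! ### Nichols algebras -/

namespace YDModule

variable {k G V : Type*} [Field k] [Group G] [AddCommGroup V] [Module k V] (M : YDModule k G V)

/-- The action of `G` on the tensor algebra. -/
def actT : G →* (TensorAlgebra k V →ₐ[k] TensorAlgebra k V) where
  toFun g := TensorAlgebra.lift k (TensorAlgebra.ι k ∘ₗ M.act g)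
  map_one' := by ext; simp
  map_mul' g h := by ext; simp

/-- The coaction of `k[G]` on the tensor algebra `T(V)`, as an algebra map to
`T(V) ⊗ k[G] = T(V)[G]`. -/
def coactT : TensorAlgebra k V →ₐ[k] MonoidAlgebra (TensorAlgebra k V) G :=
  TensorAlgebra.lift k (∑ᶠ g : G, MonoidAlgebra.lsingle g ∘ₗ TensorAlgebra.ι k ∘ₗ M.pr g)

/-- The projection of the tensor algebra onto its component of degree `g` in `G`. -/
def prT (g : G) : TensorAlgebra k V →ₗ[k] TensorAlgebra k V where
  toFun a := (M.coactT a).coeff g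
  map_add' a b := by simp
  map_smul' c a := by simp

/-- For `v` in `V`, the left multiplication by `Δ(v) = v ⊗ 1 + 1 ⊗ v` in the braided tensor square
of the tensor algebra: `a ⊗ b ↦ v a ⊗ b + (v₍₋₁₎ · a) ⊗ v₍₀₎ b`. -/
def comulMulT : V →ₗ[k] Module.End k (TensorAlgebra k V ⊗[k] TensorAlgebra k V) :=
  LinearMap.rTensorHom (TensorAlgebra k V) ∘ₗ LinearMap.mul k (TensorAlgebra k V) ∘ₗ
      TensorAlgebra.ι k +
    ∑ᶠ g : G, (TensorProduct.mapBilinear (RingHom.id k) _ _ _ _ (M.actT g).toLinearMap) ∘ₗ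
      LinearMap.mul k (TensorAlgebra k V) ∘ₗ TensorAlgebra.ι k ∘ₗ M.pr g

/-- The comultiplication of the tensor algebra: the algebra map to the braided tensor square with
`v ↦ v ⊗ 1 + 1 ⊗ v`. -/
def comulT : TensorAlgebra k V →ₗ[k] TensorAlgebra k V ⊗[k] TensorAlgebra k V :=
  LinearMap.applyₗ (1 ⊗ₜ[k] 1) ∘ₗ (TensorAlgebra.lift k M.comulMulT).toLinearMap

/-- `J ⊗ T(V) + T(V) ⊗ J` -/
def tensorIdeal (J : Ideal (TensorAlgebra k V)) :
    Submodule k (TensorAlgebra k V ⊗[k] TensorAlgebra k V) :=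
  Submodule.span k {t | ∃ a b, (a ∈ J ∨ b ∈ J) ∧ a ⊗ₜ[k] b = t}

/-- Two-sided ideals of the tensor algebra contained in `⨁ n ≥ 2, V^⊗n` that are Yetter-Drinfeld
submodules and coideals. -/
structure IsNicholsIdeal (J : Ideal (TensorAlgebra k V)) : Prop where
  mul_mem : ∀ a ∈ J, ∀ b, a * b ∈ J
  degree_zero : ∀ a ∈ J, TensorAlgebra.algebraMapInv a = 0
  degree_one : ∀ a ∈ J, TensorAlgebra.ιInv a = 0
  act_mem : ∀ g, ∀ a ∈ J, M.actT g a ∈ J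
  pr_mem : ∀ g, ∀ a ∈ J, M.prT g a ∈ J
  comul_mem : ∀ a ∈ J, M.comulT a ∈ tensorIdeal J

/-- The defining ideal of the Nichols algebra: the largest of the ideals above. -/
def nicholsIdeal : Ideal (TensorAlgebra k V) := sSup {J | M.IsNicholsIdeal J}

theorem nicholsIdeal_induction {p : TensorAlgebra k V → Prop} (h0 : p 0)
    (hadd : ∀ a b, p a → p b → p (a + b)) (h : ∀ J, M.IsNicholsIdeal J → ∀ a ∈ J, p a)
    (a : TensorAlgebra k V) (ha : a ∈ M.nicholsIdeal) : p a := by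
  rw [nicholsIdeal, sSup_eq_iSup'] at ha
  exact Submodule.iSup_induction _ (motive := p) ha (fun J x hx => h J.1 J.2 x hx) h0 hadd

theorem le_nicholsIdeal {J : Ideal (TensorAlgebra k V)} (hJ : M.IsNicholsIdeal J) :
    J ≤ M.nicholsIdeal := le_sSup hJ

instance : M.nicholsIdeal.IsTwoSided where
  mul_mem_of_left b ha := M.nicholsIdeal_induction (p := fun a => a * b ∈ M.nicholsIdeal) (by simp)
    (fun x y hx hy => by simpa [add_mul] using add_mem hx hy)
    (fun _ hJ x hx => M.le_nicholsIdeal hJ (hJ.mul_mem x hx b)) _ ha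

/-- The Nichols algebra of a Yetter-Drinfeld module. -/
abbrev Nichols : Type _ := TensorAlgebra k V ⧸ M.nicholsIdeal

/-- The projection from the tensor algebra. -/
def toNichols : TensorAlgebra k V →ₐ[k] M.Nichols := Ideal.Quotient.mkₐ k M.nicholsIdeal

/-- The inclusion of `V` in its Nichols algebra. -/
def ofV : V →ₗ[k] M.Nichols := M.toNichols.toLinearMap ∘ₗ TensorAlgebra.ι k

theorem toNichols_eq_zero {a : TensorAlgebra k V} (ha : a ∈ M.nicholsIdeal) :
    M.toNichols a = 0 := Ideal.Quotient.eq_zero_iff_mem.mpr ha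

/-- The linear map on the Nichols algebra induced by a linear map on the tensor algebra. -/
def nicholsLift {N : Type*} [AddCommGroup N] [Module k N] (f : TensorAlgebra k V →ₗ[k] N)
    (hf : ∀ a ∈ M.nicholsIdeal, f a = 0) : M.Nichols →ₗ[k] N where
  toFun := Submodule.liftQ (M.nicholsIdeal.toAddSubgroup.toIntSubmodule) f.toAddMonoidHom.toIntLinearMap
    hf
  map_add' := map_add _
  map_smul' c x := by
    obtain ⟨a, rfl⟩ := Ideal.Quotient.mk_surjective x
    exact map_smul f c a

theorem nicholsLift_toNichols {N : Type*} [AddCommGroup N] [Module k N]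
    (f : TensorAlgebra k V →ₗ[k] N) (hf : ∀ a ∈ M.nicholsIdeal, f a = 0) (a : TensorAlgebra k V) :
    M.nicholsLift f hf (M.toNichols a) = f a := rfl

theorem nicholsIdeal_act (g : G) {a : TensorAlgebra k V} (ha : a ∈ M.nicholsIdeal) :
    M.actT g a ∈ M.nicholsIdeal :=
  M.nicholsIdeal_induction (p := fun a => M.actT g a ∈ M.nicholsIdeal) (by simp)
    (fun x y hx hy => by simpa using add_mem hx hy)
    (fun _ hJ x hx => M.le_nicholsIdeal hJ (hJ.act_mem g x hx)) _ ha

theorem nicholsIdeal_pr (g : G) {a : TensorAlgebra k V} (ha : a ∈ M.nicholsIdeal) :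
    M.prT g a ∈ M.nicholsIdeal :=
  M.nicholsIdeal_induction (p := fun a => M.prT g a ∈ M.nicholsIdeal) (by simp)
    (fun x y hx hy => by simpa using add_mem hx hy)
    (fun _ hJ x hx => M.le_nicholsIdeal hJ (hJ.pr_mem g x hx)) _ ha

theorem nicholsIdeal_counit {a : TensorAlgebra k V} (ha : a ∈ M.nicholsIdeal) :
    TensorAlgebra.algebraMapInv a = 0 :=
  M.nicholsIdeal_induction (p := fun a => TensorAlgebra.algebraMapInv a = 0) (by simp)
    (fun x y hx hy => by simp [hx, hy]) (fun _ hJ x hx => hJ.degree_zero x hx) _ ha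

theorem nicholsIdeal_comul {a : TensorAlgebra k V} (ha : a ∈ M.nicholsIdeal) :
    TensorProduct.map M.toNichols.toLinearMap M.toNichols.toLinearMap (M.comulT a) = 0 := by
  refine M.nicholsIdeal_induction (p := fun a => TensorProduct.map M.toNichols.toLinearMap
    M.toNichols.toLinearMap (M.comulT a) = 0) (by simp) (fun x y hx hy => by simp [hx, hy])
    (fun J hJ x hx => ?_) _ ha
  have h : tensorIdeal J ≤ LinearMap.ker
      (TensorProduct.map M.toNichols.toLinearMap M.toNichols.toLinearMap) := by
    refine Submodule.span_le.mpr ?_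
    rintro _ ⟨b, c, hbc, rfl⟩
    rcases hbc with hb | hc
    · simp [M.toNichols_eq_zero (M.le_nicholsIdeal hJ hb)]
    · simp [M.toNichols_eq_zero (M.le_nicholsIdeal hJ hc)]
  exact h (hJ.comul_mem x hx)

/-- The Nichols algebra as a Hopf algebra in the category of Yetter-Drinfeld modules: the action,
coaction, comultiplication and counit induced by those of the tensor algebra. -/
def nichols : BraidedData k G M.Nichols where
  act :=
    { toFun := fun g => Ideal.quotientMapₐ M.nicholsIdeal (M.actT g)
        (fun _ ha => M.nicholsIdeal_act g ha)
      map_one' := Ideal.Quotient.algHom_ext k (by ext; simp)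
      map_mul' := fun g h => Ideal.Quotient.algHom_ext k (by ext; simp; rfl) }
  pr g := M.nicholsLift (M.toNichols.toLinearMap ∘ₗ M.prT g)
    (fun _ ha => M.toNichols_eq_zero (M.nicholsIdeal_pr g ha))
  comul := M.nicholsLift
    (TensorProduct.map M.toNichols.toLinearMap M.toNichols.toLinearMap ∘ₗ M.comulT)
    (fun _ ha => M.nicholsIdeal_comul ha)
  counit := M.nicholsLift TensorAlgebra.algebraMapInv.toLinearMap
    (fun _ ha => M.nicholsIdeal_counit ha)

end YDModule

/-! ### Twists and Hopf 2-cocycles -/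

section Hopf

variable {k H : Type*} [Field k] [Ring H] [Algebra k H]

/-- `J` is a twist for the Hopf algebra `H` with comultiplication `Δ` and counit `ε`. -/
structure IsTwist (Δ : H →ₗ[k] H ⊗[k] H) (ε : H →ₗ[k] k) (J : H ⊗[k] H) : Prop where
  invertible : IsUnit J
  twist : (1 ⊗ₜ[k] J) * Δ.lTensor H J = TensorProduct.assoc k H H H ((J ⊗ₜ[k] 1) * Δ.rTensor H J)
  counit_right : TensorProduct.rid k H (ε.lTensor H J) = 1
  counit_left : TensorProduct.lid k H (ε.rTensor H J) = 1

/-- The comultiplication `Δ^J = J Δ J⁻¹` of the twisted Hopf algebra `H^J`. -/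
def twistComul (Δ : H →ₗ[k] H ⊗[k] H) (J : H ⊗[k] H) : H →ₗ[k] H ⊗[k] H :=
  LinearMap.mulLeft k J ∘ₗ LinearMap.mulRight k (Ring.inverse J) ∘ₗ Δ

/-- The multiplication of the dual Hopf algebra, `⟨f g, x⟩ = ⟨f, x₍₁₎⟩ ⟨g, x₍₂₎⟩`. Its unit is the
counit of `H` and its counit is `f ↦ f 1`. -/
def dualMul (Δ : H →ₗ[k] H ⊗[k] H) :
    Module.Dual k H →ₗ[k] Module.Dual k H →ₗ[k] Module.Dual k H :=
  TensorProduct.curry (LinearMap.lcomp k k Δ ∘ₗ TensorProduct.dualDistrib k H H)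

/-- `F = f₍₁₎ ⊗ f₍₂₎` is the coproduct of `f` in the dual Hopf algebra:
`⟨f₍₁₎, x⟩ ⟨f₍₂₎, y⟩ = ⟨f, x y⟩`. If `H` is finite-dimensional, then each `f` has exactly one. -/
def IsDualComul (f : Module.Dual k H) (F : Module.Dual k H ⊗[k] Module.Dual k H) : Prop :=
  ∀ x y, TensorProduct.dualDistrib k H H F (x ⊗ₜ[k] y) = f (x * y)

theorem existsUnique_isDualComul [Module.Finite k H] (f : Module.Dual k H) :
    ∃! F, IsDualComul f F := by
  refine ⟨(TensorProduct.dualDistribEquiv k H H).symm (f ∘ₗ LinearMap.mul' k H), ?_, ?_⟩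
  · intro x y
    have := (TensorProduct.dualDistribEquiv k H H).apply_symm_apply (f ∘ₗ LinearMap.mul' k H)
    have := LinearMap.congr_fun this (x ⊗ₜ[k] y)
    simpa using this
  · intro F hF
    apply (TensorProduct.dualDistribEquiv k H H).injective
    rw [LinearEquiv.apply_symm_apply]
    ext x y
    exact hF x y

/-- `∑ σ(f₍₁₎, g₍₁₎) τ(f₍₂₎, g₍₂₎)` for `F = f₍₁₎ ⊗ f₍₂₎` and `K = g₍₁₎ ⊗ g₍₂₎`. -/
def convolve {L : Type*} [AddCommGroup L] [Module k L] (σ τ : L ⊗[k] L →ₗ[k] k) (F K : L ⊗[k] L) :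
    k :=
  LinearMap.mul' k k (TensorProduct.map σ τ (TensorProduct.tensorTensorTensorComm k L L L L
    (F ⊗ₜ[k] K)))

/-- Normalized Hopf 2-cocycles on the dual Hopf algebra of a finite-dimensional Hopf algebra `H`. -/
structure IsDualCocycle (Δ : H →ₗ[k] H ⊗[k] H) (ε : H →ₗ[k] k)
    (σ : Module.Dual k H ⊗[k] Module.Dual k H →ₗ[k] k) : Prop where
  convolution_invertible : ∃ τ : Module.Dual k H ⊗[k] Module.Dual k H →ₗ[k] k,
    ∀ f g F K, IsDualComul f F → IsDualComul g K →
      convolve σ τ F K = f 1 * g 1 ∧ convolve τ σ F K = f 1 * g 1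
  one_left : ∀ f, σ (ε ⊗ₜ f) = f 1
  one_right : ∀ f, σ (f ⊗ₜ ε) = f 1
  /-- `σ(f₍₁₎, g₍₁₎) σ(f₍₂₎ g₍₂₎, h) = σ(g₍₁₎, h₍₁₎) σ(f, g₍₂₎ h₍₂₎)` -/
  cocycle : ∀ f g h F K L, IsDualComul f F → IsDualComul g K → IsDualComul h L →
    convolve σ (TensorProduct.lift ((dualMul Δ).compr₂ (σ ∘ₗ (TensorProduct.mk k _ _).flip h))) F K =
      convolve σ (TensorProduct.lift ((dualMul Δ).compr₂ (σ ∘ₗ TensorProduct.mk k _ _ f))) K L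

end Hopf

namespace BraidedData

variable {k G R : Type*} [Field k] [Group G] [Ring R] [Algebra k R] (D : BraidedData k G R)

/-- The embedding of `R^*` in `(R # k[G])^*`: `⟨f # 1, r # g⟩ = ⟨f, r⟩`. -/
def dualInl : Module.Dual k R →ₗ[k] Module.Dual k (Smash D.act) where
  toFun f := Smash.lift D.act fun _ => f
  map_add' f f' := Smash.hom_ext D.act fun g r => by simp [Smash.lift_inc]
  map_smul' c f := Smash.hom_ext D.act fun g r => by simp [Smash.lift_inc]

/-- The embedding of `k^G = k[G]^*` in `(R # k[G])^*`: `⟨1 # α, r # g⟩ = ε(r) α(g)`. -/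
def dualInr (α : G → k) : Module.Dual k (Smash D.act) := Smash.lift D.act fun g => α g • D.counit

/-- `k^G`-balanced Hopf 2-cocycles on `(R # k[G])^*`, the bosonization `R^* # k^G`: those that factor
through the tensor product over `k^G` as maps of `k^G`-bimodules. -/
structure IsBalancedDualCocycle
    (σ : Module.Dual k (Smash D.act) ⊗[k] Module.Dual k (Smash D.act) →ₗ[k] k) : Prop extends
    IsDualCocycle D.bosComul D.bosCounit σ where
  balanced : ∀ α f g, σ (dualMul D.bosComul f (D.dualInr α) ⊗ₜ g) =
    σ (f ⊗ₜ dualMul D.bosComul (D.dualInr α) g)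
  left_linear : ∀ α f g, σ (dualMul D.bosComul (D.dualInr α) f ⊗ₜ g) = α 1 * σ (f ⊗ₜ g)
  right_linear : ∀ α f g, σ (f ⊗ₜ dualMul D.bosComul g (D.dualInr α)) = σ (f ⊗ₜ g) * α 1

/-- `J` is the element `𝒥(σ)` of `R ⊗ R`: `⟨f ⊗ g, 𝒥(σ)⟩ = σ(f # 1, g # 1)` for `f, g` in `R^*`. -/
def IsTwistOfCocycle (σ : Module.Dual k (Smash D.act) ⊗[k] Module.Dual k (Smash D.act) →ₗ[k] k)
    (J : R ⊗[k] R) : Prop :=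
  ∀ f g, TensorProduct.dualDistrib k R R (f ⊗ₜ g) J = σ (D.dualInl f ⊗ₜ D.dualInl g)

/-- The twist `J # T = T (J # 1)` of `R # k[G]`, for `J` in `R ⊗ R` and `T` in `k[F] ⊗ k[F]`, where
`F` is a subgroup of `G`. -/
def bosTwist {F : Subgroup G} (J : R ⊗[k] R) (T : MonoidAlgebra k F ⊗[k] MonoidAlgebra k F) :
    Smash D.act ⊗[k] Smash D.act :=
  TensorProduct.map (D.ofGroup F) (D.ofGroup F) T * D.bosTensor J

end BraidedData

/-! ### Quantum linear spaces -/

/-- A quantum linear space of rank `θ` with a principal realization over the group algebra of `G`. -/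
structure QuantumLinearSpace (k G : Type*) [Field k] [Group G] (θ : ℕ) where
  g : Fin θ → G
  χ : Fin θ → G →* kˣ
  g_central : ∀ i, g i ∈ Subgroup.center G
  q_self : ∀ i, χ i (g i) ≠ 1
  q_symm : ∀ i j, i ≠ j → χ j (g i) * χ i (g j) = 1

namespace QuantumLinearSpace

variable {k G : Type*} [Field k] [Group G] {θ : ℕ} (Q : QuantumLinearSpace k G θ)

/-- The braiding matrix: `c(x_i ⊗ x_j) = q i j • x_j ⊗ x_i`. -/
def q (i j : Fin θ) : k := Q.χ j (Q.g i)

/-- `N_i` -/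
def N (i : Fin θ) : ℕ := orderOf (Q.q i i)

/-- The subgroup generated by the support. -/
def Γ : Subgroup G := Subgroup.closure (Set.range Q.g)

theorem Γ_le_center : Q.Γ ≤ Subgroup.center G :=
  (Subgroup.closure_le _).mpr (by rintro _ ⟨i, rfl⟩; exact Q.g_central i)

open Classical in
/-- The Yetter-Drinfeld module `V` over `k[G]` with basis `x_i = Pi.single i 1`, with
`h · x_i = χ_i(h) x_i` and coaction `x_i ↦ g_i ⊗ x_i`. -/
def V [Finite G] : YDModule k G (Fin θ → k) where
  act :=
    { toFun := fun h => LinearMap.pi fun i => (Q.χ i h : k) • LinearMap.proj i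
      map_one' := by ext; simp
      map_mul' := fun h h' => by ext; simp [mul_assoc] }
  pr h := LinearMap.pi fun i => if Q.g i = h then LinearMap.proj i else 0
  pr_pr_self h v := by
    ext i
    by_cases hi : Q.g i = h <;> simp [hi]
  pr_pr_ne h h' v hne := by
    ext i
    by_cases hi : Q.g i = h
    · have hi' : Q.g i ≠ h' := fun e => hne (hi.symm.trans e)
      simp only [LinearMap.pi_apply, if_pos hi, LinearMap.proj_apply, if_neg hi']
      rfl
    · simp only [LinearMap.pi_apply, if_neg hi]
      rfl
  sum_pr v := by
    have := Fintype.ofFinite G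
    rw [finsum_eq_sum_of_fintype]
    ext i
    rw [Finset.sum_apply, Finset.sum_eq_single (Q.g i)]
    · simp
    · intro h _ hne
      simp [hne.symm]
    · simp
  act_pr h' h v := by
    ext i
    have hc : Q.g i = h * h' * h⁻¹ ↔ Q.g i = h' := by
      rw [eq_mul_inv_iff_mul_eq, ← Subgroup.mem_center_iff.mp (Q.g_central i) h]
      exact mul_right_inj h
    by_cases hi : Q.g i = h'
    · have hi' := hc.mpr hi
      simp only [LinearMap.pi_apply, if_pos hi']
      simp [hi]
    · have hi' := fun e => hi (hc.mp e)
      simp only [LinearMap.pi_apply, if_neg hi']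
      simp [hi]

/-- The Nichols algebra `𝔅(V)`. -/
def B [Finite G] : BraidedData k G Q.V.Nichols := Q.V.nichols

/-- `x_i` in `𝔅(V)` -/
def x [Finite G] (i : Fin θ) : Q.V.Nichols := Q.V.ofV (Pi.single i 1)

/-- The braided Hopf algebra `ℛ(V, G)` over `k[Γ]`. -/
def R [Finite G] : BraidedData k Q.Γ (Smash Q.B.act) := Q.B.overCentral Q.Γ Q.Γ_le_center

end QuantumLinearSpace

/-- The quantum factorial `(n)_q!`. -/
def qFactorial {k : Type*} [Field k] (q : k) (n : ℕ) : k :=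
  ∏ m ∈ Finset.range n, ∑ l ∈ Finset.range (m + 1), q ^ l

/-- The data `(W, F, J_F, 𝒟)` for a quantum linear space `V` over `G`: a subgroup `Γ ≤ F ≤ G`, an
`F`-stable subobject `W` of `V` over `Γ`, a family of scalars `𝒟 = (ξ_i) ∪ (a_ij)`, `i ≠ j`, that is
compatible with `W` and `F`-invariant, and a twist `J_F` for `F`. -/
structure MombelliDatum {k G : Type*} [Field k] [Group G] [Finite G] {θ : ℕ}
    (Q : QuantumLinearSpace k G θ) where
  F : Subgroup G
  Γ_le : Q.Γ ≤ F
  W : Submodule k (Fin θ → k)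
  act_mem : ∀ f ∈ F, ∀ w ∈ W, Q.V.act f w ∈ W
  pr_mem : ∀ h ∈ Q.Γ, ∀ w ∈ W, Q.V.pr h w ∈ W
  ξ : Fin θ → k
  a : Fin θ → Fin θ → k
  ξ_mem : ∀ i, ξ i ≠ 0 → Pi.single i 1 ∈ W
  a_mem : ∀ i j, i ≠ j → a i j ≠ 0 → Pi.single i 1 ∈ W ∧ Pi.single j 1 ∈ W
  ξ_coinvariant : ∀ i, ξ i ≠ 0 → Q.g i ^ Q.N i = 1
  a_coinvariant : ∀ i j, i ≠ j → a i j ≠ 0 → Q.g i * Q.g j = 1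
  ξ_invariant : ∀ i, ξ i ≠ 0 → ∀ f ∈ F, Q.χ i f ^ Q.N i = 1
  a_invariant : ∀ i j, i ≠ j → a i j ≠ 0 → ∀ f ∈ F, Q.χ i f * Q.χ j f = 1
  JF : MonoidAlgebra k F ⊗[k] MonoidAlgebra k F
  JF_twist : IsTwist (Coalgebra.comul (R := k)) (Coalgebra.counit (R := k)) JF

namespace MombelliDatum

variable {k G : Type*} [Field k] [Group G] [Finite G] {θ : ℕ} {Q : QuantumLinearSpace k G θ}
  (M : MombelliDatum Q)

/-- The Yetter-Drinfeld module `W` over `k[Γ]`. -/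
def ydW : YDModule k Q.Γ M.W where
  act :=
    { toFun := fun h => (Q.V.act h).restrict (M.act_mem h (M.Γ_le h.2))
      map_one' := by ext; simp
      map_mul' := fun h h' => by ext; simp }
  pr h := (Q.V.pr h).restrict (M.pr_mem h h.2)
  pr_pr_self h w := Subtype.ext (Q.V.pr_pr_self h w)
  pr_pr_ne h h' w hne := Subtype.ext (Q.V.pr_pr_ne h h' w fun e => hne (Subtype.ext e))
  sum_pr w := by
    have := Fintype.ofFinite Q.Γ
    rw [finsum_eq_sum_of_fintype]
    ext i
    have hi : Q.g i ∈ Q.Γ := Subgroup.subset_closure ⟨i, rfl⟩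
    simp only [AddSubmonoidClass.coe_finsetSum, Finset.sum_apply, LinearMap.coe_restrict_apply]
    rw [Finset.sum_eq_single ⟨Q.g i, hi⟩]
    · simp [QuantumLinearSpace.V]
    · intro h _ hne
      have : Q.g i ≠ h := fun e => hne (Subtype.ext e.symm)
      simp [QuantumLinearSpace.V, this]
    · simp
  act_pr h' h w := Subtype.ext (Q.V.act_pr h' h w)

/-- The Nichols algebra `𝔅(W)`. -/
def BW : BraidedData k Q.Γ M.ydW.Nichols := M.ydW.nichols

/-- `1 ⊗ 1 + ξ_i ∑ (1 / (N_i - n)_q! (n)_q!) x_i^n ⊗ x_i^(N_i - n)`, `0 < n < N_i`, `q = q_ii` -/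
def Jξ (i : Fin θ) : Q.V.Nichols ⊗[k] Q.V.Nichols :=
  1 ⊗ₜ 1 + M.ξ i • ∑ n ∈ Finset.Ioo 0 (Q.N i),
    (qFactorial (Q.q i i) (Q.N i - n) * qFactorial (Q.q i i) n)⁻¹ •
      ((Q.x i ^ n) ⊗ₜ[k] (Q.x i ^ (Q.N i - n)))

/-- The `q`-exponential of `a_ij x_i ⊗ x_j`, `q = q_ij`: the sum over `n < N_i` of
`(a_ij x_i ⊗ x_j)^n / (n)_q!`, with powers in the braided tensor square. (If `a_ij ≠ 0`, then
`N_i = 2`, so that this is `1 ⊗ 1 + a_ij x_i ⊗ x_j`.) -/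
def expq (i j : Fin θ) : Q.V.Nichols ⊗[k] Q.V.Nichols :=
  ∑ n ∈ Finset.range (Q.N i), (qFactorial (Q.q i j) n)⁻¹ •
    ((Q.B.braidedMul (M.a i j • (Q.x i ⊗ₜ[k] Q.x j)))^[n] (1 ⊗ₜ 1))

/-- The braided twist `𝒥_𝒟 = ∏ i, J_{ξ_i} ∏ i ≠ j, exp(a_ij x_i ⊗ x_j)`, a product in the braided
tensor square. (The factors commute.) -/
def JD : Q.V.Nichols ⊗[k] Q.V.Nichols :=
  ((List.finRange θ).map M.Jξ ++
    (((List.finRange θ ×ˢ List.finRange θ).filter fun p => p.1 ≠ p.2).map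
      fun p => M.expq p.1 p.2)).foldr (fun s t => Q.B.braidedMul s t) (1 ⊗ₜ 1)

/-- The braided twist `𝒥_{𝒟,F} = (1 ♯ J_F)(𝒥_𝒟 ♯ 1)` for `ℛ(V, G)`. -/
def JDF : Smash Q.B.act ⊗[k] Smash Q.B.act :=
  Q.R.braidedMul (TensorProduct.map (Q.B.ofGroup M.F) (Q.B.ofGroup M.F) M.JF)
    (TensorProduct.map (Smash.inc Q.B.act 1) (Smash.inc Q.B.act 1) M.JD)

/-- The braided Hopf algebra `ℛ(V, G)^{𝒥_{𝒟,F}}`. -/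
def RJ : BraidedData k Q.Γ (Smash Q.B.act) := Q.R.twisted M.JDF

/-- The relation `1 ♯ h # 1 = 1 ♯ 1 # h`, `h ∈ Γ`, which identifies the two copies of `Γ`. -/
def rel (s t : Smash M.RJ.act) : Prop :=
  ∃ h : Q.Γ, s = Smash.inc M.RJ.act 1 (Smash.inc Q.B.act (h : G) 1) ∧ t = Smash.inc M.RJ.act h 1

/-- The algebra `A(V, G, W, F, J_F, 𝒟)`: the quotient of `ℛ(V, G)^{𝒥_{𝒟,F}} # k[Γ]` by the
two-sided ideal generated by the elements `1 ♯ h # 1 - 1 ♯ 1 # h`. -/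
abbrev A : Type _ := RingQuot M.rel

/-- The projection `ℛ(V, G)^{𝒥_{𝒟,F}} # k[Γ] → A(V, G, W, F, J_F, 𝒟)`. -/
def proj : Smash M.RJ.act →ₐ[k] M.A := RingQuot.mkAlgHom k M.rel

/-- `Δ` and `ε` are the comultiplication and counit of the Hopf algebra `A(V, G, W, F, J_F, 𝒟)`, which
are induced by those of `ℛ(V, G)^{𝒥_{𝒟,F}} # k[Γ]`. -/
structure IsHopfStructure (Δ : M.A →ₗ[k] M.A ⊗[k] M.A) (ε : M.A →ₗ[k] k) : Prop where
  comul : Δ ∘ₗ M.proj.toLinearMap =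
    TensorProduct.map M.proj.toLinearMap M.proj.toLinearMap ∘ₗ M.RJ.bosComul
  counit : ε ∘ₗ M.proj.toLinearMap = M.RJ.bosCounit

end MombelliDatum

end QLS

end

open scoped TensorProduct

open scoped TensorProduct

noncomputable section

namespace QLS

/-! Everything braided is moved into ordinary tensor powers of the bosonization H = 𝔅(V) # kG. The
map `bosTensor`, r ⊗ s ↦ r # s₍₋₁₎ ⊗ s₍₀₎ # 1, is an injective algebra map from the braided tensor
square to H ⊗ H, and it carries the braided coproduct to the coproduct of H (`bosTensor_mul`,
`bosTensor_injective`, `bosTensor_comul`). Coassociativity is never needed. The only facts required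
about Nichols algebras are that they are bialgebras in this sense, that x_i^N_i and the
q-commutators vanish (each is primitive of degree at least 2, so it generates an admissible ideal),
and that W ⊆ V induces 𝔅(W) → 𝔅(V).

The twist equation for 𝒥_𝒟 is checked in H ⊗ H ⊗ H. There the images a, b, c of x_i in the three
positions are nilpotent of order N = N_i and satisfy ba = q ab, cb = q bc, ca = q ac. The factor of
ξ_i is 1 + ξ_i E(a, b), where E(a, b) is the degree N part of the product of the truncated
q-exponentials of a and b. Its twist equation is the associativity of the product of three truncated
exponentials, read in degrees N and 2N (`expMul_twist`). If a_ij ≠ 0, all the braiding scalars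
involved are -1 and the factor is 1 + a_ij x_i ⊗ x_j, which is treated by hand. Coinvariance makes
each factor commute with the letters of all other factors, so the product of the factors is again a
twist (`isTwist_bosList_prod`). F-invariance makes it commute with f ⊗ f for f in F, so it can be
multiplied by J_F (`isTwist_bosTwist`).

The cocycle σ is evaluation on the twist of 𝔅(W) # kΓ obtained by the same computation, with x_i
replaced by 0 when x_i is not in W. The cocycle identity is the transposed twist equation
(`IsTwist.isDualCocycle`), and balancedness is the coinvariance of the twist
(`isBalancedDualCocycle`).

Finally, ℛ(V, G) is H itself as an algebra, and since Γ is central, Γ acts on it by conjugation with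
1 ♯ h. Hence x # h ↦ x h identifies A with H (`collapseEquiv`). The map `shift`, x ⊗ y ↦ x y₍₋₁₎ ⊗
y₍₀₎, is an isomorphism of algebras from the braided tensor square of ℛ(V, G) to H ⊗ H. It carries
the coproduct of ℛ(V, G) to that of H and 𝒥_{𝒟,F} to J_F (𝒥_𝒟 # 1). So the braided twist conditions
and the twisted coproduct are those of the ordinary twist (`IsInner.isBraidedTwist`,
`IsInner.collapse_bosComul_twisted`). -/

namespace BraidedData

/-! ### Graded algebras with action, and the embedding of the braided tensor square in the
bosonization. -/

section Graded

variable {k G R : Type*} [Field k] [Group G] [Ring R] [Algebra k R] (D : BraidedData k G R)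

/-- The homogeneous elements of degree `g`. -/
def hom (g : G) : Submodule k R where
  carrier := {r | D.pr g r = r ∧ ∀ h, h ≠ g → D.pr h r = 0}
  zero_mem' := by simp
  add_mem' := by
    rintro a b ⟨ha, ha'⟩ ⟨hb, hb'⟩
    exact ⟨by rw [map_add, ha, hb], fun h hh => by rw [map_add, ha' h hh, hb' h hh, add_zero]⟩
  smul_mem' := by
    rintro c a ⟨ha, ha'⟩
    exact ⟨by rw [map_smul, ha], fun h hh => by rw [map_smul, ha' h hh, smul_zero]⟩

variable {D}

theorem pr_of_mem {g : G} {r : R} (hr : r ∈ D.hom g) : D.pr g r = r := hr.1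

theorem pr_of_mem_ne {g h : G} {r : R} (hr : r ∈ D.hom g) (hne : h ≠ g) : D.pr h r = 0 :=
  hr.2 h hne

variable (D)

/-- The tensors of total degree `g`. -/
def hom2 (g : G) : Submodule k (R ⊗[k] R) :=
  Submodule.span k {t | ∃ a b r s, r ∈ D.hom a ∧ s ∈ D.hom b ∧ a * b = g ∧ t = r ⊗ₜ s}

theorem tmul_mem_hom2 {a b g : G} {r s : R} (hr : r ∈ D.hom a) (hs : s ∈ D.hom b)
    (h : a * b = g) : r ⊗ₜ[k] s ∈ D.hom2 g :=
  Submodule.subset_span ⟨a, b, r, s, hr, hs, h, rfl⟩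

/-- The projections `pr` define a grading of the algebra `R`, compatible with the action. -/
structure IsGraded : Prop where
  iSup_hom : ⨆ g, D.hom g = ⊤
  one_mem : (1 : R) ∈ D.hom 1
  mul_mem : ∀ {g h r s}, r ∈ D.hom g → s ∈ D.hom h → r * s ∈ D.hom (g * h)
  act_mem : ∀ {g r} (h), r ∈ D.hom g → D.act h r ∈ D.hom (h * g * h⁻¹)

/-- `R` is a bialgebra in the category of Yetter-Drinfeld modules, up to coassociativity. -/
structure IsBialg : Prop extends D.IsGraded where
  comul_one : D.comul 1 = 1 ⊗ₜ 1
  comul_mul : ∀ r s, D.comul (r * s) = D.braidedMul (D.comul r) (D.comul s)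
  comul_act : ∀ g r, D.comul (D.act g r) =
    TensorProduct.map (D.act g).toLinearMap (D.act g).toLinearMap (D.comul r)
  comul_mem : ∀ {g r}, r ∈ D.hom g → D.comul r ∈ D.hom2 g
  counit_one : D.counit 1 = 1
  counit_mul : ∀ r s, D.counit (r * s) = D.counit r * D.counit s
  counit_act : ∀ g r, D.counit (D.act g r) = D.counit r
  counit_hom : ∀ {g r}, r ∈ D.hom g → g ≠ 1 → D.counit r = 0
  rid_comul : ∀ r, TensorProduct.rid k R (D.counit.lTensor R (D.comul r)) = r
  lid_comul : ∀ r, TensorProduct.lid k R (D.counit.rTensor R (D.comul r)) = r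

variable {D}

section

variable {p : R → Prop}

theorem hom_induction (h : ⨆ g, D.hom g = ⊤) (r : R) (hom : ∀ g, ∀ r ∈ D.hom g, p r)
    (h0 : p 0) (hadd : ∀ r s, p r → p s → p (r + s)) : p r :=
  Submodule.iSup_induction D.hom (motive := p) (h ▸ Submodule.mem_top) hom h0 hadd

theorem hom_ext (h : ⨆ g, D.hom g = ⊤) {N : Type*} [AddCommMonoid N] [Module k N]
    {f f' : R →ₗ[k] N} (hf : ∀ g, ∀ r ∈ D.hom g, f r = f' r) : f = f' :=
  LinearMap.ext fun r => hom_induction (p := fun r => f r = f' r) h r hf (by simp)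
    (fun r s hr hs => by simp [hr, hs])

theorem tensor_hom_ext (h : ⨆ g, D.hom g = ⊤) {N : Type*} [AddCommMonoid N] [Module k N]
    {f f' : R ⊗[k] R →ₗ[k] N}
    (hf : ∀ a b, ∀ r ∈ D.hom a, ∀ s ∈ D.hom b, f (r ⊗ₜ s) = f' (r ⊗ₜ s)) : f = f' :=
  TensorProduct.ext <| hom_ext h fun a r hr => hom_ext h fun b s hs => hf a b r hr s hs

/-- `pr g` fixes `K g` and kills every other `K a`, so it maps everything into `K g`. With `K g` cut
out of `D.hom g` by some property, this proves the property for all homogeneous elements once the `K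
g` span. -/
theorem eq_of_le_hom {K : G → Submodule k R} (hK : ∀ g, K g ≤ D.hom g) (h : ⨆ g, K g = ⊤)
    (g : G) : K g = D.hom g := by
  refine le_antisymm (hK g) fun r hr => ?_
  have key : ∀ s : R, D.pr g s ∈ K g := fun s =>
    Submodule.iSup_induction K (motive := fun s => D.pr g s ∈ K g) (h ▸ Submodule.mem_top)
      (fun a s hs => by
        by_cases ha : g = a
        · subst ha; rwa [pr_of_mem (hK _ hs)]
        · rw [pr_of_mem_ne (hK _ hs) ha]; exact zero_mem _)
      (by simp) (fun s t hs ht => by rw [map_add]; exact add_mem hs ht)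
  rw [← pr_of_mem hr]
  exact key r

theorem pr_mem_hom (h : ⨆ g, D.hom g = ⊤) (g : G) (r : R) : D.pr g r ∈ D.hom g :=
  hom_induction (p := fun r => D.pr g r ∈ D.hom g) h r
    (fun a s hs => by
      by_cases ha : g = a
      · subst ha; rwa [pr_of_mem hs]
      · rw [pr_of_mem_ne hs ha]; exact zero_mem _)
    (by simp) (fun s t hs ht => by rw [map_add]; exact add_mem hs ht)

end

/-- The group-like element `1 # g` of `R # k[G]`. -/
def grp (D : BraidedData k G R) : G →* Smash D.act where
  toFun g := Smash.inc D.act g 1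
  map_one' := rfl
  map_mul' g h := by simp [Smash.inc_mul_inc]

theorem grp_mul_inc (g h : G) (r : R) :
    D.grp g * Smash.inc D.act h r = Smash.inc D.act (g * h) (D.act g r) := by
  simp [grp, Smash.inc_mul_inc]

theorem inc_mul_grp (g h : G) (r : R) :
    Smash.inc D.act h r * D.grp g = Smash.inc D.act (h * g) r := by
  simp [grp, Smash.inc_mul_inc]

theorem bosCounit_inc (g : G) (r : R) : D.bosCounit (Smash.inc D.act g r) = D.counit r :=
  Smash.lift_inc ..

namespace IsBialg

/-- The counit of the bosonization as an algebra map. -/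
def counitHom (hD : D.IsBialg) : Smash D.act →ₐ[k] k :=
  AlgHom.ofLinearMap D.bosCounit
    (by rw [Smash.one_def, bosCounit_inc, hD.counit_one])
    (fun x y => by
      induction x using Smash.induction with
      | h0 => simp
      | hadd a b ha hb => simp [add_mul, ha, hb]
      | hinc g r =>
        induction y using Smash.induction with
        | h0 => simp
        | hadd a b ha hb => simp [mul_add, ha, hb]
        | hinc h s =>
          rw [Smash.inc_mul_inc, bosCounit_inc, bosCounit_inc, bosCounit_inc, hD.counit_mul,
            hD.counit_act])

end IsBialg

section

variable [Finite G]

theorem braidedMul_tmul {g : G} {s : R} (hs : s ∈ D.hom g) (r r' s' : R) :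
    D.braidedMul (r ⊗ₜ s) (r' ⊗ₜ s') = (r * D.act g r') ⊗ₜ (s * s') := by
  have := Fintype.ofFinite G
  rw [braidedMul, finsum_eq_sum_of_fintype, LinearMap.sum_apply, LinearMap.sum_apply,
    Finset.sum_eq_single g]
  · simp [pr_of_mem hs]
  · intro h _ hne
    simp [pr_of_mem_ne hs hne]
  · simp

theorem bosTensor_tmul {g : G} {s : R} (hs : s ∈ D.hom g) (r : R) :
    D.bosTensor (r ⊗ₜ s) = Smash.inc D.act g r ⊗ₜ Smash.inc D.act 1 s := by
  have := Fintype.ofFinite G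
  rw [bosTensor, finsum_eq_sum_of_fintype, LinearMap.sum_apply, Finset.sum_eq_single g]
  · simp [pr_of_mem hs]
  · intro h _ hne
    simp [pr_of_mem_ne hs hne]
  · simp

namespace IsGraded

/-- If s has degree b, then in (r # b ⊗ s # 1)(r' # b' ⊗ s' # 1) the group-like b passes r' and
turns it into b · r', which is exactly the braiding. -/
theorem bosTensor_mul (hD : D.IsGraded) (X Y : R ⊗[k] R) :
    D.bosTensor (D.braidedMul X Y) = D.bosTensor X * D.bosTensor Y := by
  have : D.braidedMul.compr₂ D.bosTensor =
      (LinearMap.mul k _).compl₁₂ D.bosTensor D.bosTensor :=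
    tensor_hom_ext hD.iSup_hom fun a b r hr s hs => tensor_hom_ext hD.iSup_hom
      fun a' b' r' hr' s' hs' => by
        simp [braidedMul_tmul hs, bosTensor_tmul hs, bosTensor_tmul hs',
          bosTensor_tmul (hD.mul_mem hs hs'), Smash.inc_mul_inc]
  exact LinearMap.congr_fun (LinearMap.congr_fun this X) Y

/-- Forgetting the group elements, r # g ↦ r, in both factors is a left inverse. Associativity and
units of the braided tensor square are then inherited from the tensor square of the bosonization. -/
theorem bosTensor_injective (hD : D.IsGraded) : Function.Injective D.bosTensor := by
  have : TensorProduct.map (Smash.lift D.act fun _ => LinearMap.id)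
      (Smash.lift D.act fun _ => LinearMap.id) ∘ₗ D.bosTensor = LinearMap.id :=
    tensor_hom_ext hD.iSup_hom fun a b r hr s hs => by simp [bosTensor_tmul hs, Smash.lift_inc]
  exact Function.LeftInverse.injective (LinearMap.congr_fun this)

theorem bosTensor_one (hD : D.IsGraded) : D.bosTensor (1 ⊗ₜ 1) = 1 := by
  rw [bosTensor_tmul hD.one_mem]; rfl

theorem braidedMul_assoc (hD : D.IsGraded) (X Y Z : R ⊗[k] R) :
    D.braidedMul (D.braidedMul X Y) Z = D.braidedMul X (D.braidedMul Y Z) :=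
  hD.bosTensor_injective (by simp only [hD.bosTensor_mul, mul_assoc])

theorem one_braidedMul (hD : D.IsGraded) (X : R ⊗[k] R) : D.braidedMul (1 ⊗ₜ 1) X = X :=
  hD.bosTensor_injective (by rw [hD.bosTensor_mul, hD.bosTensor_one, one_mul])

theorem braidedMul_one (hD : D.IsGraded) (X : R ⊗[k] R) : D.braidedMul X (1 ⊗ₜ 1) = X :=
  hD.bosTensor_injective (by rw [hD.bosTensor_mul, hD.bosTensor_one, mul_one])

/-- A homogeneous second factor with nonzero counit has degree 1, so the braiding past it is
trivial. On the other side the invariance of the counit plays this role. -/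
theorem rid_braidedMul (hD : D.IsGraded) (hmul : ∀ r s, D.counit (r * s) = D.counit r * D.counit s)
    (hhom : ∀ {g r}, r ∈ D.hom g → g ≠ 1 → D.counit r = 0) (X Y : R ⊗[k] R) :
    TensorProduct.rid k R (D.counit.lTensor R (D.braidedMul X Y)) =
      TensorProduct.rid k R (D.counit.lTensor R X) *
        TensorProduct.rid k R (D.counit.lTensor R Y) := by
  have : D.braidedMul.compr₂ ((TensorProduct.rid k R).toLinearMap ∘ₗ D.counit.lTensor R) =
      (LinearMap.mul k R).compl₁₂ ((TensorProduct.rid k R).toLinearMap ∘ₗ D.counit.lTensor R)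
        ((TensorProduct.rid k R).toLinearMap ∘ₗ D.counit.lTensor R) :=
    tensor_hom_ext hD.iSup_hom fun a b r hr s hs => tensor_hom_ext hD.iSup_hom
      fun a' b' r' hr' s' hs' => by
        by_cases hb : b = 1
        · subst hb
          simp [braidedMul_tmul hs, hmul, smul_smul, mul_comm (D.counit s)]
        · simp [braidedMul_tmul hs, hmul, hhom hs hb]
  exact LinearMap.congr_fun (LinearMap.congr_fun this X) Y

theorem lid_braidedMul (hD : D.IsGraded) (hmul : ∀ r s, D.counit (r * s) = D.counit r * D.counit s)
    (hact : ∀ g r, D.counit (D.act g r) = D.counit r) (X Y : R ⊗[k] R) :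
    TensorProduct.lid k R (D.counit.rTensor R (D.braidedMul X Y)) =
      TensorProduct.lid k R (D.counit.rTensor R X) *
        TensorProduct.lid k R (D.counit.rTensor R Y) := by
  have : D.braidedMul.compr₂ ((TensorProduct.lid k R).toLinearMap ∘ₗ D.counit.rTensor R) =
      (LinearMap.mul k R).compl₁₂ ((TensorProduct.lid k R).toLinearMap ∘ₗ D.counit.rTensor R)
        ((TensorProduct.lid k R).toLinearMap ∘ₗ D.counit.rTensor R) :=
    tensor_hom_ext hD.iSup_hom fun a b r hr s hs => tensor_hom_ext hD.iSup_hom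
      fun a' b' r' hr' s' hs' => by
        simp [braidedMul_tmul hs, hmul, hact, smul_smul, mul_comm (D.counit r)]
  exact LinearMap.congr_fun (LinearMap.congr_fun this X) Y

theorem map_act_braidedMul (hD : D.IsGraded) (g : G) (X Y : R ⊗[k] R) :
    TensorProduct.map (D.act g).toLinearMap (D.act g).toLinearMap (D.braidedMul X Y) =
      D.braidedMul (TensorProduct.map (D.act g).toLinearMap (D.act g).toLinearMap X)
        (TensorProduct.map (D.act g).toLinearMap (D.act g).toLinearMap Y) := by
  have : D.braidedMul.compr₂ (TensorProduct.map (D.act g).toLinearMap (D.act g).toLinearMap) =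
      D.braidedMul.compl₁₂ (TensorProduct.map (D.act g).toLinearMap (D.act g).toLinearMap)
        (TensorProduct.map (D.act g).toLinearMap (D.act g).toLinearMap) :=
    tensor_hom_ext hD.iSup_hom fun a b r hr s hs => tensor_hom_ext hD.iSup_hom
      fun a' b' r' hr' s' hs' => by
        have h : D.act (g * b * g⁻¹) (D.act g r') = D.act g (D.act b r') := by
          simp only [← AlgHom.mul_apply, ← map_mul, inv_mul_cancel_right]
        simp only [LinearMap.compr₂_apply, LinearMap.compl₁₂_apply, braidedMul_tmul hs,
          TensorProduct.map_tmul, AlgHom.toLinearMap_apply, braidedMul_tmul (hD.act_mem g hs), h,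
          map_mul (D.act g)]
  exact LinearMap.congr_fun (LinearMap.congr_fun this X) Y

theorem braidedMul_mem_hom2 (hD : D.IsGraded) {g h : G} {X Y : R ⊗[k] R} (hX : X ∈ D.hom2 g)
    (hY : Y ∈ D.hom2 h) : D.braidedMul X Y ∈ D.hom2 (g * h) := by
  induction hX using Submodule.span_induction with
  | mem X hX =>
    obtain ⟨a, b, r, s, hr, hs, rfl, rfl⟩ := hX
    induction hY using Submodule.span_induction with
    | mem Y hY =>
      obtain ⟨a', b', r', s', hr', hs', rfl, rfl⟩ := hY
      rw [braidedMul_tmul hs]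
      exact D.tmul_mem_hom2 (hD.mul_mem hr (hD.act_mem b hr')) (hD.mul_mem hs hs') (by group)
    | zero => simp
    | add Y Z _ _ hY hZ => rw [map_add]; exact add_mem hY hZ
    | smul c Y _ hY => rw [map_smul]; exact Submodule.smul_mem _ c hY
  | zero => simp
  | add X Z _ _ hX hZ => rw [map_add, LinearMap.add_apply]; exact add_mem hX hZ
  | smul c X _ hX => rw [map_smul, LinearMap.smul_apply]; exact Submodule.smul_mem _ c hX

end IsGraded

/-- Conjugation by g ⊗ g realizes the diagonal action: if s has degree b, then g · s has degree g b
g⁻¹, and g b = (g b g⁻¹) g. Thus invariance of a tensor becomes commutation with g ⊗ g. -/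
theorem grp_tmul_mul_bosTensor (hD : D.IsGraded) (g : G) (X : R ⊗[k] R) :
    D.grp g ⊗ₜ D.grp g * D.bosTensor X =
      D.bosTensor (TensorProduct.map (D.act g).toLinearMap (D.act g).toLinearMap X) *
        D.grp g ⊗ₜ D.grp g := by
  have : LinearMap.mulLeft k (D.grp g ⊗ₜ[k] D.grp g) ∘ₗ D.bosTensor =
      LinearMap.mulRight k (D.grp g ⊗ₜ[k] D.grp g) ∘ₗ D.bosTensor ∘ₗ
        TensorProduct.map (D.act g).toLinearMap (D.act g).toLinearMap :=
    tensor_hom_ext hD.iSup_hom fun a b r hr s hs => by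
      simp [bosTensor_tmul hs, bosTensor_tmul (hD.act_mem g hs), grp_mul_inc, inc_mul_grp]
  exact LinearMap.congr_fun this X

/-- This form of the coproduct of the bosonization reduces its multiplicativity to that of `D.comul`
and `bosTensor`, together with the conjugation rule for g ⊗ g. -/
theorem bosComul_inc (g : G) (r : R) :
    D.bosComul (Smash.inc D.act g r) = D.bosTensor (D.comul r) * D.grp g ⊗ₜ D.grp g := by
  have := Fintype.ofFinite G
  have : (∑ᶠ h : G, TensorProduct.map (Smash.inc D.act (h * g)) (Smash.inc D.act g ∘ₗ D.pr h)) =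
      LinearMap.mulRight k (D.grp g ⊗ₜ[k] D.grp g) ∘ₗ D.bosTensor := by
    ext r s
    rw [bosTensor, finsum_eq_sum_of_fintype, finsum_eq_sum_of_fintype]
    simp [LinearMap.sum_apply, inc_mul_grp]
  rw [bosComul, Smash.lift_inc, this]
  rfl

namespace IsBialg

/-- The comultiplication of the bosonization as an algebra map. -/
def comulHom (hD : D.IsBialg) : Smash D.act →ₐ[k] Smash D.act ⊗[k] Smash D.act :=
  AlgHom.ofLinearMap D.bosComul
    (by rw [Smash.one_def, bosComul_inc, hD.comul_one, hD.bosTensor_one, map_one, one_mul]; rfl)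
    (fun x y => by
      induction x using Smash.induction with
      | h0 => simp
      | hadd a b ha hb => simp [add_mul, ha, hb]
      | hinc g r =>
        induction y using Smash.induction with
        | h0 => simp
        | hadd a b ha hb => simp [mul_add, ha, hb]
        | hinc h s =>
          rw [Smash.inc_mul_inc, bosComul_inc, bosComul_inc, bosComul_inc, hD.comul_mul,
            hD.comul_act, hD.bosTensor_mul, mul_assoc, mul_assoc, ← mul_assoc (D.grp g ⊗ₜ D.grp g),
            grp_tmul_mul_bosTensor hD.toIsGraded, map_mul, mul_assoc,
            Algebra.TensorProduct.tmul_mul_tmul])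

@[simp]
theorem comulHom_apply (hD : D.IsBialg) (x : Smash D.act) : hD.comulHom x = D.bosComul x := rfl

end IsBialg

end

end Graded

end BraidedData

/-! ### The tensor algebra as a braided bialgebra. -/

namespace YDModule

variable {k G V : Type*} [Field k] [Group G] [AddCommGroup V] [Module k V] (M : YDModule k G V)

/-- The tensor algebra as a bialgebra in the category of Yetter-Drinfeld modules. -/
def tensorData : BraidedData k G (TensorAlgebra k V) where
  act := M.actT
  pr := M.prT
  comul := M.comulT
  counit := TensorAlgebra.algebraMapInv.toLinearMap

@[simp]
theorem actT_ι (g : G) (v : V) :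
    M.actT g (TensorAlgebra.ι k v) = TensorAlgebra.ι k (M.act g v) := by
  simp [actT]

/-- Homogeneity is expressed through the algebra map `coactT`, so that products of homogeneous
elements are homogeneous because products of `single`s are `single`s. -/
theorem mem_hom_iff {g : G} {a : TensorAlgebra k V} :
    a ∈ M.tensorData.hom g ↔ M.coactT a = MonoidAlgebra.single g a := by
  classical
  constructor
  · rintro ⟨h, h'⟩
    ext l
    rw [MonoidAlgebra.coeff_single, Finsupp.single_apply]
    split_ifs with hl
    · subst hl; exact h
    · exact h' l (Ne.symm hl)
  · intro h
    have key : ∀ l, M.prT l a = Finsupp.single g a l := fun l => by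
      change (M.coactT a).coeff l = _
      rw [h, MonoidAlgebra.coeff_single]
    exact ⟨(key g).trans (by simp), fun l hl => (key l).trans (by simp [hl.symm])⟩

/-- The sum of the `K g` is a subalgebra that contains V. Together with `eq_of_le_hom` this is an
induction principle for homogeneous elements: a property has to be checked only on 1, on homogeneous
vectors and on products. -/
theorem iSup_eq_top_of_mul_mem [Finite G] {K : G → Submodule k (TensorAlgebra k V)}
    (h1 : 1 ∈ K 1)
    (hι : ∀ g v, TensorAlgebra.ι k (M.pr g v) ∈ K g)
    (hmul : ∀ {g h a b}, a ∈ K g → b ∈ K h → a * b ∈ K (g * h)) : ⨆ g, K g = ⊤ := by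
  have := Fintype.ofFinite G
  have le : ∀ g, ∀ {a}, a ∈ K g → a ∈ ⨆ g, K g := fun g a ha => Submodule.mem_iSup_of_mem g ha
  refine eq_top_iff.mpr fun a _ => ?_
  induction a using TensorAlgebra.induction with
  | algebraMap r =>
    rw [Algebra.algebraMap_eq_smul_one]
    exact Submodule.smul_mem _ _ (le 1 h1)
  | ι v =>
    rw [← M.sum_pr v, finsum_eq_sum_of_fintype, map_sum]
    exact Submodule.sum_mem _ fun g _ => le g (hι g v)
  | mul a b ha hb =>
    refine Submodule.iSup_induction K (motive := fun a => a * b ∈ ⨆ g, K g) (ha trivial) ?_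
      (by simp) (fun x y hx hy => by rw [add_mul]; exact add_mem hx hy)
    intro g x hx
    exact Submodule.iSup_induction K (motive := fun b => x * b ∈ ⨆ g, K g) (hb trivial)
      (fun h y hy => le (g * h) (hmul hx hy)) (by simp)
      (fun y z hy hz => by rw [mul_add]; exact add_mem hy hz)
  | add a b ha hb => exact add_mem (ha trivial) (hb trivial)

theorem comulT_one : M.comulT 1 = 1 ⊗ₜ 1 := by simp [comulT]

variable [Finite G]

theorem prT_ι (g : G) (v : V) :
    M.prT g (TensorAlgebra.ι k v) = TensorAlgebra.ι k (M.pr g v) := by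
  classical
  have := Fintype.ofFinite G
  change (M.coactT _).coeff g = _
  rw [coactT, TensorAlgebra.lift_ι_apply, finsum_eq_sum_of_fintype, LinearMap.sum_apply,
    MonoidAlgebra.coeff_sum, Finsupp.finsetSum_apply, Finset.sum_eq_single g]
  · simp
  · intro h _ hne
    simp [hne]
  · simp

theorem ι_mem_hom {g : G} {v : V} (h : M.pr g v = v) :
    TensorAlgebra.ι k v ∈ M.tensorData.hom g :=
  ⟨(M.prT_ι g v).trans (by rw [h]), fun l hl => (M.prT_ι l v).trans (by
    rw [← h, M.pr_pr_ne l g v hl, map_zero])⟩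

theorem tensorData_isGraded : M.tensorData.IsGraded where
  one_mem := M.mem_hom_iff.mpr (by rw [map_one]; rfl)
  mul_mem hr hs := M.mem_hom_iff.mpr (by
    rw [map_mul, M.mem_hom_iff.mp hr, M.mem_hom_iff.mp hs, MonoidAlgebra.single_mul_single])
  iSup_hom := M.iSup_eq_top_of_mul_mem (M.mem_hom_iff.mpr (by rw [map_one]; rfl))
    (fun g v => M.ι_mem_hom (M.pr_pr_self g v)) (fun hr hs => M.mem_hom_iff.mpr (by
      rw [map_mul, M.mem_hom_iff.mp hr, M.mem_hom_iff.mp hs, MonoidAlgebra.single_mul_single]))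
  act_mem := by
    -- The elements of degree g whose translates by each h have degree h g h⁻¹. They span, hence
    -- exhaust the homogeneous components.
    let K (g : G) : Submodule k (TensorAlgebra k V) :=
      M.tensorData.hom g ⊓ ⨅ h, (M.tensorData.hom (h * g * h⁻¹)).comap (M.actT h).toLinearMap
    have one_mem : (1 : TensorAlgebra k V) ∈ M.tensorData.hom 1 :=
      M.mem_hom_iff.mpr (by rw [map_one]; rfl)
    have mul_mem : ∀ {g h r s}, r ∈ M.tensorData.hom g → s ∈ M.tensorData.hom h →
        r * s ∈ M.tensorData.hom (g * h) := fun hr hs => M.mem_hom_iff.mpr (by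
      rw [map_mul, M.mem_hom_iff.mp hr, M.mem_hom_iff.mp hs, MonoidAlgebra.single_mul_single])
    have hK : ⨆ g, K g = ⊤ := by
      refine M.iSup_eq_top_of_mul_mem ?_ ?_ ?_
      · refine ⟨one_mem, (Submodule.mem_iInf _).mpr fun h => ?_⟩
        simpa using one_mem
      · refine fun g v => ⟨M.ι_mem_hom (M.pr_pr_self g v), (Submodule.mem_iInf _).mpr fun h => ?_⟩
        simp only [Submodule.mem_comap, AlgHom.toLinearMap_apply, actT_ι]
        exact M.ι_mem_hom (by rw [M.act_pr, M.pr_pr_self])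
      · rintro g h a b ⟨ha, ha'⟩ ⟨hb, hb'⟩
        refine ⟨mul_mem ha hb, (Submodule.mem_iInf _).mpr fun l => ?_⟩
        have := mul_mem ((Submodule.mem_iInf _).mp ha' l) ((Submodule.mem_iInf _).mp hb' l)
        simpa [mul_assoc] using this
    intro g r h hr
    rw [← BraidedData.eq_of_le_hom (fun g => inf_le_left) hK g] at hr
    exact (Submodule.mem_iInf _).mp hr.2 h

theorem comulMulT_eq (v : V) (t : TensorAlgebra k V ⊗[k] TensorAlgebra k V) :
    M.comulMulT v t = M.tensorData.braidedMul
      (TensorAlgebra.ι k v ⊗ₜ 1 + 1 ⊗ₜ TensorAlgebra.ι k v) t := by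
  have := Fintype.ofFinite G
  have h : M.comulMulT v = M.tensorData.braidedMul
      (TensorAlgebra.ι k v ⊗ₜ 1 + 1 ⊗ₜ TensorAlgebra.ι k v) := by
    rw [map_add, comulMulT, finsum_eq_sum_of_fintype]
    ext a b
    simp only [LinearMap.add_apply, LinearMap.sum_apply, LinearMap.comp_apply,
      TensorProduct.AlgebraTensorModule.curry_apply, TensorProduct.curry_apply,
      LinearMap.coe_restrictScalars,
      BraidedData.braidedMul_tmul M.tensorData_isGraded.one_mem]
    congr 1
    · simp
    · rw [BraidedData.braidedMul, finsum_eq_sum_of_fintype, LinearMap.sum_apply,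
        LinearMap.sum_apply]
      refine Finset.sum_congr rfl fun g _ => ?_
      simp [tensorData, prT_ι]
  rw [h]

/-- Left multiplications in an associative algebra compose to left multiplications, so the operator
attached to a is left multiplication by its value at 1 ⊗ 1, which is `comulT a` by definition.
Multiplicativity of `comulT` is the case t = `comulT b`. -/
theorem lift_comulMulT (a : TensorAlgebra k V) (t : TensorAlgebra k V ⊗[k] TensorAlgebra k V) :
    TensorAlgebra.lift k M.comulMulT a t = M.tensorData.braidedMul (M.comulT a) t := by
  have hT := M.tensorData_isGraded
  induction a using TensorAlgebra.induction generalizing t with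
  | algebraMap r =>
    simp [comulT, hT.one_braidedMul, Algebra.algebraMap_eq_smul_one]
  | ι v => simp [comulT, comulMulT_eq, hT.braidedMul_one, TensorAlgebra.lift_ι_apply]
  | mul a b ha hb =>
    simp only [comulT, map_mul, Module.End.mul_apply, LinearMap.comp_apply,
      LinearMap.applyₗ_apply_apply, AlgHom.toLinearMap_apply] at ha hb ⊢
    rw [hb t, ha, ha (TensorAlgebra.lift k M.comulMulT b (1 ⊗ₜ 1)), hT.braidedMul_assoc]
  | add a b ha hb => simp only [map_add, LinearMap.add_apply, ha, hb]

theorem comulT_mul (a b : TensorAlgebra k V) :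
    M.comulT (a * b) = M.tensorData.braidedMul (M.comulT a) (M.comulT b) := by
  rw [← lift_comulMulT]
  simp [comulT]

theorem comulT_ι (v : V) :
    M.comulT (TensorAlgebra.ι k v) = TensorAlgebra.ι k v ⊗ₜ 1 + 1 ⊗ₜ TensorAlgebra.ι k v := by
  simp [comulT, comulMulT_eq, M.tensorData_isGraded.braidedMul_one, TensorAlgebra.lift_ι_apply]

omit [Finite G] in
theorem tensorData_counit_act (g : G) (r : TensorAlgebra k V) :
    M.tensorData.counit (M.tensorData.act g r) = M.tensorData.counit r := by
  have : TensorAlgebra.algebraMapInv.comp (M.actT g) =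
      (TensorAlgebra.algebraMapInv : TensorAlgebra k V →ₐ[k] k) := by
    ext; simp [TensorAlgebra.algebraMapInv]
  exact AlgHom.congr_fun this r

theorem tensorData_counit_hom {g : G} {r : TensorAlgebra k V} (hr : r ∈ M.tensorData.hom g)
    (hg : g ≠ 1) : M.tensorData.counit r = 0 := by
  have hT := M.tensorData_isGraded
  let K (g : G) : Submodule k (TensorAlgebra k V) :=
    M.tensorData.hom g ⊓ ⨅ _ : g ≠ 1, LinearMap.ker M.tensorData.counit
  have hK : ⨆ g, K g = ⊤ := by
    refine M.iSup_eq_top_of_mul_mem ?_ ?_ ?_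
    · exact ⟨hT.one_mem, (Submodule.mem_iInf _).mpr fun h => absurd rfl h⟩
    · refine fun g v => ⟨M.ι_mem_hom (M.pr_pr_self g v), (Submodule.mem_iInf _).mpr fun h => ?_⟩
      simp [tensorData, TensorAlgebra.algebraMapInv]
    · rintro g h a b ⟨ha, ha'⟩ ⟨hb, hb'⟩
      refine ⟨hT.mul_mem ha hb, (Submodule.mem_iInf _).mpr fun hgh => ?_⟩
      simp only [SetLike.mem_coe, Submodule.mem_iInf, LinearMap.mem_ker] at ha' hb' ⊢
      change TensorAlgebra.algebraMapInv (a * b) = 0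
      rw [map_mul]
      by_cases hg : g = 1
      · exact mul_eq_zero_of_right _ (hb' (by rintro rfl; exact hgh (by simp [hg])))
      · exact mul_eq_zero_of_left (ha' hg) _
  rw [← BraidedData.eq_of_le_hom (fun g => inf_le_left) hK g] at hr
  exact (Submodule.mem_iInf _).mp hr.2 hg

theorem tensorData_isBialg : M.tensorData.IsBialg where
  toIsGraded := M.tensorData_isGraded
  comul_one := M.comulT_one
  comul_mul := M.comulT_mul
  comul_act g a := by
    change M.comulT (M.actT g a) =
      TensorProduct.map (M.tensorData.act g).toLinearMap (M.tensorData.act g).toLinearMap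
        (M.comulT a)
    induction a using TensorAlgebra.induction with
    | algebraMap r => simp [Algebra.algebraMap_eq_smul_one, comulT_one]
    | ι v => simp [comulT_ι, tensorData]
    | mul a b ha hb =>
      rw [map_mul, comulT_mul, comulT_mul, M.tensorData_isGraded.map_act_braidedMul, ha, hb]
    | add a b ha hb => simp only [map_add, ha, hb]
  comul_mem := by
    have hT := M.tensorData_isGraded
    let K (g : G) : Submodule k (TensorAlgebra k V) :=
      M.tensorData.hom g ⊓ (M.tensorData.hom2 g).comap M.comulT
    have hK : ⨆ g, K g = ⊤ := by
      refine M.iSup_eq_top_of_mul_mem ?_ ?_ ?_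
      · refine ⟨hT.one_mem, ?_⟩
        rw [SetLike.mem_coe, Submodule.mem_comap, comulT_one]
        exact M.tensorData.tmul_mem_hom2 hT.one_mem hT.one_mem (one_mul 1)
      · refine fun g v => ⟨M.ι_mem_hom (M.pr_pr_self g v), ?_⟩
        rw [SetLike.mem_coe, Submodule.mem_comap, comulT_ι]
        have := M.ι_mem_hom (M.pr_pr_self g v)
        exact add_mem (M.tensorData.tmul_mem_hom2 this hT.one_mem (mul_one g))
          (M.tensorData.tmul_mem_hom2 hT.one_mem this (one_mul g))
      · rintro g h a b ⟨ha, ha'⟩ ⟨hb, hb'⟩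
        refine ⟨hT.mul_mem ha hb, ?_⟩
        rw [SetLike.mem_coe, Submodule.mem_comap, comulT_mul]
        exact hT.braidedMul_mem_hom2 ha' hb'
    intro g r hr
    rw [← BraidedData.eq_of_le_hom (fun g => inf_le_left) hK g] at hr
    exact hr.2
  counit_one := map_one TensorAlgebra.algebraMapInv
  counit_mul := map_mul TensorAlgebra.algebraMapInv
  counit_act := M.tensorData_counit_act
  counit_hom := M.tensorData_counit_hom
  rid_comul a := by
    have hT := M.tensorData_isGraded
    change TensorProduct.rid k _ (M.tensorData.counit.lTensor _ (M.comulT a)) = a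
    induction a using TensorAlgebra.induction with
    | algebraMap r => simp [Algebra.algebraMap_eq_smul_one, comulT_one, tensorData]
    | ι v => simp [comulT_ι, tensorData, TensorAlgebra.algebraMapInv]
    | mul a b ha hb =>
      rw [comulT_mul, hT.rid_braidedMul (map_mul TensorAlgebra.algebraMapInv)
        M.tensorData_counit_hom, ha, hb]
    | add a b ha hb => simp only [map_add, ha, hb]
  lid_comul a := by
    have hT := M.tensorData_isGraded
    change TensorProduct.lid k _ (M.tensorData.counit.rTensor _ (M.comulT a)) = a
    induction a using TensorAlgebra.induction with
    | algebraMap r => simp [Algebra.algebraMap_eq_smul_one, comulT_one, tensorData]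
    | ι v => simp [comulT_ι, tensorData, TensorAlgebra.algebraMapInv]
    | mul a b ha hb =>
      rw [comulT_mul, hT.lid_braidedMul (map_mul TensorAlgebra.algebraMapInv)
        M.tensorData_counit_act, ha, hb]
    | add a b ha hb => simp only [map_add, ha, hb]

end YDModule

open Finset.HasAntidiagonal (antidiagonal mem_antidiagonal)

/-! ### Truncated `q`-exponentials -/

section QCalculus

variable {k : Type*} [Field k]

/-- The quantum number `(n)_q`. -/
def qNumber (q : k) (n : ℕ) : k := ∑ l ∈ Finset.range n, q ^ l

theorem qNumber_zero (q : k) : qNumber q 0 = 0 := by simp [qNumber]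

theorem qNumber_add (q : k) (m n : ℕ) : qNumber q (m + n) = qNumber q m + q ^ m * qNumber q n := by
  simp [qNumber, Finset.sum_range_add, Finset.mul_sum, pow_add]

theorem qFactorial_succ (q : k) (n : ℕ) :
    qFactorial q (n + 1) = qNumber q (n + 1) * qFactorial q n := by
  rw [qFactorial, Finset.prod_range_succ, mul_comm]; rfl

theorem qNumber_mul_sub_one (q : k) (n : ℕ) : qNumber q n * (q - 1) = q ^ n - 1 :=
  geom_sum_mul q n

/-- `q ≠ 1` is a root of unity of order `N`. -/
structure IsQRoot (q : k) (N : ℕ) : Prop where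
  ne_one : q ≠ 1
  order : orderOf q = N
  pos : 0 < N

namespace IsQRoot

variable {q : k} {N : ℕ} (h : IsQRoot q N)

include h

theorem pow_eq_one : q ^ N = 1 := h.order ▸ pow_orderOf_eq_one q

theorem two_le : 2 ≤ N := by
  have h1 : N ≠ 1 := fun e => h.ne_one (orderOf_eq_one_iff.mp (h.order.trans e))
  have := h.pos
  omega

theorem qNumber_eq_zero : qNumber q N = 0 := by
  have := qNumber_mul_sub_one q N
  rw [h.pow_eq_one, sub_self] at this
  exact (mul_eq_zero.mp this).resolve_right (sub_ne_zero.mpr h.ne_one)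

theorem qNumber_ne_zero {m : ℕ} (h0 : m ≠ 0) (hm : m < N) : qNumber q m ≠ 0 := fun e => by
  have := qNumber_mul_sub_one q m
  rw [e, zero_mul, eq_comm, sub_eq_zero] at this
  exact pow_ne_one_of_lt_orderOf h0 (h.order.symm ▸ hm) this

theorem qFactorial_ne_zero {m : ℕ} (hm : m < N) : qFactorial q m ≠ 0 := by
  induction m with
  | zero => simp [qFactorial]
  | succ m ih =>
    rw [qFactorial_succ]
    exact mul_ne_zero (h.qNumber_ne_zero m.succ_ne_zero hm) (ih (by omega))

theorem qNumber_add_self (m : ℕ) : qNumber q (N + m) = qNumber q m := by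
  rw [qNumber_add, h.qNumber_eq_zero, h.pow_eq_one, zero_add, one_mul]

end IsQRoot

variable {E : Type*} [Ring E] [Algebra k E] (q : k) (N : ℕ)

/-- The divided power `a ^ n / (n)_q!`, truncated at `N`. -/
def divPow (a : E) (n : ℕ) : E := if n < N then (qFactorial q n)⁻¹ • a ^ n else 0

/-- The component of degree `n` of the product of the truncated exponentials of `a` and `b`. -/
def expMul (a b : E) (n : ℕ) : E :=
  ∑ p ∈ antidiagonal n, divPow q N a p.1 * divPow q N b p.2

variable {q N}

theorem divPow_of_le {n : ℕ} (hn : N ≤ n) (a : E) : divPow q N a n = 0 := if_neg hn.not_gt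

theorem divPow_zero (hN : 0 < N) (a : E) : divPow q N a 0 = 1 := by
  simp [divPow, hN, qFactorial]

/-- The usual recursion of divided powers, with the term that the truncation loses: for n + 1 = N
the regular term is 0 and only a^N / (N - 1)_q! remains. -/
theorem divPow_mul_self (h : IsQRoot q N) (a : E) (n : ℕ) :
    divPow q N a n * a = qNumber q (n + 1) • divPow q N a (n + 1) +
      if n + 1 = N then (qFactorial q n)⁻¹ • a ^ N else 0 := by
  rcases lt_trichotomy (n + 1) N with hn | hn | hn
  · rw [divPow, divPow, if_pos hn, if_pos (by omega), if_neg hn.ne, add_zero, qFactorial_succ,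
      smul_smul, mul_inv, mul_inv_cancel_left₀ (h.qNumber_ne_zero n.succ_ne_zero hn),
      smul_mul_assoc, ← pow_succ]
  · rw [divPow, divPow, if_neg hn.not_lt, if_pos (by omega), if_pos hn, smul_zero, zero_add,
      smul_mul_assoc, ← pow_succ, hn]
  · rw [divPow_of_le (by omega), divPow_of_le (by omega), if_neg hn.ne', zero_mul, smul_zero,
      add_zero]

theorem pow_mul_of_mul_eq {a b : E} (hab : b * a = q • (a * b)) (n : ℕ) :
    b ^ n * a = q ^ n • (a * b ^ n) := by
  induction n with
  | zero => simp
  | succ n ih =>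
    rw [pow_succ, mul_assoc, hab, mul_smul_comm, ← mul_assoc, ih, smul_mul_assoc, smul_smul,
      mul_assoc, pow_succ q, mul_comm q]

theorem divPow_mul_of_mul_eq {a b : E} (hab : b * a = q • (a * b)) (n : ℕ) :
    divPow q N b n * a = q ^ n • (a * divPow q N b n) := by
  rw [divPow]
  split_ifs
  · rw [smul_mul_assoc, pow_mul_of_mul_eq hab, mul_smul_comm, smul_comm]
  · simp

/-- Moving a past b^j costs q^j, and (i + j)_q = (j)_q + q^j (i)_q. So multiplication by a + b
raises the degree by one with the factor (n + 1)_q, up to truncation terms that contain a^N or b^N.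
-/
theorem expMul_mul_add (h : IsQRoot q N) {a b : E} (hab : b * a = q • (a * b)) (n : ℕ) :
    expMul q N a b n * (a + b) = qNumber q (n + 1) • expMul q N a b (n + 1) +
      ∑ p ∈ antidiagonal n,
        (q ^ p.2 • ((if p.1 + 1 = N then (qFactorial q p.1)⁻¹ • a ^ N else 0) * divPow q N b p.2) +
          divPow q N a p.1 * (if p.2 + 1 = N then (qFactorial q p.2)⁻¹ • b ^ N else 0)) := by
  -- Shifting the index adds a term with p.1 = 0, which vanishes because (0)_q = 0; likewise for p.2
  -- in `hb`.
  have ha : ∑ p ∈ antidiagonal n,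
      (q ^ p.2 * qNumber q (p.1 + 1)) • (divPow q N a (p.1 + 1) * divPow q N b p.2) =
      ∑ p ∈ antidiagonal (n + 1),
        (q ^ p.2 * qNumber q p.1) • (divPow q N a p.1 * divPow q N b p.2) := by
    rw [Finset.Nat.sum_antidiagonal_succ]; simp [qNumber_zero]
  have hb : ∑ p ∈ antidiagonal n,
      qNumber q (p.2 + 1) • (divPow q N a p.1 * divPow q N b (p.2 + 1)) =
      ∑ p ∈ antidiagonal (n + 1),
        qNumber q p.2 • (divPow q N a p.1 * divPow q N b p.2) := by
    rw [Finset.Nat.sum_antidiagonal_succ']; simp [qNumber_zero]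
  have hs : qNumber q (n + 1) • expMul q N a b (n + 1) =
      (∑ p ∈ antidiagonal n,
        (q ^ p.2 * qNumber q (p.1 + 1)) • (divPow q N a (p.1 + 1) * divPow q N b p.2)) +
      ∑ p ∈ antidiagonal n,
        qNumber q (p.2 + 1) • (divPow q N a p.1 * divPow q N b (p.2 + 1)) := by
    rw [ha, hb, ← Finset.sum_add_distrib, expMul, Finset.smul_sum]
    refine Finset.sum_congr rfl fun p hp => ?_
    rw [← add_smul, ← mem_antidiagonal.mp hp, add_comm p.1 p.2, qNumber_add,
      add_comm (qNumber q p.2)]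
  rw [hs, ← Finset.sum_add_distrib, ← Finset.sum_add_distrib, expMul, Finset.sum_mul]
  refine Finset.sum_congr rfl fun p _ => ?_
  rw [mul_add, mul_assoc, divPow_mul_of_mul_eq hab, mul_smul_comm, ← mul_assoc,
    divPow_mul_self h a, mul_assoc, divPow_mul_self h b, add_mul, mul_add, smul_add,
    smul_mul_assoc, mul_smul_comm, smul_smul]
  abel

/-- The q-binomial theorem. Below degree N there are no truncation terms, and both sides satisfy a
recursion whose factors (n + 1)_q are invertible. -/
theorem expMul_eq_divPow (h : IsQRoot q N) {a b : E} (hab : b * a = q • (a * b)) {n : ℕ}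
    (hn : n < N) : expMul q N a b n = divPow q N (a + b) n := by
  induction n with
  | zero => simp [expMul, divPow_zero h.pos]
  | succ n ih =>
    have h1 := expMul_mul_add h hab n
    rw [Finset.sum_eq_zero, add_zero, ih (by omega), divPow_mul_self h, if_neg hn.ne,
      add_zero] at h1
    · have := h.qNumber_ne_zero n.succ_ne_zero hn
      exact ((smul_right_injective E this) h1).symm
    · intro p hp
      have := mem_antidiagonal.mp hp
      rw [if_neg (by omega), if_neg (by omega), zero_mul, smul_zero, mul_zero, add_zero]

/-- The recursion at n = N - 1: since (N)_q = 0, the regular terms disappear and the truncation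
terms a^N and b^N are all that remains, with the common factor 1 / (N - 1)_q!. -/
theorem add_pow_of_mul_eq (h : IsQRoot q N) {a b : E} (hab : b * a = q • (a * b)) :
    (a + b) ^ N = a ^ N + b ^ N := by
  obtain ⟨n, rfl⟩ : ∃ n, N = n + 1 := ⟨N - 1, by have := h.pos; omega⟩
  have hf : (qFactorial q n)⁻¹ ≠ 0 := inv_ne_zero (h.qFactorial_ne_zero (by omega))
  have h1 := expMul_mul_add h hab n
  rw [expMul_eq_divPow h hab (by omega), divPow_mul_self h, h.qNumber_eq_zero, zero_smul,
    zero_smul, zero_add, zero_add, if_pos rfl, Finset.sum_add_distrib,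
    Finset.sum_eq_single (n, 0), Finset.sum_eq_single (0, n)] at h1
  · simp only [if_true, divPow_zero h.pos, pow_zero, one_smul, mul_one, one_mul, ← smul_add] at h1
    exact smul_right_injective E hf h1
  · rintro ⟨i, j⟩ hp hne
    have := mem_antidiagonal.mp hp
    rw [if_neg, mul_zero]
    rintro (e : j + 1 = n + 1)
    exact hne (Prod.ext (by simp at *; omega) (by simp at *; omega))
  · simp
  · rintro ⟨i, j⟩ hp hne
    have := mem_antidiagonal.mp hp
    rw [if_neg, zero_mul, smul_zero]
    rintro (e : i + 1 = n + 1)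
    exact hne (Prod.ext (by simp at *; omega) (by simp at *; omega))
  · simp

/-- The recursion cannot cross degree N, where (N)_q = 0, but it restarts there: without truncation
terms its factor in degree N + n is (N + n)_q = (n)_q, the same as for the divided powers of a + b.
-/
theorem expMul_mul_divPow (h : IsQRoot q N) {a b : E} (hab : b * a = q • (a * b)) (ha : a ^ N = 0)
    (hb : b ^ N = 0) {n : ℕ} (hn : n < N) :
    expMul q N a b N * divPow q N (a + b) n = expMul q N a b (N + n) := by
  induction n with
  | zero => rw [divPow_zero h.pos, mul_one, add_zero]
  | succ n ih =>
    have h1 := expMul_mul_add h hab (N + n)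
    rw [Finset.sum_eq_zero (fun p _ => by simp [ha, hb]), add_zero, ← ih (by omega), mul_assoc,
      divPow_mul_self h, if_neg hn.ne, add_zero, mul_smul_comm, add_assoc, h.qNumber_add_self] at h1
    exact smul_right_injective E (h.qNumber_ne_zero n.succ_ne_zero hn) h1

/-- The component of degree `n` of the product of the truncated exponentials of `a`, `b`, `c`. -/
theorem expMul_assoc (a b c : E) (n : ℕ) :
    ∑ p ∈ antidiagonal n, divPow q N a p.1 * expMul q N b c p.2 =
      ∑ p ∈ antidiagonal n, expMul q N a b p.1 * divPow q N c p.2 := by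
  have := congrArg (PowerSeries.coeff n) (mul_assoc (PowerSeries.mk (divPow q N a))
    (PowerSeries.mk (divPow q N b)) (PowerSeries.mk (divPow q N c)))
  simpa only [PowerSeries.coeff_mul, PowerSeries.coeff_mk, expMul] using this.symm

/-- The central identity. Expanded in ξ, the linear coefficient of either side is the degree N part
of the product of the truncated exponentials of a, b and c, and the quadratic coefficient is its
degree 2N part. The two sides only bracket this product differently. -/
theorem expMul_twist (h : IsQRoot q N) {a b c : E} (hab : b * a = q • (a * b))
    (hbc : c * b = q • (b * c)) (hac : c * a = q • (a * c)) (ha : a ^ N = 0) (hb : b ^ N = 0)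
    (hc : c ^ N = 0) (ξ : k) :
    (1 + ξ • expMul q N b c N) * (1 + ξ • expMul q N a (b + c) N) =
      (1 + ξ • expMul q N a b N) * (1 + ξ • expMul q N (a + b) c N) := by
  have hN := h.pos
  have h1 : expMul q N b c N + expMul q N a (b + c) N =
      expMul q N a b N + expMul q N (a + b) c N := by
    -- The term without a is `expMul q N b c N`. In the other terms the degree in b, c is below N,
    -- so the q-binomial theorem gives a divided power of b + c.
    have e1 : expMul q N b c N + expMul q N a (b + c) N =
        ∑ p ∈ antidiagonal N, divPow q N a p.1 * expMul q N b c p.2 := by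
      rw [expMul.eq_def q N a (b + c), Finset.Nat.sum_antidiagonal_eq_sum_range_succ_mk,
        Finset.Nat.sum_antidiagonal_eq_sum_range_succ_mk, Finset.sum_range_succ', Finset.sum_range_succ' (n := N)]
      simp only [divPow_zero hN, Nat.sub_zero, one_mul,
        divPow_of_le le_rfl, add_zero]
      rw [add_comm]
      congr 1
      refine Finset.sum_congr rfl fun i hi => ?_
      rw [expMul_eq_divPow h hbc (by omega)]
    have e2 : expMul q N a b N + expMul q N (a + b) c N =
        ∑ p ∈ antidiagonal N, expMul q N a b p.1 * divPow q N c p.2 := by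
      rw [expMul.eq_def q N (a + b) c, Finset.Nat.sum_antidiagonal_eq_sum_range_succ_mk,
        Finset.Nat.sum_antidiagonal_eq_sum_range_succ_mk, Finset.sum_range_succ, Finset.sum_range_succ (n := N)]
      simp only [divPow_zero hN, Nat.sub_self, mul_one,
        divPow_of_le le_rfl, add_zero]
      rw [add_comm]
      congr 1
      refine Finset.sum_congr rfl fun i hi => ?_
      rw [expMul_eq_divPow h hab (by simpa using hi)]
    rw [e1, e2, expMul_assoc]
  -- Two truncated exponentials have a product of degree at most 2 (N - 1), so everything from
  -- degree 2N - 1 on vanishes.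
  have big : ∀ x y : E, ∀ n, 2 * N ≤ n + 1 → expMul q N x y n = 0 := fun x y n hn =>
    Finset.sum_eq_zero fun p hp => by
      have := mem_antidiagonal.mp hp
      by_cases h1 : N ≤ p.1
      · rw [divPow_of_le h1, zero_mul]
      · rw [divPow_of_le (n := p.2) (by omega), mul_zero]
  -- Every monomial of degree N in b and c passes a with the factor q^N = 1.
  have hcomm : ∀ n, expMul q N b c N * divPow q N a n = divPow q N a n * expMul q N b c N := by
    intro n
    have key : expMul q N b c N * a = a * expMul q N b c N := by
      rw [expMul, Finset.sum_mul, Finset.mul_sum]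
      refine Finset.sum_congr rfl fun p hp => ?_
      rw [mul_assoc, divPow_mul_of_mul_eq hac, mul_smul_comm, ← mul_assoc,
        divPow_mul_of_mul_eq hab, smul_mul_assoc, smul_smul, ← pow_add, add_comm p.2,
        mem_antidiagonal.mp hp, h.pow_eq_one, one_smul, mul_assoc]
    rw [divPow]
    split_ifs
    · exact ((Commute.pow_right key n).smul_right _).eq
    · simp
  have h2 : expMul q N b c N * expMul q N a (b + c) N =
      expMul q N a b N * expMul q N (a + b) c N := by
    have e1 : expMul q N b c N * expMul q N a (b + c) N =
        ∑ p ∈ antidiagonal (N + N), divPow q N a p.1 * expMul q N b c p.2 := by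
      rw [Finset.Nat.sum_antidiagonal_eq_sum_range_succ_mk, Nat.succ_eq_add_one, add_assoc,
        Finset.sum_range_add, expMul.eq_def q N a (b + c), Finset.Nat.sum_antidiagonal_eq_sum_range_succ_mk,
        Finset.mul_sum, Nat.succ_eq_add_one, Finset.sum_range_succ]
      simp only [Nat.sub_self, divPow_of_le le_rfl, zero_mul,
        mul_zero, add_zero]
      rw [Finset.sum_eq_zero (s := Finset.range (N + 1))
        (fun i _ => by rw [divPow_of_le (by omega), zero_mul]), add_zero]
      refine Finset.sum_congr rfl fun i hi => ?_
      rw [← mul_assoc, hcomm, mul_assoc]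
      -- At i = 0 both sides vanish: the left contains the divided power of order N of b + c, the
      -- right the part of degree 2N in b and c.
      rcases Nat.eq_zero_or_pos i with rfl | hi0
      · rw [Nat.sub_zero, Nat.sub_zero, divPow_of_le le_rfl, mul_zero,
          big b c _ (by omega)]
      · have hi := Finset.mem_range.mp hi
        rw [expMul_mul_divPow h hbc hb hc (by omega), Nat.add_sub_assoc hi.le]
    have e2 : expMul q N a b N * expMul q N (a + b) c N =
        ∑ p ∈ antidiagonal (N + N), expMul q N a b p.1 * divPow q N c p.2 := by
      -- After the swap the summation index is the exponent of c, which plays the role that the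
      -- exponent of a has in `e1`. Here no commutation is needed.
      rw [← Finset.Nat.sum_antidiagonal_swap]
      rw [Finset.Nat.sum_antidiagonal_eq_sum_range_succ_mk, Nat.succ_eq_add_one, add_assoc,
        Finset.sum_range_add, expMul.eq_def q N (a + b) c, ← Finset.Nat.sum_antidiagonal_swap,
        Finset.Nat.sum_antidiagonal_eq_sum_range_succ_mk,
        Finset.mul_sum, Nat.succ_eq_add_one, Finset.sum_range_succ]
      simp only [Prod.fst_swap, Prod.snd_swap, Nat.sub_self,
        divPow_of_le le_rfl, mul_zero, add_zero]
      rw [Finset.sum_eq_zero (s := Finset.range (N + 1))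
        (fun i _ => by rw [divPow_of_le (by omega), mul_zero]), add_zero]
      refine Finset.sum_congr rfl fun i hi => ?_
      rw [← mul_assoc]
      rcases Nat.eq_zero_or_pos i with rfl | hi0
      · rw [Nat.sub_zero, Nat.sub_zero, divPow_of_le le_rfl, mul_zero, zero_mul,
          big a b _ (by omega), zero_mul]
      · have hi := Finset.mem_range.mp hi
        rw [expMul_mul_divPow h hab ha hb (by omega), Nat.add_sub_assoc hi.le]
    rw [e1, e2, expMul_assoc]
  have e : ∀ s t : E, (1 + s) * (1 + t) = 1 + (s + t) + s * t := fun s t => by noncomm_ring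
  rw [e, e, ← smul_add, ← smul_add, h1, smul_mul_smul_comm, smul_mul_smul_comm, h2]

end QCalculus

namespace BraidedData

/-! ### Morphisms and diagonal primitive elements -/

section Hom

variable {k G Γ R R' : Type*} [Field k] [Group G] [Group Γ] [Finite G] [Finite Γ] [Ring R]
  [Algebra k R] [Ring R'] [Algebra k R'] (D : BraidedData k Γ R) (D' : BraidedData k G R')

/-- Algebra maps compatible with actions and gradings along a group homomorphism. -/
structure IsYDHom (φ : Γ →* G) (f : R →ₐ[k] R') : Prop where
  map_act : ∀ g r, f (D.act g r) = D'.act (φ g) (f r)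
  map_mem : ∀ {g r}, r ∈ D.hom g → f r ∈ D'.hom (φ g)

variable {D D'} {φ : Γ →* G} {f : R →ₐ[k] R'}

theorem IsYDHom.map_braidedMul (hf : IsYDHom D D' φ f) (hD : D.IsGraded) (X Y : R ⊗[k] R) :
    TensorProduct.map f.toLinearMap f.toLinearMap (D.braidedMul X Y) =
      D'.braidedMul (TensorProduct.map f.toLinearMap f.toLinearMap X)
        (TensorProduct.map f.toLinearMap f.toLinearMap Y) := by
  have : D.braidedMul.compr₂ (TensorProduct.map f.toLinearMap f.toLinearMap) =
      D'.braidedMul.compl₁₂ (TensorProduct.map f.toLinearMap f.toLinearMap)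
        (TensorProduct.map f.toLinearMap f.toLinearMap) :=
    tensor_hom_ext hD.iSup_hom fun a b r hr s hs => tensor_hom_ext hD.iSup_hom
      fun a' b' r' hr' s' hs' => by
        simp only [LinearMap.compr₂_apply, LinearMap.compl₁₂_apply, braidedMul_tmul hs,
          TensorProduct.map_tmul, AlgHom.toLinearMap_apply, braidedMul_tmul (hf.map_mem hs),
          hf.map_act, map_mul f]
  exact LinearMap.congr_fun (LinearMap.congr_fun this X) Y

omit [Finite G] [Finite Γ] in
theorem IsYDHom.map_hom2 (hf : IsYDHom D D' φ f) {g : Γ} {X : R ⊗[k] R} (hX : X ∈ D.hom2 g) :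
    TensorProduct.map f.toLinearMap f.toLinearMap X ∈ D'.hom2 (φ g) := by
  suffices D.hom2 g ≤ (D'.hom2 (φ g)).comap (TensorProduct.map f.toLinearMap f.toLinearMap) from
    this hX
  refine Submodule.span_le.mpr ?_
  rintro _ ⟨a, b, r, s, hr, hs, rfl, rfl⟩
  exact D'.tmul_mem_hom2 (hf.map_mem hr) (hf.map_mem hs) (map_mul φ a b).symm

/-- Axioms pass to a quotient by lifting elements. The axioms on homogeneous elements need
homogeneous lifts, which are obtained by projecting any lift to its component of the right degree.
-/
theorem IsBialg.of_surjective {D' : BraidedData k Γ R'} (hD : D.IsBialg)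
    (hf : IsYDHom D D' (MonoidHom.id Γ) f) (hsurj : Function.Surjective f)
    (hpr : ∀ g r, D'.pr g (f r) = f (D.pr g r))
    (hcomul : ∀ r, D'.comul (f r) = TensorProduct.map f.toLinearMap f.toLinearMap (D.comul r))
    (hcounit : ∀ r, D'.counit (f r) = D.counit r) : D'.IsBialg := by
  have lift : ∀ {g r}, r ∈ D'.hom g → ∃ s ∈ D.hom g, f s = r := fun {g r} hr => by
    obtain ⟨s, rfl⟩ := hsurj r
    exact ⟨D.pr g s, pr_mem_hom hD.iSup_hom g s, by rw [← hpr, pr_of_mem hr]⟩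
  refine ⟨⟨?_, ?_, ?_, ?_⟩, ?_, ?_, ?_, ?_, ?_, ?_, ?_, ?_, ?_, ?_⟩
  · refine eq_top_iff.mpr fun r _ => ?_
    obtain ⟨s, rfl⟩ := hsurj r
    exact hom_induction (p := fun s => f s ∈ ⨆ g, D'.hom g) hD.iSup_hom s
      (fun g s hs => Submodule.mem_iSup_of_mem g (hf.map_mem hs)) (by simp)
      (fun x y hx hy => by rw [map_add]; exact add_mem hx hy)
  · rw [← map_one f]; exact hf.map_mem hD.one_mem
  · intro g h r s hr hs
    obtain ⟨r, hr', rfl⟩ := lift hr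
    obtain ⟨s, hs', rfl⟩ := lift hs
    rw [← map_mul f]; exact hf.map_mem (hD.mul_mem hr' hs')
  · intro g r h hr
    obtain ⟨r, hr', rfl⟩ := lift hr
    have := hf.map_act h r
    rw [MonoidHom.id_apply] at this
    rw [← this]; exact hf.map_mem (hD.act_mem h hr')
  · rw [← map_one f, hcomul, hD.comul_one]; rfl
  · intro r s
    obtain ⟨r, rfl⟩ := hsurj r
    obtain ⟨s, rfl⟩ := hsurj s
    rw [← map_mul f, hcomul, hcomul, hcomul, hD.comul_mul, hf.map_braidedMul hD.toIsGraded]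
  · intro g r
    obtain ⟨r, rfl⟩ := hsurj r
    have := hf.map_act g
    simp only [MonoidHom.id_apply] at this
    rw [← this, hcomul, hcomul, hD.comul_act]
    induction D.comul r with
    | zero => simp
    | add X Y hX hY => simp only [map_add, hX, hY]
    | tmul r s => simp [this]
  · intro g r hr
    obtain ⟨r, hr', rfl⟩ := lift hr
    rw [hcomul]; exact hf.map_hom2 (hD.comul_mem hr')
  · rw [← map_one f, hcounit, hD.counit_one]
  · intro r s
    obtain ⟨r, rfl⟩ := hsurj r
    obtain ⟨s, rfl⟩ := hsurj s
    rw [← map_mul f, hcounit, hcounit, hcounit, hD.counit_mul]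
  · intro g r
    obtain ⟨r, rfl⟩ := hsurj r
    have := hf.map_act g r
    rw [MonoidHom.id_apply] at this
    rw [← this, hcounit, hcounit, hD.counit_act]
  · intro g r hr hg
    obtain ⟨r, hr', rfl⟩ := lift hr
    rw [hcounit, hD.counit_hom hr' hg]
  · intro r
    obtain ⟨r, rfl⟩ := hsurj r
    have e : ∀ X, TensorProduct.rid k R' (D'.counit.lTensor R'
        (TensorProduct.map f.toLinearMap f.toLinearMap X)) =
        f (TensorProduct.rid k R (D.counit.lTensor R X)) := fun X => by
      induction X with
      | zero => simp
      | add X Y hX hY => simp only [map_add, hX, hY]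
      | tmul r s => simp [hcounit]
    rw [hcomul, e, hD.rid_comul]
  · intro r
    obtain ⟨r, rfl⟩ := hsurj r
    have e : ∀ X, TensorProduct.lid k R' (D'.counit.rTensor R'
        (TensorProduct.map f.toLinearMap f.toLinearMap X)) =
        f (TensorProduct.lid k R (D.counit.rTensor R X)) := fun X => by
      induction X with
      | zero => simp
      | add X Y hX hY => simp only [map_add, hX, hY]
      | tmul r s => simp [hcounit]
    rw [hcomul, e, hD.lid_comul]

end Hom

section Diag

variable {k G R : Type*} [Field k] [Group G] [Ring R] [Algebra k R] (D : BraidedData k G R)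

/-- Primitive elements of degree `g` that span a representation with character `χ`. -/
structure IsDiag (g : G) (χ : G →* kˣ) (y : R) : Prop where
  mem : y ∈ D.hom g
  act : ∀ h, D.act h y = (χ h : k) • y
  comul : D.comul y = y ⊗ₜ 1 + 1 ⊗ₜ y
  counit : D.counit y = 0

/-- The inclusion `r ↦ r # 1`. -/
def incHom : R →ₐ[k] Smash D.act :=
  AlgHom.ofLinearMap (Smash.inc D.act 1) rfl fun r s => by simp [Smash.inc_mul_inc]

theorem incHom_apply (r : R) : D.incHom r = Smash.inc D.act 1 r := rfl

variable {D} {g g' : G} {χ χ' : G →* kˣ} {y y' : R}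

theorem IsDiag.grp_mul (hy : D.IsDiag g χ y) (h : G) :
    D.grp h * D.incHom y = (χ h : k) • (D.incHom y * D.grp h) := by
  rw [incHom_apply, grp_mul_inc, inc_mul_grp, hy.act, map_smul, mul_one, one_mul]

theorem IsDiag.grp_tmul_mul (hy' : D.IsDiag g' χ' y') (g : G) (y : R) :
    (D.grp g ⊗ₜ[k] D.incHom y) * (D.incHom y' ⊗ₜ[k] 1) =
      (χ' g : k) • ((D.incHom y' ⊗ₜ[k] 1) * (D.grp g ⊗ₜ[k] D.incHom y)) := by
  simp [hy'.grp_mul, TensorProduct.smul_tmul']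

theorem IsGraded.pow_mem (hD : D.IsGraded) (hy : y ∈ D.hom g) (n : ℕ) : y ^ n ∈ D.hom (g ^ n) := by
  induction n with
  | zero => simpa using hD.one_mem
  | succ n ih => rw [pow_succ, pow_succ]; exact hD.mul_mem ih hy

variable [Finite G]

theorem bosTensor_comul (r : R) : D.bosTensor (D.comul r) = D.bosComul (D.incHom r) := by
  rw [incHom_apply, bosComul_inc, map_one, ← Algebra.TensorProduct.one_def, mul_one]

theorem bosTensor_tmul_one (hD : D.IsGraded) (r : R) : D.bosTensor (r ⊗ₜ 1) = D.incHom r ⊗ₜ 1 :=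
  bosTensor_tmul hD.one_mem r

theorem bosTensor_one_tmul (hy : y ∈ D.hom g) : D.bosTensor (1 ⊗ₜ y) = D.grp g ⊗ₜ D.incHom y :=
  bosTensor_tmul hy 1

theorem IsDiag.bosComul (hD : D.IsGraded) (hy : D.IsDiag g χ y) :
    D.bosComul (D.incHom y) = D.incHom y ⊗ₜ 1 + D.grp g ⊗ₜ D.incHom y := by
  rw [← bosTensor_comul, hy.comul, map_add, bosTensor_tmul_one hD, bosTensor_one_tmul hy.mem]

/-- In the bosonization Δ(y) = y ⊗ 1 + g ⊗ y, and the two summands q-commute with q = χ(g) of order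
N, so the N-th power of the sum is the sum of the N-th powers. -/
theorem IsDiag.comul_pow (hD : D.IsBialg) (hy : D.IsDiag g χ y) {N : ℕ}
    (hN : IsQRoot (χ g : k) N) : D.comul (y ^ N) = (y ^ N) ⊗ₜ 1 + 1 ⊗ₜ (y ^ N) := by
  apply hD.bosTensor_injective
  rw [map_add, bosTensor_tmul_one hD.toIsGraded, bosTensor_one_tmul (hD.pow_mem hy.mem N),
    bosTensor_comul, map_pow, ← hD.comulHom_apply, map_pow, hD.comulHom_apply,
    hy.bosComul hD.toIsGraded, add_pow_of_mul_eq hN (hy.grp_tmul_mul g y)]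
  simp [Algebra.TensorProduct.tmul_pow]

/-- The mixed terms of Δ(y)Δ(y') are y ⊗ y' and χ'(g) y' ⊗ y, those of Δ(y')Δ(y) are y' ⊗ y and
χ(g') y ⊗ y'. They cancel in the q-commutator because χ'(g) χ(g') = 1. -/
theorem IsDiag.comul_qCommutator (hD : D.IsBialg) (hy : D.IsDiag g χ y) (hy' : D.IsDiag g' χ' y')
    (hq : (χ' g : k) * χ g' = 1) :
    D.comul (y * y' - (χ' g : k) • (y' * y)) =
      (y * y' - (χ' g : k) • (y' * y)) ⊗ₜ 1 + 1 ⊗ₜ (y * y' - (χ' g : k) • (y' * y)) := by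
  have h1 := hD.one_mem
  rw [map_sub, map_smul, hD.comul_mul, hD.comul_mul, hy.comul, hy'.comul]
  simp only [map_add, LinearMap.add_apply, braidedMul_tmul h1, braidedMul_tmul hy.mem,
    braidedMul_tmul hy'.mem, map_one, AlgHom.one_apply, hy'.act, hy.act, one_mul, mul_one,
    smul_add, TensorProduct.sub_tmul, TensorProduct.tmul_sub, ← TensorProduct.smul_tmul',
    TensorProduct.tmul_smul, smul_smul, hq, one_smul]
  abel

end Diag

end BraidedData

/-! ### Nichols algebras -/

namespace YDModule

variable {k G V : Type*} [Field k] [Group G] [AddCommGroup V] [Module k V] (M : YDModule k G V)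

/-- The projection to degree one is the second component of an algebra map to the trivial
square-zero extension of k by V, whose first component is the counit. -/
theorem ιInv_mul (a b : TensorAlgebra k V) : TensorAlgebra.ιInv (a * b) =
    (TensorAlgebra.algebraMapInv a : k) • TensorAlgebra.ιInv b +
      (TensorAlgebra.algebraMapInv b : k) • (TensorAlgebra.ιInv a : V) := by
  -- The right module structure used in the definition of `TensorAlgebra.ιInv`, so that the `change`
  -- below is definitional.
  let _ : Module kᵐᵒᵖ V := Module.compHom _ ((RingHom.id k).fromOpposite mul_comm)
  have _ : IsCentralScalar k V := ⟨fun r m => rfl⟩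
  have h : (TrivSqZeroExt.fstHom k k V).comp TensorAlgebra.toTrivSqZeroExt =
      TensorAlgebra.algebraMapInv := by
    ext v; simp [TensorAlgebra.algebraMapInv]
  have h' : ∀ a : TensorAlgebra k V, (TensorAlgebra.toTrivSqZeroExt a).fst =
      TensorAlgebra.algebraMapInv a := fun a => AlgHom.congr_fun h a
  change (TensorAlgebra.toTrivSqZeroExt (a * b)).snd = _
  rw [map_mul, TrivSqZeroExt.snd_mul, h', h', op_smul_eq_smul]
  rfl

variable [Finite G]

/-- The left ideal generated by `S * T(V)`. -/
def twoSidedSpan (S : Submodule k (TensorAlgebra k V)) : Ideal (TensorAlgebra k V) :=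
  Ideal.span {x | ∃ s ∈ S, ∃ b, x = s * b}

section

variable {J : Ideal (TensorAlgebra k V)}

omit [Finite G] in
theorem tensorIdeal_left {a : TensorAlgebra k V} (ha : a ∈ J) (b : TensorAlgebra k V) :
    a ⊗ₜ b ∈ tensorIdeal J := Submodule.subset_span ⟨a, b, Or.inl ha, rfl⟩

omit [Finite G] in
theorem tensorIdeal_right {b : TensorAlgebra k V} (hb : b ∈ J) (a : TensorAlgebra k V) :
    a ⊗ₜ b ∈ tensorIdeal J := Submodule.subset_span ⟨a, b, Or.inr hb, rfl⟩

/-- The braiding acts on the first leg of Y, so stability of J under the action is what is needed.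
-/
theorem braidedMul_mem_tensorIdeal_left
    (hact : ∀ g, ∀ a ∈ J, M.actT g a ∈ J) (X : TensorAlgebra k V ⊗[k] TensorAlgebra k V)
    {Y : TensorAlgebra k V ⊗[k] TensorAlgebra k V} (hY : Y ∈ tensorIdeal J) :
    M.tensorData.braidedMul X Y ∈ tensorIdeal J := by
  have := Fintype.ofFinite G
  induction hY using Submodule.span_induction with
  | zero => simp
  | add Y Z _ _ hY hZ => rw [map_add]; exact add_mem hY hZ
  | smul c Y _ hY => rw [map_smul]; exact Submodule.smul_mem _ c hY
  | mem Y hY =>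
    obtain ⟨a, b, hab, rfl⟩ := hY
    induction X with
    | zero => simp
    | add X Z hX hZ => rw [map_add, LinearMap.add_apply]; exact add_mem hX hZ
    | tmul r s =>
      rw [BraidedData.braidedMul, finsum_eq_sum_of_fintype, LinearMap.sum_apply,
        LinearMap.sum_apply]
      refine Submodule.sum_mem _ fun g _ => ?_
      rw [TensorProduct.map₂_apply_tmul]
      rcases hab with ha | hb
      · exact tensorIdeal_left (J.mul_mem_left r (hact g a ha)) _
      · exact tensorIdeal_right (J.mul_mem_left _ hb) _

/-- The braiding splits the second leg of X into homogeneous components, so here J must be stable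
under the projections, and also under right multiplication. -/
theorem braidedMul_mem_tensorIdeal_right (hmul : ∀ a ∈ J, ∀ b, a * b ∈ J)
    (hpr : ∀ g, ∀ a ∈ J, M.prT g a ∈ J) {X : TensorAlgebra k V ⊗[k] TensorAlgebra k V}
    (hX : X ∈ tensorIdeal J) (Y : TensorAlgebra k V ⊗[k] TensorAlgebra k V) :
    M.tensorData.braidedMul X Y ∈ tensorIdeal J := by
  have := Fintype.ofFinite G
  induction hX using Submodule.span_induction with
  | zero => simp
  | add Y Z _ _ hY hZ => rw [map_add, LinearMap.add_apply]; exact add_mem hY hZ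
  | smul c Y _ hY => rw [map_smul, LinearMap.smul_apply]; exact Submodule.smul_mem _ c hY
  | mem X hX =>
    obtain ⟨a, b, hab, rfl⟩ := hX
    induction Y with
    | zero => simp
    | add X Z hX hZ => rw [map_add]; exact add_mem hX hZ
    | tmul r s =>
      rw [BraidedData.braidedMul, finsum_eq_sum_of_fintype, LinearMap.sum_apply,
        LinearMap.sum_apply]
      refine Submodule.sum_mem _ fun g _ => ?_
      rw [TensorProduct.map₂_apply_tmul]
      rcases hab with ha | hb
      · exact tensorIdeal_left (hmul a ha _) _
      · exact tensorIdeal_right (hmul _ (hpr g b hb) _) _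

end

theorem prT_mul_of_mem_left {h : G} {a : TensorAlgebra k V} (ha : a ∈ M.tensorData.hom h) (g : G)
    (b : TensorAlgebra k V) : M.prT g (a * b) = a * M.prT (h⁻¹ * g) b := by
  have hT := M.tensorData_isGraded
  have : M.tensorData.pr g ∘ₗ LinearMap.mulLeft k a =
      LinearMap.mulLeft k a ∘ₗ M.tensorData.pr (h⁻¹ * g) :=
    BraidedData.hom_ext hT.iSup_hom fun l b hb => by
      simp only [LinearMap.comp_apply, LinearMap.mulLeft_apply]
      by_cases hl : g = h * l
      · subst hl
        rw [BraidedData.pr_of_mem (hT.mul_mem ha hb), inv_mul_cancel_left,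
          BraidedData.pr_of_mem hb]
      · rw [BraidedData.pr_of_mem_ne (hT.mul_mem ha hb) hl, BraidedData.pr_of_mem_ne hb, mul_zero]
        rintro rfl
        exact hl (by group)
  exact LinearMap.congr_fun this b

theorem prT_mul_of_mem_right {h : G} {b : TensorAlgebra k V} (hb : b ∈ M.tensorData.hom h) (g : G)
    (a : TensorAlgebra k V) : M.prT g (a * b) = M.prT (g * h⁻¹) a * b := by
  have hT := M.tensorData_isGraded
  have : M.tensorData.pr g ∘ₗ LinearMap.mulRight k b =
      LinearMap.mulRight k b ∘ₗ M.tensorData.pr (g * h⁻¹) :=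
    BraidedData.hom_ext hT.iSup_hom fun l a ha => by
      simp only [LinearMap.comp_apply, LinearMap.mulRight_apply]
      by_cases hl : g = l * h
      · subst hl
        rw [BraidedData.pr_of_mem (hT.mul_mem ha hb), mul_inv_cancel_right,
          BraidedData.pr_of_mem ha]
      · rw [BraidedData.pr_of_mem_ne (hT.mul_mem ha hb) hl, BraidedData.pr_of_mem_ne ha, zero_mul]
        rintro rfl
        exact hl (by group)
  exact LinearMap.congr_fun this a

omit [Finite G] in
theorem mem_twoSidedSpan {S : Submodule k (TensorAlgebra k V)} {s : TensorAlgebra k V}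
    (hs : s ∈ S) (b : TensorAlgebra k V) : s * b ∈ twoSidedSpan S :=
  Ideal.subset_span ⟨s, hs, b, rfl⟩

/-- The two-sided ideal generated by S inherits each of the defining properties of an admissible
ideal from S. This is the only way in which elements are shown to vanish in the Nichols algebra. -/
theorem le_nicholsIdeal_of_stable (S : Submodule k (TensorAlgebra k V))
    (hact : ∀ g, ∀ s ∈ S, M.actT g s ∈ S) (hpr : ∀ g, ∀ s ∈ S, M.prT g s ∈ S)
    (h0 : ∀ s ∈ S, TensorAlgebra.algebraMapInv s = 0) (h1 : ∀ s ∈ S, TensorAlgebra.ιInv s = 0)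
    (hcomul : ∀ s ∈ S, M.comulT s ∈ tensorIdeal (twoSidedSpan S)) {s : TensorAlgebra k V}
    (hs : s ∈ S) : s ∈ M.nicholsIdeal := by
  have hT := M.tensorData_isBialg
  have hJ0 : ∀ a ∈ twoSidedSpan S, TensorAlgebra.algebraMapInv a = 0 := by
    intro a ha
    induction ha using Submodule.span_induction with
    | mem a ha => obtain ⟨s, hs, b, rfl⟩ := ha; rw [map_mul, h0 s hs, zero_mul]
    | zero => simp
    | add a b _ _ ha hb => rw [map_add, ha, hb, add_zero]
    | smul c a _ ha => rw [smul_eq_mul, map_mul, ha, mul_zero]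
  have hJmul : ∀ a ∈ twoSidedSpan S, ∀ b, a * b ∈ twoSidedSpan S := by
    intro a ha b
    induction ha using Submodule.span_induction with
    | mem a ha => obtain ⟨s, hs, c, rfl⟩ := ha; rw [mul_assoc]; exact mem_twoSidedSpan hs _
    | zero => simp
    | add a b _ _ ha hb => rw [add_mul]; exact add_mem ha hb
    | smul c a _ ha => rw [smul_eq_mul, mul_assoc]; exact Ideal.mul_mem_left _ c ha
  have hJact : ∀ g, ∀ a ∈ twoSidedSpan S, M.actT g a ∈ twoSidedSpan S := by
    intro g a ha
    induction ha using Submodule.span_induction with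
    | mem a ha =>
      obtain ⟨s, hs, c, rfl⟩ := ha; rw [map_mul]; exact mem_twoSidedSpan (hact g s hs) _
    | zero => simp
    | add a b _ _ ha hb => rw [map_add]; exact add_mem ha hb
    | smul c a _ ha => rw [smul_eq_mul, map_mul]; exact Ideal.mul_mem_left _ _ ha
  have hJpr : ∀ g, ∀ a ∈ twoSidedSpan S, M.prT g a ∈ twoSidedSpan S := by
    intro g a ha
    induction ha using Submodule.span_induction generalizing g with
    | mem a ha =>
      obtain ⟨s, hs, c, rfl⟩ := ha
      -- For homogeneous c, a component of s c is a component of s times c.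
      refine BraidedData.hom_induction (p := fun c => M.prT g (s * c) ∈ twoSidedSpan S)
        hT.iSup_hom c (fun h c hc => ?_) (by simp)
        (fun x y hx hy => by rw [mul_add, map_add]; exact add_mem hx hy)
      rw [M.prT_mul_of_mem_right hc]
      exact mem_twoSidedSpan (hpr _ s hs) _
    | zero => simp
    | add a b _ _ ha hb => rw [map_add]; exact add_mem (ha g) (hb g)
    | smul c a _ ha =>
      refine BraidedData.hom_induction (p := fun c => M.prT g (c • a) ∈ twoSidedSpan S)
        hT.iSup_hom c (fun h c hc => ?_) (by simp)
        (fun x y hx hy => by rw [add_smul, map_add]; exact add_mem hx hy)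
      rw [smul_eq_mul, M.prT_mul_of_mem_left hc]
      exact Ideal.mul_mem_left _ _ (ha _)
  refine M.le_nicholsIdeal (J := twoSidedSpan S) ⟨hJmul, hJ0, ?_, hJact, hJpr, ?_⟩
    (by simpa using mem_twoSidedSpan hs 1)
  · intro a ha
    induction ha using Submodule.span_induction with
    | mem a ha =>
      obtain ⟨s, hs, b, rfl⟩ := ha
      rw [ιInv_mul, h0 s hs, h1 s hs, zero_smul, smul_zero, add_zero]
    | zero => simp
    | add a b _ _ ha hb => rw [map_add, ha, hb, add_zero]
    | smul c a hc ha =>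
      rw [smul_eq_mul, ιInv_mul, ha, hJ0 a hc, zero_smul, smul_zero, add_zero]
  · intro a ha
    induction ha using Submodule.span_induction with
    | mem a ha =>
      obtain ⟨s, hs, b, rfl⟩ := ha
      rw [comulT_mul]
      exact M.braidedMul_mem_tensorIdeal_right hJmul hJpr (hcomul s hs) _
    | zero => simp
    | add a b _ _ ha hb => rw [map_add]; exact add_mem ha hb
    | smul c a _ ha =>
      rw [smul_eq_mul, comulT_mul]
      exact M.braidedMul_mem_tensorIdeal_left hJact _ ha

/-- The line spanned by z is stable under action and projections, and primitivity puts Δ(z) in J ⊗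
T(V) + T(V) ⊗ J for the ideal J generated by z. -/
theorem mem_nicholsIdeal_of_primitive {g : G} {z : TensorAlgebra k V}
    (hz : z ∈ M.tensorData.hom g) (hact : ∀ h, ∃ c : k, M.actT h z = c • z)
    (h0 : TensorAlgebra.algebraMapInv z = 0) (h1 : TensorAlgebra.ιInv z = 0)
    (hcomul : M.comulT z = z ⊗ₜ 1 + 1 ⊗ₜ z) : z ∈ M.nicholsIdeal := by
  have hself := Submodule.mem_span_singleton_self (R := k) z
  refine M.le_nicholsIdeal_of_stable (Submodule.span k {z}) ?_ ?_ ?_ ?_ ?_ hself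
  on_goal 1 => intro h
  on_goal 2 => intro h
  all_goals
    intro s hs
    obtain ⟨c, rfl⟩ := Submodule.mem_span_singleton.mp hs
    rw [map_smul]
  · obtain ⟨d, hd⟩ := hact h
    rw [hd]
    exact Submodule.smul_mem _ _ (Submodule.smul_mem _ _ hself)
  · refine Submodule.smul_mem _ _ ?_
    by_cases hh : h = g
    · subst hh
      exact (BraidedData.pr_of_mem hz).symm ▸ hself
    · exact (BraidedData.pr_of_mem_ne hz hh).symm ▸ zero_mem _
  · rw [h0, smul_zero]
  · rw [h1, smul_zero]
  · rw [hcomul]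
    have hz' : z ∈ twoSidedSpan (Submodule.span k {z}) := by simpa using mem_twoSidedSpan hself 1
    exact Submodule.smul_mem _ _ (add_mem (tensorIdeal_left hz' 1) (tensorIdeal_right hz' 1))

omit [Finite G] in
theorem toNichols_surjective : Function.Surjective M.toNichols := Ideal.Quotient.mk_surjective

omit [Finite G] in
theorem isYDHom_toNichols :
    BraidedData.IsYDHom M.tensorData M.nichols (MonoidHom.id G) M.toNichols where
  map_act _ _ := rfl
  map_mem {g r} hr := by
    refine ⟨?_, fun h hh => ?_⟩
    · change M.toNichols (M.tensorData.pr g r) = _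
      rw [BraidedData.pr_of_mem hr]
    · change M.toNichols (M.tensorData.pr h r) = _
      rw [BraidedData.pr_of_mem_ne hr hh, map_zero]

theorem nichols_isBialg : M.nichols.IsBialg :=
  M.tensorData_isBialg.of_surjective M.isYDHom_toNichols M.toNichols_surjective
    (fun _ _ => rfl) (fun _ => rfl) (fun _ => rfl)

section Diag

variable {g g' : G} {χ χ' : G →* kˣ} {y y' : V}

theorem isDiag_ι (hg : M.pr g y = y) (hχ : ∀ h, M.act h y = (χ h : k) • y) :
    M.tensorData.IsDiag g χ (TensorAlgebra.ι k y) where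
  mem := M.ι_mem_hom hg
  act h := (M.actT_ι h y).trans (by rw [hχ, map_smul])
  comul := M.comulT_ι y
  counit := by simp [tensorData, TensorAlgebra.algebraMapInv]

theorem isDiag_ofV (hg : M.pr g y = y) (hχ : ∀ h, M.act h y = (χ h : k) • y) :
    M.nichols.IsDiag g χ (M.ofV y) := by
  have h := M.isDiag_ι hg hχ
  refine ⟨M.isYDHom_toNichols.map_mem h.mem, fun l => ?_, ?_, h.counit⟩
  · change M.toNichols (M.tensorData.act l _) = _
    rw [h.act, map_smul]; rfl
  · change TensorProduct.map _ _ (M.tensorData.comul _) = _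
    rw [h.comul]
    simp [ofV]

theorem ofV_pow (hg : M.pr g y = y) (hχ : ∀ h, M.act h y = (χ h : k) • y) {N : ℕ}
    (hN : IsQRoot (χ g : k) N) : M.ofV y ^ N = 0 := by
  have h := M.isDiag_ι hg hχ
  change (M.toNichols (TensorAlgebra.ι k y)) ^ N = 0
  rw [← map_pow]
  refine M.toNichols_eq_zero (M.mem_nicholsIdeal_of_primitive
    (M.tensorData_isGraded.pow_mem h.mem N) (fun l => ⟨(χ l : k) ^ N, ?_⟩) ?_ ?_
    (h.comul_pow M.tensorData_isBialg hN))
  · rw [map_pow]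
    exact (congrArg (· ^ N) (h.act l)).trans (smul_pow _ _ _)
  · rw [map_pow]
    exact (congrArg (· ^ N) h.counit).trans (zero_pow hN.pos.ne')
  · have h0 : TensorAlgebra.algebraMapInv (TensorAlgebra.ι k y) = 0 := h.counit
    -- N ≥ 2 because q ≠ 1; this is why y^N has no component of degree one.
    obtain ⟨n, rfl⟩ : ∃ n, N = n + 2 := ⟨N - 2, by have := hN.two_le; omega⟩
    rw [pow_succ, ιInv_mul, map_pow, h0, zero_pow n.succ_ne_zero, zero_smul, zero_smul, add_zero]

theorem ofV_mul (hg : M.pr g y = y) (hχ : ∀ h, M.act h y = (χ h : k) • y)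
    (hg' : M.pr g' y' = y') (hχ' : ∀ h, M.act h y' = (χ' h : k) • y')
    (hcomm : g * g' = g' * g) (hq : (χ' g : k) * χ g' = 1) :
    M.ofV y * M.ofV y' = (χ' g : k) • (M.ofV y' * M.ofV y) := by
  have h := M.isDiag_ι hg hχ
  have h' := M.isDiag_ι hg' hχ'
  have hT := M.tensorData_isGraded
  have h0 : TensorAlgebra.algebraMapInv (TensorAlgebra.ι k y) = 0 := h.counit
  have h0' : TensorAlgebra.algebraMapInv (TensorAlgebra.ι k y') = 0 := h'.counit
  rw [← sub_eq_zero]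
  have : M.toNichols (TensorAlgebra.ι k y * TensorAlgebra.ι k y' -
      (χ' g : k) • (TensorAlgebra.ι k y' * TensorAlgebra.ι k y)) = 0 := by
    refine M.toNichols_eq_zero (M.mem_nicholsIdeal_of_primitive (g := g * g')
      (sub_mem (hT.mul_mem h.mem h'.mem) (Submodule.smul_mem _ _
        (hcomm ▸ hT.mul_mem h'.mem h.mem))) (fun l => ⟨(χ l : k) * χ' l, ?_⟩) ?_ ?_
      (h.comul_qCommutator M.tensorData_isBialg h' hq))
    · simp only [map_sub, map_smul, map_mul, actT_ι, hχ, hχ', smul_mul_smul_comm, smul_sub]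
      rw [smul_comm (χ' g : k), mul_comm (χ' l : k)]
    · simp [h0, h0']
    · simp [ιInv_mul, h0, h0']
  simpa [ofV] using this

end Diag

end YDModule

namespace BraidedData

theorem sum_pr_eq {k G R : Type*} [Field k] [Group G] [Fintype G] [Ring R] [Algebra k R]
    {D : BraidedData k G R} (h : ⨆ g, D.hom g = ⊤) (r : R) : ∑ g, D.pr g r = r := by
  have : ∑ g, D.pr g = LinearMap.id := hom_ext h fun g r hr => by
    rw [LinearMap.sum_apply, Finset.sum_eq_single g, pr_of_mem hr, LinearMap.id_apply]
    · exact fun l _ hl => pr_of_mem_ne hr hl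
    · simp
  simpa [LinearMap.sum_apply] using LinearMap.congr_fun this r

end BraidedData

/-! ### Functoriality of Nichols algebras -/

namespace YDModule

section Functor

variable {k G Γ V W : Type*} [Field k] [Group G] [Group Γ] [Finite G] [Finite Γ]
  [AddCommGroup V] [Module k V] [AddCommGroup W] [Module k W] (N : YDModule k Γ W)
  (M : YDModule k G V)

/-- Linear maps compatible with actions and coactions along a group homomorphism. -/
structure IsHom (φ : Γ →* G) (f : W →ₗ[k] V) : Prop where
  map_act : ∀ g w, f (N.act g w) = M.act (φ g) (f w)
  pr_map : ∀ g w, M.pr (φ g) (f (N.pr g w)) = f (N.pr g w)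

/-- The algebra map `T(W) → T(V)` extending a linear map `W → V`. -/
def tensorMap (f : W →ₗ[k] V) : TensorAlgebra k W →ₐ[k] TensorAlgebra k V :=
  TensorAlgebra.lift k (TensorAlgebra.ι k ∘ₗ f)

omit [Finite G] [Finite Γ] in
@[simp]
theorem tensorMap_ι (f : W →ₗ[k] V) (w : W) :
    tensorMap f (TensorAlgebra.ι k w) = TensorAlgebra.ι k (f w) := by
  simp [tensorMap]

variable {N M} {φ : Γ →* G} {f : W →ₗ[k] V} (hf : IsHom N M φ f)

include hf

theorem IsHom.tensorMap : BraidedData.IsYDHom N.tensorData M.tensorData φ (tensorMap f) where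
  map_act g r := by
    have : (YDModule.tensorMap f).comp (N.actT g) =
        (M.actT (φ g)).comp (YDModule.tensorMap f) := by
      ext w; simp [hf.map_act]
    exact AlgHom.congr_fun this r
  map_mem := by
    have hT := N.tensorData_isGraded
    have hT' := M.tensorData_isGraded
    let K (g : Γ) : Submodule k (TensorAlgebra k W) :=
      N.tensorData.hom g ⊓ (M.tensorData.hom (φ g)).comap (YDModule.tensorMap f).toLinearMap
    have hK : ⨆ g, K g = ⊤ := by
      refine N.iSup_eq_top_of_mul_mem ?_ ?_ ?_
      · exact ⟨hT.one_mem, by simpa using hT'.one_mem⟩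
      · refine fun g v => ⟨N.ι_mem_hom (N.pr_pr_self g v), ?_⟩
        simp only [SetLike.mem_coe, Submodule.mem_comap, AlgHom.toLinearMap_apply, tensorMap_ι]
        exact M.ι_mem_hom (hf.pr_map g v)
      · rintro g h a b ⟨ha, ha'⟩ ⟨hb, hb'⟩
        exact ⟨hT.mul_mem ha hb, by simpa using hT'.mul_mem ha' hb'⟩
    intro g r hr
    rw [← BraidedData.eq_of_le_hom (fun g => inf_le_left) hK g] at hr
    exact hr.2

theorem IsHom.comulT_tensorMap (a : TensorAlgebra k W) : M.comulT (YDModule.tensorMap f a) =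
    TensorProduct.map (YDModule.tensorMap f).toLinearMap (YDModule.tensorMap f).toLinearMap
      (N.comulT a) := by
  induction a using TensorAlgebra.induction with
  | algebraMap r => simp [Algebra.algebraMap_eq_smul_one, comulT_one]
  | ι v => simp [comulT_ι]
  | mul a b ha hb =>
    rw [map_mul, comulT_mul, comulT_mul, hf.tensorMap.map_braidedMul N.tensorData_isGraded, ha, hb]
  | add a b ha hb => simp only [map_add, ha, hb]

/-- The image of an admissible ideal of T(W) is stable under Γ only, so its G-translates are added.
Their span satisfies the hypotheses of `le_nicholsIdeal_of_stable`, because the coproduct is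
G-equivariant and compatible with `tensorMap`. -/
theorem IsHom.tensorMap_mem_nicholsIdeal {a : TensorAlgebra k W} (ha : a ∈ N.nicholsIdeal) :
    YDModule.tensorMap f a ∈ M.nicholsIdeal := by
  have := Fintype.ofFinite Γ
  refine N.nicholsIdeal_induction (p := fun a => YDModule.tensorMap f a ∈ M.nicholsIdeal)
    (by simp) (fun x y hx hy => by rw [map_add]; exact add_mem hx hy) (fun J hJ x hx => ?_) a ha
  let S : Submodule k (TensorAlgebra k V) :=
    Submodule.span k {t | ∃ g, ∃ a ∈ J, t = M.actT g (YDModule.tensorMap f a)}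
  have hS : ∀ g, ∀ a ∈ J, M.actT g (YDModule.tensorMap f a) ∈ S := fun g a ha =>
    Submodule.subset_span ⟨g, a, ha, rfl⟩
  have hSle : ∀ P : Submodule k (TensorAlgebra k V),
      (∀ g, ∀ a ∈ J, M.actT g (YDModule.tensorMap f a) ∈ P) → S ≤ P := fun P hP =>
    Submodule.span_le.mpr fun _ ⟨g, a, ha, e⟩ => e ▸ hP g a ha
  have h0 : ∀ g a, TensorAlgebra.algebraMapInv (M.actT g (YDModule.tensorMap f a)) =
      (TensorAlgebra.algebraMapInv a : k) := fun g a => by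
    have : (TensorAlgebra.algebraMapInv.comp (M.actT g)).comp (YDModule.tensorMap f) =
        (TensorAlgebra.algebraMapInv : TensorAlgebra k W →ₐ[k] k) := by
      ext; simp [TensorAlgebra.algebraMapInv]
    exact AlgHom.congr_fun this a
  have h1 : ∀ g a, TensorAlgebra.ιInv (M.actT g (YDModule.tensorMap f a)) =
      M.act g (f (TensorAlgebra.ιInv a)) := fun g a => by
    induction a using TensorAlgebra.induction with
    | algebraMap r =>
      have h1 : TensorAlgebra.ιInv (1 : TensorAlgebra k V) = 0 := by
        have := ιInv_mul (1 : TensorAlgebra k V) 1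
        simpa using this
      have h1' : TensorAlgebra.ιInv (1 : TensorAlgebra k W) = 0 := by
        have := ιInv_mul (1 : TensorAlgebra k W) 1
        simpa using this
      simp [Algebra.algebraMap_eq_smul_one, h1, h1']
    | ι v =>
      rw [tensorMap_ι, actT_ι, TensorAlgebra.ι_leftInverse, TensorAlgebra.ι_leftInverse]
    | mul a b ha hb => rw [map_mul, map_mul, ιInv_mul, ha, hb, h0, h0, ιInv_mul]; simp
    | add a b ha hb => simp only [map_add, ha, hb]
  refine M.le_nicholsIdeal_of_stable S ?_ ?_ ?_ ?_ ?_
    (by simpa using hS 1 x hx)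
  · refine fun h s hs => hSle (S.comap (M.actT h).toLinearMap) (fun g a ha => ?_) hs
    simp only [Submodule.mem_comap, AlgHom.toLinearMap_apply]
    rw [← AlgHom.mul_apply, ← map_mul]
    exact hS _ a ha
  · refine fun h s hs => hSle (S.comap (M.prT h)) (fun g a ha => ?_) hs
    -- The element a is split into its Γ-components: the translate by g of the image of the
    -- component of degree γ is homogeneous of degree g φ(γ) g⁻¹, so a projection keeps it or kills
    -- it.
    rw [Submodule.mem_comap,
      ← BraidedData.sum_pr_eq N.tensorData_isGraded.iSup_hom a, map_sum, map_sum, map_sum]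
    refine Submodule.sum_mem _ fun γ _ => ?_
    have hγ := M.tensorData_isGraded.act_mem g
      (hf.tensorMap.map_mem (BraidedData.pr_mem_hom N.tensorData_isGraded.iSup_hom γ a))
    by_cases e : h = g * φ γ * g⁻¹
    · subst e
      have := BraidedData.pr_of_mem hγ
      exact this.symm ▸ hS g _ (hJ.pr_mem γ a ha)
    · have := BraidedData.pr_of_mem_ne hγ e
      exact this.symm ▸ zero_mem _
  · refine fun s hs => hSle (LinearMap.ker (TensorAlgebra.algebraMapInv (R := k) (M := V)).toLinearMap) (fun g a ha => ?_) hs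
    exact (h0 g a).trans (hJ.degree_zero a ha)
  · refine fun s hs => hSle (LinearMap.ker (TensorAlgebra.ιInv (R := k) (M := V))) (fun g a ha => ?_) hs
    refine (h1 g a).trans ?_
    rw [hJ.degree_one a ha, map_zero, map_zero]
  · refine fun s hs => hSle ((tensorIdeal (twoSidedSpan S)).comap M.comulT) (fun g a ha => ?_) hs
    have e := M.tensorData_isBialg.comul_act g (YDModule.tensorMap f a)
    change M.comulT (M.actT g _) = TensorProduct.map (M.actT g).toLinearMap
      (M.actT g).toLinearMap (M.comulT _) at e
    rw [Submodule.mem_comap, e, hf.comulT_tensorMap]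
    have hle : tensorIdeal J ≤ ((tensorIdeal (twoSidedSpan S)).comap
      (TensorProduct.map (M.actT g).toLinearMap (M.actT g).toLinearMap)).comap
      (TensorProduct.map (YDModule.tensorMap f).toLinearMap
        (YDModule.tensorMap f).toLinearMap) := Submodule.span_le.mpr ?_
    · exact hle (hJ.comul_mem a ha)
    rintro _ ⟨b, c, hbc, rfl⟩
    simp only [SetLike.mem_coe, Submodule.mem_comap, TensorProduct.map_tmul,
      AlgHom.toLinearMap_apply]
    rcases hbc with hb | hc
    · exact tensorIdeal_left (by simpa using mem_twoSidedSpan (hS g b hb) 1) _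
    · exact tensorIdeal_right (by simpa using mem_twoSidedSpan (hS g c hc) 1) _

/-- The algebra map between Nichols algebras induced by a map of Yetter-Drinfeld modules. -/
def IsHom.nicholsMap : N.Nichols →ₐ[k] M.Nichols :=
  Ideal.Quotient.liftₐ N.nicholsIdeal (M.toNichols.comp (YDModule.tensorMap f))
    fun _ ha => M.toNichols_eq_zero (hf.tensorMap_mem_nicholsIdeal ha)

theorem IsHom.nicholsMap_toNichols (a : TensorAlgebra k W) :
    hf.nicholsMap (N.toNichols a) = M.toNichols (YDModule.tensorMap f a) := rfl

theorem IsHom.nicholsMap_ofV (w : W) : hf.nicholsMap (N.ofV w) = M.ofV (f w) := by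
  change hf.nicholsMap (N.toNichols _) = _
  rw [hf.nicholsMap_toNichols, tensorMap_ι]; rfl

theorem IsHom.isYDHom_nicholsMap : BraidedData.IsYDHom N.nichols M.nichols φ hf.nicholsMap where
  map_act g r := by
    obtain ⟨a, rfl⟩ := N.toNichols_surjective r
    exact congrArg M.toNichols (hf.tensorMap.map_act g a)
  map_mem {g r} hr := by
    obtain ⟨a, rfl⟩ := N.toNichols_surjective r
    rw [← BraidedData.pr_of_mem hr]
    exact M.isYDHom_toNichols.map_mem
      (hf.tensorMap.map_mem (BraidedData.pr_mem_hom N.tensorData_isGraded.iSup_hom g a))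

end Functor

end YDModule

/-! ### Commutation, vanishing and scaling of the degree N part of a product of truncated
exponentials. -/

section ExpMul

variable {k E E' : Type*} [Field k] [Ring E] [Algebra k E] [Ring E'] [Algebra k E'] {q : k} {N : ℕ}

theorem map_expMul (f : E →ₐ[k] E') (a b : E) (n : ℕ) :
    f (expMul q N a b n) = expMul q N (f a) (f b) n := by
  rw [expMul, expMul, map_sum]
  refine Finset.sum_congr rfl fun p _ => ?_
  simp only [divPow, map_mul]
  congr 1 <;> split_ifs <;> simp

theorem divPow_mul_left {z a : E} (h : Commute z a) (n : ℕ) :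
    divPow q N (z * a) n = z ^ n * divPow q N a n := by
  simp only [divPow]
  split_ifs
  · rw [h.mul_pow, mul_smul_comm]
  · simp

theorem expMul_mul_left {z a b : E} (ha : Commute z a) (hb : Commute z b) (n : ℕ) :
    expMul q N (z * a) (z * b) n = z ^ n * expMul q N a b n := by
  rw [expMul, expMul, Finset.mul_sum]
  refine Finset.sum_congr rfl fun p hp => ?_
  have h : Commute (divPow q N a p.1) (z ^ p.2) := by
    rw [divPow]
    split_ifs
    · exact (ha.symm.pow_pow _ _).smul_left _
    · exact Commute.zero_left _
  rw [divPow_mul_left ha, divPow_mul_left hb, ← mem_antidiagonal.mp hp, pow_add,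
    mul_assoc, ← mul_assoc (divPow q N a p.1), h.eq]
  simp only [mul_assoc]

theorem commute_divPow {x a : E} (h : Commute x a) (n : ℕ) : Commute x (divPow q N a n) := by
  rw [divPow]
  split_ifs
  · exact (h.pow_right n).smul_right _
  · exact Commute.zero_right _

theorem commute_expMul {x a b : E} (ha : Commute x a) (hb : Commute x b) (n : ℕ) :
    Commute x (expMul q N a b n) :=
  Commute.sum_right _ _ _ fun _ _ => (commute_divPow ha _).mul_right (commute_divPow hb _)

/-- Each monomial of degree N in a and b passes x with the factor l^N = 1. -/
theorem expMul_commute_of_mul_eq {l : k} {a b x : E} (ha : a * x = l • (x * a))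
    (hb : b * x = l • (x * b)) (hl : l ^ N = 1) : Commute (expMul q N a b N) x := by
  have key : ∀ {c : E}, c * x = l • (x * c) → ∀ n,
      divPow q N c n * x = l ^ n • (x * divPow q N c n) := by
    intro c hc n
    rw [divPow]
    split_ifs
    · rw [smul_mul_assoc, pow_mul_of_mul_eq hc, mul_smul_comm, smul_comm]
    · simp
  rw [Commute, SemiconjBy, expMul, Finset.sum_mul, Finset.mul_sum]
  refine Finset.sum_congr rfl fun p hp => ?_
  rw [mul_assoc, key hb, mul_smul_comm, ← mul_assoc, key ha, smul_mul_assoc, smul_smul, ← pow_add,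
    add_comm p.2, mem_antidiagonal.mp hp, hl, one_smul, mul_assoc]

theorem divPow_zero_left {n : ℕ} (hn : n ≠ 0) : divPow q N (0 : E) n = 0 := by
  rw [divPow]; split_ifs <;> simp [hn]

/-- Only the exponent 0 of the zero argument could contribute, and then the exponent of a is N,
which is cut off by the truncation. This gives the counit conditions for the twist. -/
theorem expMul_zero_right (a : E) : expMul q N a 0 N = 0 :=
  Finset.sum_eq_zero fun p hp => by
    have := mem_antidiagonal.mp hp
    by_cases h2 : p.2 = 0
    · rw [divPow_of_le (by omega), zero_mul]
    · rw [divPow_zero_left h2, mul_zero]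

theorem expMul_zero_left (a : E) : expMul q N 0 a N = 0 :=
  Finset.sum_eq_zero fun p hp => by
    have := mem_antidiagonal.mp hp
    by_cases h2 : p.1 = 0
    · rw [divPow_of_le (n := p.2) (by omega), mul_zero]
    · rw [divPow_zero_left h2, zero_mul]

/-- A product of two monomials of degree N has total degree 2N, so a or b occurs in it at least N
times. Hence 1 + ξ `expMul` is invertible. -/
theorem expMul_mul_self {a b : E} (hab : b * a = q • (a * b)) (ha : a ^ N = 0) (hb : b ^ N = 0) :
    expMul q N a b N * expMul q N a b N = 0 := by
  have key : ∀ i j m n, i + j = N → m + n = N → a ^ i * b ^ j * (a ^ m * b ^ n) = 0 := by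
    intro i j m n h1 h2
    have hp : ∀ m, b ^ j * a ^ m = (q ^ j) ^ m • (a ^ m * b ^ j) := by
      intro m
      induction m with
      | zero => simp
      | succ m ih =>
        rw [pow_succ, ← mul_assoc, ih, smul_mul_assoc, mul_assoc, pow_mul_of_mul_eq hab,
          mul_smul_comm, smul_smul, pow_succ, mul_assoc]
    rw [mul_assoc, ← mul_assoc (b ^ j), hp, smul_mul_assoc, mul_smul_comm, mul_assoc, ← mul_assoc,
      ← pow_add, ← pow_add]
    rcases le_total N (i + m) with h | h
    · rw [pow_eq_zero_of_le h ha, zero_mul, smul_zero]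
    · rw [pow_eq_zero_of_le (show N ≤ j + n by omega) hb, mul_zero, smul_zero]
  rw [expMul, Finset.sum_mul_sum]
  refine Finset.sum_eq_zero fun p hp => Finset.sum_eq_zero fun p' hp' => ?_
  simp only [divPow]
  split_ifs <;> simp only [zero_mul, mul_zero, smul_mul_smul_comm, smul_zero,
    key _ _ _ _ (mem_antidiagonal.mp hp) (mem_antidiagonal.mp hp')]

theorem isUnit_one_add_of_mul_self {x : E} (h : x * x = 0) : IsUnit (1 + x) :=
  IsNilpotent.isUnit_one_add ⟨2, by rw [pow_two, h]⟩

end ExpMul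

/-! ### Relations of a quantum linear space and the images of the twist factors in the bosonization.
-/

namespace QuantumLinearSpace

theorem isQRoot {k G : Type*} [Field k] [Group G] [Finite G] {θ : ℕ} (Q : QuantumLinearSpace k G θ)
    (i : Fin θ) : IsQRoot (Q.q i i) (Q.N i) where
  ne_one h := Q.q_self i (Units.ext h)
  order := rfl
  pos := by
    have h : IsOfFinOrder (Q.q i i) := MonoidHom.isOfFinOrder (Units.coeHom k)
      (MonoidHom.isOfFinOrder (Q.χ i) (isOfFinOrder_of_finite (Q.g i)))
    exact h.orderOf_pos

variable {k G R : Type*} [Field k] [Group G] [Ring R] [Algebra k R] {θ : ℕ}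
  (Q : QuantumLinearSpace k G θ) (D : BraidedData k G R) (y : Fin θ → R) (ξ : Fin θ → k)
  (a : Fin θ → Fin θ → k)

theorem q_mul_q {i j : Fin θ} (h : i ≠ j) : Q.q i j * Q.q j i = 1 := by
  have := congrArg Units.val (Q.q_symm i j h)
  simpa [q] using this

/-- A family of elements that satisfies the relations of the quantum linear space. -/
structure IsRealization : Prop where
  diag : ∀ i, D.IsDiag (Q.g i) (Q.χ i) (y i)
  pow_N : ∀ i, y i ^ Q.N i = 0
  comm : ∀ i j, i ≠ j → y i * y j = Q.q i j • (y j * y i)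

/-- The compatibility of the scalars with the coaction, and with the action of the `g i`. -/
structure IsCompatible : Prop where
  ξ_coinvariant : ∀ i, ξ i ≠ 0 → Q.g i ^ Q.N i = 1
  a_coinvariant : ∀ i j, i ≠ j → a i j ≠ 0 → Q.g i * Q.g j = 1
  a_invariant : ∀ i j, i ≠ j → a i j ≠ 0 → ∀ l, Q.χ i (Q.g l) * Q.χ j (Q.g l) = 1

/-- The factor of the braided twist given by `ξ i`. -/
def twistξ (i : Fin θ) : R ⊗[k] R :=
  1 ⊗ₜ 1 + ξ i • ∑ n ∈ Finset.Ioo 0 (Q.N i),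
    (qFactorial (Q.q i i) (Q.N i - n) * qFactorial (Q.q i i) n)⁻¹ •
      ((y i ^ n) ⊗ₜ[k] (y i ^ (Q.N i - n)))

/-- The factor of the braided twist given by `a i j`. -/
def twistExp (i j : Fin θ) : R ⊗[k] R :=
  ∑ n ∈ Finset.range (Q.N i), (qFactorial (Q.q i j) n)⁻¹ •
    ((D.braidedMul (a i j • (y i ⊗ₜ[k] y j)))^[n] (1 ⊗ₜ 1))

/-- The factors of the braided twist. -/
def twistList : List (R ⊗[k] R) :=
  (List.finRange θ).map (Q.twistξ y ξ) ++
    (((List.finRange θ ×ˢ List.finRange θ).filter fun p => p.1 ≠ p.2).map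
      fun p => Q.twistExp D y a p.1 p.2)

/-- The braided twist. -/
def twistD : R ⊗[k] R := (Q.twistList D y ξ a).foldr (fun s t => D.braidedMul s t) (1 ⊗ₜ 1)

variable {Q D y ξ a}

section Compatible

variable (h : IsCompatible Q ξ a) {i j : Fin θ} (hij : i ≠ j) (ha : a i j ≠ 0)

include h hij ha

theorem IsCompatible.q_mul (l : Fin θ) : Q.q i l * Q.q j l = 1 := by
  have := congrArg (Q.χ l) (h.a_coinvariant i j hij ha)
  rw [map_mul, map_one] at this
  simpa [q] using congrArg Units.val this

theorem IsCompatible.mul_q (l : Fin θ) : Q.q l i * Q.q l j = 1 := by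
  simpa [q] using congrArg Units.val (h.a_invariant i j hij ha l)

/-- Evaluating characters on g_i g_j = 1, and χ_i χ_j = 1 on the g_l, forces q_ii, q_jj, q_ij and
q_ji to be one common scalar of square 1. It is not 1 because q_ii ≠ 1. -/
theorem IsCompatible.q_eq [Finite G] : Q.q i i = -1 ∧ Q.q j j = -1 ∧ Q.q i j = -1 ∧
    Q.N i = 2 ∧ Q.N j = 2 := by
  have h1 := h.q_mul hij ha i
  have h2 := h.mul_q hij ha i
  have h3 := Q.q_mul_q hij
  have h4 := h.mul_q hij ha j
  have h5 := h.q_mul hij ha j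
  have hi := Q.isQRoot i
  have hj := Q.isQRoot j
  have e1 : Q.q i j = Q.q j i := by
    have : Q.q i i ≠ 0 := left_ne_zero_of_mul_eq_one h1
    exact mul_left_cancel₀ this (h2.trans h1.symm)
  have e2 : Q.q i j * Q.q i j = 1 := by rwa [← e1] at h3
  have e3 : Q.q i i = Q.q i j := by
    have h0 : Q.q i j ≠ 0 := left_ne_zero_of_mul_eq_one e2
    exact mul_right_cancel₀ h0 (h2.trans e2.symm)
  have e4 : Q.q j j = Q.q i j := by
    have h0 : Q.q i j ≠ 0 := left_ne_zero_of_mul_eq_one e2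
    exact mul_left_cancel₀ h0 (h5.trans e2.symm)
  have e5 : Q.q i j = -1 := by
    rcases mul_self_eq_one_iff.mp e2 with e | e
    · exact absurd (e3.trans e) hi.ne_one
    · exact e
  have hN : ∀ l, Q.q l l = -1 → Q.N l = 2 := fun l hl => by
    have hr := Q.isQRoot l
    have := hr.two_le
    have hd : Q.N l ∣ 2 := orderOf_dvd_of_pow_eq_one (by rw [hl]; norm_num)
    exact le_antisymm (Nat.le_of_dvd two_pos hd) this
  exact ⟨e3.trans e5, e4.trans e5, e5, hN i (e3.trans e5), hN j (e4.trans e5)⟩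

end Compatible

section Generic

variable {H : Type*} [Ring H] [Algebra k H] (u : G →* H) (Y : Fin θ → H)

/-- The relations of the bosonization of a quantum linear space. -/
structure IsBosonized (Q : QuantumLinearSpace k G θ) (u : G →* H) (Y : Fin θ → H) : Prop where
  grp_mul : ∀ g i, u g * Y i = (Q.χ i g : k) • (Y i * u g)
  pow_N : ∀ i, Y i ^ Q.N i = 0
  comm : ∀ i j, i ≠ j → Y i * Y j = Q.q i j • (Y j * Y i)

/-- The image of `x_i ⊗ 1` in the tensor square of the bosonization. -/
def fst (k : Type*) [Field k] {H : Type*} [Ring H] [Algebra k H] (Y : Fin θ → H) (i : Fin θ) :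
    H ⊗[k] H := Y i ⊗ₜ 1

/-- The image of `1 ⊗ x_i` in the tensor square of the bosonization. -/
def snd (Q : QuantumLinearSpace k G θ) (u : G →* H) (Y : Fin θ → H) (i : Fin θ) : H ⊗[k] H :=
  u (Q.g i) ⊗ₜ Y i

/-- The images of `x_i ⊗ 1 ⊗ 1`, `1 ⊗ x_i ⊗ 1` and `1 ⊗ 1 ⊗ x_i` in the tensor cube of the
bosonization. -/
def letter (Q : QuantumLinearSpace k G θ) (u : G →* H) (Y : Fin θ → H) (p : Fin 3) (i : Fin θ) :
    H ⊗[k] (H ⊗[k] H) :=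
  ![Y i ⊗ₜ (1 ⊗ₜ 1), u (Q.g i) ⊗ₜ (Y i ⊗ₜ 1), u (Q.g i) ⊗ₜ (u (Q.g i) ⊗ₜ Y i)] p

/-- The image of the factor of the braided twist given by `ξ i`. -/
def bosξ (Q : QuantumLinearSpace k G θ) (u : G →* H) (Y : Fin θ → H) (ξ : Fin θ → k) (i : Fin θ) :
    H ⊗[k] H :=
  1 + ξ i • expMul (Q.q i i) (Q.N i) (fst k Y i) (Q.snd u Y i) (Q.N i)

/-- The image of the factor of the braided twist given by `a i j`. -/
def bosExp (Q : QuantumLinearSpace k G θ) (u : G →* H) (Y : Fin θ → H) (a : Fin θ → Fin θ → k)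
    (i j : Fin θ) : H ⊗[k] H :=
  1 + a i j • (fst k Y i * Q.snd u Y j)

/-- The images of the factors of the braided twist. -/
def bosList (Q : QuantumLinearSpace k G θ) (u : G →* H) (Y : Fin θ → H) (ξ : Fin θ → k)
    (a : Fin θ → Fin θ → k) : List (H ⊗[k] H) :=
  (List.finRange θ).map (Q.bosξ u Y ξ) ++
    (((List.finRange θ ×ˢ List.finRange θ).filter fun p => p.1 ≠ p.2).map
      fun p => Q.bosExp u Y a p.1 p.2)

theorem q_mul_q_of_or {i j : Fin θ} (h : i ≠ j ∨ Q.N i = 2) : Q.q i j * Q.q j i = 1 := by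
  by_cases hij : i = j
  · subst hij
    rw [← pow_two, ← h.resolve_left (· rfl)]
    exact pow_orderOf_eq_one _
  · exact Q.q_mul_q hij

variable {u Y}

omit [Algebra k H] in
theorem grp_mul_grp (g : G) (i : Fin θ) : u g * u (Q.g i) = u (Q.g i) * u g := by
  rw [← map_mul, ← map_mul, Subgroup.mem_center_iff.mp (Q.g_central i)]

namespace IsBosonized

variable (hy : IsBosonized Q u Y)

include hy

theorem g_mul (i j : Fin θ) : u (Q.g i) * Y j = Q.q i j • (Y j * u (Q.g i)) := hy.grp_mul _ j

theorem mul_eq {i j : Fin θ} (h : i ≠ j ∨ Q.N i = 2) : Y i * Y j = Q.q i j • (Y j * Y i) := by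
  by_cases hij : i = j
  · subst hij
    have := hy.pow_N i
    rw [h.resolve_left (· rfl), pow_two] at this
    rw [this, smul_zero]
  · exact hy.comm i j hij

theorem mul_g {i j : Fin θ} (h : i ≠ j ∨ Q.N i = 2) :
    Y i * u (Q.g j) = Q.q i j • (u (Q.g j) * Y i) := by
  rw [hy.g_mul, smul_smul, q_mul_q_of_or h, one_smul]

theorem snd_mul_fst (i j : Fin θ) :
    Q.snd u Y i * fst k Y j = Q.q i j • (fst k Y j * Q.snd u Y i) := by
  simp [fst, snd, hy.g_mul, ← TensorProduct.smul_tmul']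

theorem fst_pow (i : Fin θ) : fst k Y i ^ Q.N i = 0 := by
  simp [fst, Algebra.TensorProduct.tmul_pow, hy.pow_N]

theorem snd_pow (i : Fin θ) : Q.snd u Y i ^ Q.N i = 0 := by
  simp [snd, Algebra.TensorProduct.tmul_pow, hy.pow_N]

/-- Letters with different indices q-commute in any positions, since q_ij q_ji = 1. The case N_i = 2
allows i = j, where q_ii² = 1 and Y_i² = 0. -/
theorem letter_mul {i j : Fin θ} (h : i ≠ j ∨ Q.N i = 2) (p r : Fin 3) :
    Q.letter u Y p i * Q.letter u Y r j = Q.q i j • (Q.letter u Y r j * Q.letter u Y p i) := by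
  have h1 := hy.g_mul i j
  have h2 := hy.mul_eq h
  have h3 := hy.mul_g h
  have h4 := grp_mul_grp (Q := Q) (u := u) (Q.g i) j
  fin_cases p <;> fin_cases r <;>
    simp [letter, h1, h2, h3, h4, ← TensorProduct.smul_tmul']

theorem letter_mul_letter_of_lt (i : Fin θ) {p r : Fin 3} (h : p < r) :
    Q.letter u Y r i * Q.letter u Y p i = Q.q i i • (Q.letter u Y p i * Q.letter u Y r i) := by
  have h1 := hy.g_mul i i
  fin_cases p <;> fin_cases r <;>
    first
    | exact absurd h (by decide)
    | simp [letter, h1, ← TensorProduct.smul_tmul']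

theorem letter_pow (i : Fin θ) (p : Fin 3) : Q.letter u Y p i ^ Q.N i = 0 := by
  fin_cases p <;> simp [letter, Algebra.TensorProduct.tmul_pow, hy.pow_N]

/-- The total factor is q_il q_jl = χ_l(g_i g_j) = 1. Since N_i = N_j = 2, this includes l = i and l
= j. -/
theorem pair_commute [Finite G] (hc : IsCompatible Q ξ a) {i j : Fin θ} (hij : i ≠ j)
    (ha : a i j ≠ 0) (p r s : Fin 3) (l : Fin θ) :
    Commute (Q.letter u Y p i * Q.letter u Y r j) (Q.letter u Y s l) := by
  obtain ⟨_, _, _, hi, hj⟩ := hc.q_eq hij ha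
  rw [Commute, SemiconjBy, mul_assoc, hy.letter_mul (Or.inr hj), mul_smul_comm, ← mul_assoc,
    hy.letter_mul (Or.inr hi), smul_mul_assoc, smul_smul, mul_comm (Q.q j l), hc.q_mul hij ha,
    one_smul, mul_assoc]

/-- Each letter of index i passes the letter of index l with the factor q_il, and q_il^N_i =
χ_l(g_i^N_i) = 1. -/
theorem expMul_commute (hc : IsCompatible Q ξ a) {i l : Fin θ} (hil : i ≠ l)
    (hξ : ξ i ≠ 0) (p r s : Fin 3) :
    Commute (expMul (Q.q i i) (Q.N i) (Q.letter u Y p i) (Q.letter u Y r i) (Q.N i))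
      (Q.letter u Y s l) :=
  expMul_commute_of_mul_eq (hy.letter_mul (Or.inl hil) p s) (hy.letter_mul (Or.inl hil) r s) (by
    have := congrArg (Q.χ l) (hc.ξ_coinvariant i hξ)
    rw [map_pow, map_one] at this
    simpa [q] using congrArg Units.val this)

end IsBosonized

end Generic

section Square

variable [Finite G] (hD : D.IsBialg) (hy : Q.IsRealization D y)

include hD hy

theorem IsRealization.bosTensor_tmul_pow (i j : Fin θ) (m n : ℕ) :
    D.bosTensor ((y i ^ m) ⊗ₜ (y j ^ n)) = fst k (D.incHom ∘ y) i ^ m * Q.snd D.grp (D.incHom ∘ y) j ^ n := by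
  rw [BraidedData.bosTensor_tmul (hD.pow_mem (hy.diag j).mem n), fst, snd,
    Algebra.TensorProduct.tmul_pow, Algebra.TensorProduct.tmul_pow, one_pow,
    Algebra.TensorProduct.tmul_mul_tmul, one_mul, Function.comp_apply, Function.comp_apply,
    ← map_pow, ← map_pow, ← map_pow,
    BraidedData.incHom_apply, BraidedData.inc_mul_grp, one_mul, BraidedData.incHom_apply]

/-- The sum over 0 < n < N_i is the full sum over the antidiagonal of N_i, since truncation kills
both end terms. -/
theorem IsRealization.bosTensor_twistξ (i : Fin θ) : D.bosTensor (Q.twistξ y ξ i) =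
    1 + ξ i • expMul (Q.q i i) (Q.N i) (fst k (D.incHom ∘ y) i) (Q.snd D.grp (D.incHom ∘ y) i) (Q.N i) := by
  have hN := (Q.isQRoot i).pos
  rw [twistξ, map_add, hD.bosTensor_one, map_smul, map_sum, expMul,
    Finset.Nat.sum_antidiagonal_eq_sum_range_succ_mk, Finset.sum_range_succ,
    divPow_of_le (le_refl (Q.N i)), zero_mul, add_zero]
  congr 2
  have hs : Finset.Ioo 0 (Q.N i) ⊆ Finset.range (Q.N i) := fun n hn => by
    simp only [Finset.mem_Ioo, Finset.mem_range] at hn ⊢; omega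
  rw [← Finset.sum_subset hs]
  · refine Finset.sum_congr rfl fun n hn => ?_
    simp only [Finset.mem_Ioo] at hn
    rw [map_smul, hy.bosTensor_tmul_pow hD, divPow, divPow, if_pos (by omega), if_pos (by omega),
      smul_mul_smul_comm, mul_inv, mul_comm (qFactorial _ n)⁻¹]
  · intro n hn hn'
    simp only [Finset.mem_Ioo, Finset.mem_range] at hn hn'
    obtain rfl : n = 0 := by omega
    rw [divPow_of_le (n := Q.N i - 0) (by omega), mul_zero]

omit hD hy in
theorem twistExp_of_eq_zero {i j : Fin θ} (ha : a i j = 0) :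
    Q.twistExp D y a i j = 1 ⊗ₜ 1 := by
  have hN := (Q.isQRoot i).pos
  obtain ⟨n, hn⟩ : ∃ n, Q.N i = n + 1 := ⟨Q.N i - 1, by omega⟩
  rw [twistExp, hn, Finset.sum_range_succ', Finset.sum_eq_zero]
  · simp [qFactorial]
  · intro m _
    rw [Function.iterate_succ_apply', ha, zero_smul, map_zero, LinearMap.zero_apply, smul_zero]

/-- If a_ij ≠ 0 then N_i = 2, so the q-exponential has only its constant and its linear term. -/
theorem IsRealization.bosTensor_twistExp (h : IsCompatible Q ξ a) {i j : Fin θ} (hij : i ≠ j) :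
    D.bosTensor (Q.twistExp D y a i j) = 1 + a i j • (fst k (D.incHom ∘ y) i * Q.snd D.grp (D.incHom ∘ y) j) := by
  by_cases ha : a i j = 0
  · rw [twistExp_of_eq_zero ha, hD.bosTensor_one, ha, zero_smul, add_zero]
  · obtain ⟨_, _, _, hN, _⟩ := h.q_eq hij ha
    rw [twistExp, hN, Finset.sum_range_succ, Finset.sum_range_succ, Finset.sum_range_zero, zero_add,
      Function.iterate_one, Function.iterate_zero, id, hD.braidedMul_one, map_add, map_smul,
      map_smul, map_smul, hD.bosTensor_one]
    have := hy.bosTensor_tmul_pow hD i j 1 1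
    simp only [pow_one] at this
    rw [this]
    simp [qFactorial]

omit hy in
theorem bosTensor_twistD : D.bosTensor (Q.twistD D y ξ a) =
    ((Q.twistList D y ξ a).map D.bosTensor).prod := by
  rw [twistD]
  induction Q.twistList D y ξ a with
  | nil => simp [hD.bosTensor_one]
  | cons s l ih => rw [List.foldr_cons, hD.bosTensor_mul, ih, List.map_cons, List.prod_cons]

end Square

end QuantumLinearSpace

/-! ### Twists of an ordinary bialgebra, and products of twists. -/

section Legs

variable {k H : Type*} [Field k] [Ring H] [Algebra k H] (Δ : H →ₐ[k] H ⊗[k] H) (ε : H →ₐ[k] k)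

variable (k H) in
/-- `X ↦ 1 ⊗ X` -/
def leg₂₃ : H ⊗[k] H →ₐ[k] H ⊗[k] (H ⊗[k] H) := Algebra.TensorProduct.includeRight

variable (k H) in
/-- `X ↦ X ⊗ 1` -/
def leg₁₂ : H ⊗[k] H →ₐ[k] H ⊗[k] (H ⊗[k] H) :=
  (Algebra.TensorProduct.assoc k k k H H H).toAlgHom.comp Algebra.TensorProduct.includeLeft

/-- `id ⊗ Δ` -/
def idComul : H ⊗[k] H →ₐ[k] H ⊗[k] (H ⊗[k] H) :=
  Algebra.TensorProduct.map (AlgHom.id k H) Δ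

/-- `Δ ⊗ id` -/
def comulId : H ⊗[k] H →ₐ[k] H ⊗[k] (H ⊗[k] H) :=
  (Algebra.TensorProduct.assoc k k k H H H).toAlgHom.comp
    (Algebra.TensorProduct.map Δ (AlgHom.id k H))

/-- `id ⊗ ε` -/
def idCounit : H ⊗[k] H →ₐ[k] H :=
  (Algebra.TensorProduct.rid k k H).toAlgHom.comp (Algebra.TensorProduct.map (AlgHom.id k H) ε)

/-- `ε ⊗ id` -/
def counitId : H ⊗[k] H →ₐ[k] H :=
  (Algebra.TensorProduct.lid k H).toAlgHom.comp (Algebra.TensorProduct.map ε (AlgHom.id k H))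

/-- Each operation in the twist conditions becomes an algebra map, to H ⊗ (H ⊗ H) or to H, so the
conditions can be multiplied and transported. -/
theorem isTwist_iff {J : H ⊗[k] H} : IsTwist Δ.toLinearMap ε.toLinearMap J ↔ IsUnit J ∧
    leg₂₃ k H J * idComul Δ J = leg₁₂ k H J * comulId Δ J ∧ idCounit ε J = 1 ∧
      counitId ε J = 1 := by
  have e : TensorProduct.assoc k H H H ((J ⊗ₜ[k] 1) * Δ.toLinearMap.rTensor H J) =
      leg₁₂ k H J * comulId Δ J :=
    map_mul (Algebra.TensorProduct.assoc k k k H H H) (J ⊗ₜ[k] 1) (Δ.toLinearMap.rTensor H J)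
  exact ⟨fun h => ⟨h.1, h.2.trans e, h.3, h.4⟩, fun h => ⟨h.1, h.2.1.trans e.symm, h.2.2.1, h.2.2.2⟩⟩

variable {Δ ε}

/-- All the maps involved are multiplicative, so the commutation hypotheses let the twist equation
of the product be regrouped into the product of the two twist equations. -/
theorem IsTwist.mul {J J' : H ⊗[k] H} (h : IsTwist Δ.toLinearMap ε.toLinearMap J)
    (h' : IsTwist Δ.toLinearMap ε.toLinearMap J')
    (h1 : Commute (leg₂₃ k H J') (idComul Δ J)) (h2 : Commute (leg₁₂ k H J') (comulId Δ J)) :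
    IsTwist Δ.toLinearMap ε.toLinearMap (J * J') := by
  rw [isTwist_iff] at *
  refine ⟨h.1.mul h'.1, ?_, ?_, ?_⟩
  · rw [map_mul, map_mul, map_mul, map_mul, h1.mul_mul_mul_comm, h2.mul_mul_mul_comm, h.2.1, h'.2.1]
  · rw [map_mul, h.2.2.1, h'.2.2.1, one_mul]
  · rw [map_mul, h.2.2.2, h'.2.2.2, one_mul]

variable (Δ ε) in
theorem isTwist_one : IsTwist Δ.toLinearMap ε.toLinearMap 1 := by
  rw [isTwist_iff]
  simp only [map_one, isUnit_one, and_self]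

theorem isTwist_list_prod {l : List (H ⊗[k] H)}
    (h : ∀ J ∈ l, IsTwist Δ.toLinearMap ε.toLinearMap J)
    (hl : l.Pairwise fun J J' => Commute (leg₂₃ k H J') (idComul Δ J) ∧
      Commute (leg₁₂ k H J') (comulId Δ J)) :
    IsTwist Δ.toLinearMap ε.toLinearMap l.prod := by
  induction l with
  | nil => exact isTwist_one Δ ε
  | cons J l ih =>
    rw [List.pairwise_cons] at hl
    rw [List.prod_cons]
    refine (h J (by simp)).mul (ih (fun J' hJ' => h J' (by simp [hJ'])) hl.2) ?_ ?_
    · rw [map_list_prod]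
      refine Commute.list_prod_left _ _ fun x hx => ?_
      obtain ⟨J', hJ', rfl⟩ := List.mem_map.mp hx
      exact (hl.1 J' hJ').1
    · rw [map_list_prod]
      refine Commute.list_prod_left _ _ fun x hx => ?_
      obtain ⟨J', hJ', rfl⟩ := List.mem_map.mp hx
      exact (hl.1 J' hJ').2

end Legs

/-! ### The twist equation for the factors and for their product. -/

namespace QuantumLinearSpace

section Twist

variable {k G H : Type*} [Field k] [Group G] [Ring H] [Algebra k H] {θ : ℕ}
  {Q : QuantumLinearSpace k G θ} {u : G →* H} {Y : Fin θ → H} {ξ : Fin θ → k}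
  {a : Fin θ → Fin θ → k}

/-- The values of the comultiplication and counit on the generators. -/
structure IsHopfBosonized (Q : QuantumLinearSpace k G θ) (Δ : H →ₐ[k] H ⊗[k] H) (ε : H →ₐ[k] k)
    (u : G →* H) (Y : Fin θ → H) : Prop extends IsBosonized Q u Y where
  comul_grp : ∀ g, Δ (u g) = u g ⊗ₜ u g
  comul_gen : ∀ i, Δ (Y i) = Y i ⊗ₜ 1 + u (Q.g i) ⊗ₜ Y i
  counit_gen : ∀ i, ε (Y i) = 0

namespace IsHopfBosonized

variable {Δ : H →ₐ[k] H ⊗[k] H} {ε : H →ₐ[k] k} (hY : IsHopfBosonized Q Δ ε u Y)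

theorem leg₁₂_fst (i : Fin θ) : leg₁₂ k H (fst k Y i) = Q.letter u Y 0 i := by
  simp [leg₁₂, fst, letter]

theorem leg₁₂_snd (i : Fin θ) : leg₁₂ k H (Q.snd u Y i) = Q.letter u Y 1 i := by
  simp [leg₁₂, snd, letter]

theorem mul_leg₂₃_fst (i : Fin θ) :
    (u (Q.g i) ⊗ₜ[k] (1 : H ⊗[k] H)) * leg₂₃ k H (fst k Y i) = Q.letter u Y 1 i := by
  simp [leg₂₃, fst, letter]

theorem mul_leg₂₃_snd (i : Fin θ) :
    (u (Q.g i) ⊗ₜ[k] (1 : H ⊗[k] H)) * leg₂₃ k H (Q.snd u Y i) = Q.letter u Y 2 i := by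
  simp [leg₂₃, snd, letter]

theorem commute_leg₂₃ (h : H) (X : H ⊗[k] H) : Commute (h ⊗ₜ[k] (1 : H ⊗[k] H)) (leg₂₃ k H X) := by
  simp [Commute, SemiconjBy, leg₂₃]

theorem leg₁₂_bosξ (i : Fin θ) : leg₁₂ k H (Q.bosξ u Y ξ i) = 1 + ξ i •
    expMul (Q.q i i) (Q.N i) (Q.letter u Y 0 i) (Q.letter u Y 1 i) (Q.N i) := by
  rw [bosξ, map_add, map_one, map_smul, map_expMul, leg₁₂_fst (Q := Q) (u := u), leg₁₂_snd]

/-- `leg₂₃` puts 1 in the first slot where the letters have g_i. In degree N_i the difference is the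
factor g_i^N_i, which is 1 by coinvariance. -/
theorem leg₂₃_bosξ (hc : IsCompatible Q ξ a) (i : Fin θ) : leg₂₃ k H (Q.bosξ u Y ξ i) = 1 + ξ i •
    expMul (Q.q i i) (Q.N i) (Q.letter u Y 1 i) (Q.letter u Y 2 i) (Q.N i) := by
  rw [bosξ, map_add, map_one, map_smul, map_expMul]
  by_cases hξ : ξ i = 0
  · rw [hξ, zero_smul, zero_smul]
  · rw [← mul_leg₂₃_fst, ← mul_leg₂₃_snd, expMul_mul_left (commute_leg₂₃ _ _) (commute_leg₂₃ _ _),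
      Algebra.TensorProduct.tmul_pow, ← map_pow, hc.ξ_coinvariant i hξ, map_one, one_pow,
      ← Algebra.TensorProduct.one_def, one_mul]

theorem leg₁₂_bosExp (i j : Fin θ) : leg₁₂ k H (Q.bosExp u Y a i j) =
    1 + a i j • (Q.letter u Y 0 i * Q.letter u Y 1 j) := by
  rw [bosExp, map_add, map_one, map_smul, map_mul, leg₁₂_fst (Q := Q) (u := u), leg₁₂_snd]

theorem leg₂₃_bosExp (hc : IsCompatible Q ξ a) {i j : Fin θ} (hij : i ≠ j) :
    leg₂₃ k H (Q.bosExp u Y a i j) =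
      1 + a i j • (Q.letter u Y 1 i * Q.letter u Y 2 j) := by
  rw [bosExp, map_add, map_one, map_smul, map_mul]
  by_cases ha : a i j = 0
  · rw [ha, zero_smul, zero_smul]
  · rw [← mul_leg₂₃_fst, ← mul_leg₂₃_snd, (commute_leg₂₃ _ _).symm.mul_mul_mul_comm,
      Algebra.TensorProduct.tmul_mul_tmul, ← map_mul u, hc.a_coinvariant i j hij ha, map_one, one_mul,
      ← Algebra.TensorProduct.one_def, one_mul]

theorem idComul_fst (i : Fin θ) : idComul Δ (fst k Y i) = Q.letter u Y 0 i := by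
  simp [idComul, fst, letter, Algebra.TensorProduct.one_def]

include hY

theorem idComul_snd (i : Fin θ) :
    idComul Δ (Q.snd u Y i) = Q.letter u Y 1 i + Q.letter u Y 2 i := by
  simp [idComul, snd, letter, hY.comul_gen, TensorProduct.tmul_add]

theorem comulId_fst (i : Fin θ) :
    comulId Δ (fst k Y i) = Q.letter u Y 0 i + Q.letter u Y 1 i := by
  simp [comulId, fst, letter, hY.comul_gen, TensorProduct.add_tmul]

theorem comulId_snd (i : Fin θ) : comulId Δ (Q.snd u Y i) = Q.letter u Y 2 i := by
  simp [comulId, snd, letter, hY.comul_grp]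

theorem idComul_bosξ (i : Fin θ) : idComul Δ (Q.bosξ u Y ξ i) = 1 + ξ i •
    expMul (Q.q i i) (Q.N i) (Q.letter u Y 0 i) (Q.letter u Y 1 i + Q.letter u Y 2 i) (Q.N i) := by
  rw [bosξ, map_add, map_one, map_smul, map_expMul, idComul_fst (Q := Q) (u := u), hY.idComul_snd]

theorem comulId_bosξ (i : Fin θ) : comulId Δ (Q.bosξ u Y ξ i) = 1 + ξ i •
    expMul (Q.q i i) (Q.N i) (Q.letter u Y 0 i + Q.letter u Y 1 i) (Q.letter u Y 2 i) (Q.N i) := by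
  rw [bosξ, map_add, map_one, map_smul, map_expMul, hY.comulId_fst, hY.comulId_snd]

theorem idComul_bosExp (i j : Fin θ) : idComul Δ (Q.bosExp u Y a i j) = 1 + a i j •
    (Q.letter u Y 0 i * (Q.letter u Y 1 j + Q.letter u Y 2 j)) := by
  rw [bosExp, map_add, map_one, map_smul, map_mul, idComul_fst (Q := Q) (u := u), hY.idComul_snd]

theorem comulId_bosExp (i j : Fin θ) : comulId Δ (Q.bosExp u Y a i j) = 1 + a i j •
    ((Q.letter u Y 0 i + Q.letter u Y 1 i) * Q.letter u Y 2 j) := by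
  rw [bosExp, map_add, map_one, map_smul, map_mul, hY.comulId_fst, hY.comulId_snd]

theorem commute_bosξ {x : H ⊗[k] (H ⊗[k] H)} {i : Fin θ}
    (hx : ∀ p, Commute x (Q.letter u Y p i)) :
    Commute x (idComul Δ (Q.bosξ u Y ξ i)) ∧ Commute x (comulId Δ (Q.bosξ u Y ξ i)) := by
  rw [hY.idComul_bosξ, hY.comulId_bosξ]
  exact ⟨(Commute.one_right _).add_right
      ((commute_expMul (hx 0) ((hx 1).add_right (hx 2)) _).smul_right _),
    (Commute.one_right _).add_right
      ((commute_expMul ((hx 0).add_right (hx 1)) (hx 2) _).smul_right _)⟩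

theorem commute_bosExp {x : H ⊗[k] (H ⊗[k] H)} {i j : Fin θ}
    (hx : ∀ p l, Commute x (Q.letter u Y p l)) :
    Commute x (idComul Δ (Q.bosExp u Y a i j)) ∧ Commute x (comulId Δ (Q.bosExp u Y a i j)) := by
  rw [hY.idComul_bosExp, hY.comulId_bosExp]
  exact ⟨(Commute.one_right _).add_right
      (((hx 0 i).mul_right ((hx 1 j).add_right (hx 2 j))).smul_right _),
    (Commute.one_right _).add_right
      ((((hx 0 i).add_right (hx 1 i)).mul_right (hx 2 j)).smul_right _)⟩

theorem bosξ_commute_letter (hc : IsCompatible Q ξ a) {i l : Fin θ} (hil : i ≠ l) (p : Fin 3) :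
    Commute (leg₂₃ k H (Q.bosξ u Y ξ i)) (Q.letter u Y p l) ∧
      Commute (leg₁₂ k H (Q.bosξ u Y ξ i)) (Q.letter u Y p l) := by
  rw [leg₂₃_bosξ hc, leg₁₂_bosξ]
  by_cases hξ : ξ i = 0
  · rw [hξ, zero_smul, zero_smul, add_zero]
    exact ⟨Commute.one_left _, Commute.one_left _⟩
  · exact ⟨(Commute.one_left _).add_left ((hY.expMul_commute hc hil hξ _ _ _).smul_left _),
      (Commute.one_left _).add_left ((hY.expMul_commute hc hil hξ _ _ _).smul_left _)⟩

variable [Finite G]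

theorem bosExp_commute_letter (hc : IsCompatible Q ξ a) {i j : Fin θ} (hij : i ≠ j) (p : Fin 3)
    (l : Fin θ) :
    Commute (leg₂₃ k H (Q.bosExp u Y a i j)) (Q.letter u Y p l) ∧
      Commute (leg₁₂ k H (Q.bosExp u Y a i j)) (Q.letter u Y p l) := by
  rw [leg₂₃_bosExp hc hij, leg₁₂_bosExp]
  by_cases ha : a i j = 0
  · rw [ha, zero_smul, zero_smul, add_zero]
    exact ⟨Commute.one_left _, Commute.one_left _⟩
  · exact ⟨(Commute.one_left _).add_left ((hY.pair_commute hc hij ha _ _ _ _).smul_left _),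
      (Commute.one_left _).add_left ((hY.pair_commute hc hij ha _ _ _ _).smul_left _)⟩

/-- The maps id ⊗ Δ and Δ ⊗ id replace a letter by a sum of two letters, so the twist equation is
`expMul_twist` for the letters of index i in the three positions. -/
theorem isTwist_bosξ (hc : IsCompatible Q ξ a) (i : Fin θ) :
    IsTwist Δ.toLinearMap ε.toLinearMap (Q.bosξ u Y ξ i) := by
  have hq := Q.isQRoot i
  rw [isTwist_iff]
  refine ⟨?_, ?_, ?_, ?_⟩
  · refine isUnit_one_add_of_mul_self ?_
    rw [smul_mul_smul_comm, expMul_mul_self (hY.snd_mul_fst i i) (hY.fst_pow i) (hY.snd_pow i),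
      smul_zero]
  · rw [leg₂₃_bosξ hc, leg₁₂_bosξ, hY.idComul_bosξ, hY.comulId_bosξ]
    exact expMul_twist hq (hY.letter_mul_letter_of_lt i (by decide))
      (hY.letter_mul_letter_of_lt i (by decide)) (hY.letter_mul_letter_of_lt i (by decide))
      (hY.letter_pow i _) (hY.letter_pow i _) (hY.letter_pow i _) _
  · have : idCounit ε (Q.snd u Y i) = 0 := by simp [idCounit, snd, hY.counit_gen]
    rw [bosξ, map_add, map_one, map_smul, map_expMul, this, expMul_zero_right, smul_zero, add_zero]
  · have : counitId ε (fst k Y i) = 0 := by simp [counitId, fst, hY.counit_gen]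
    rw [bosξ, map_add, map_one, map_smul, map_expMul, this, expMul_zero_left, smul_zero, add_zero]

/-- With letters a, b, c of index i and a', b', c' of index j, the terms linear in a_ij agree on
both sides without any relation. The quadratic terms both reduce to a b' b c', because products of a
letter of index i with one of index j are central among the letters and the letters have square 0.
-/
theorem isTwist_bosExp (hc : IsCompatible Q ξ a) {i j : Fin θ} (hij : i ≠ j) :
    IsTwist Δ.toLinearMap ε.toLinearMap (Q.bosExp u Y a i j) := by
  by_cases ha : a i j = 0
  · rw [bosExp, ha, zero_smul, add_zero]
    exact isTwist_one Δ ε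
  obtain ⟨_, _, _, hi, hj⟩ := hc.q_eq hij ha
  have hsq : ∀ l, Q.N l = 2 → ∀ p, Q.letter u Y p l * Q.letter u Y p l = 0 := fun l hl p => by
    rw [← pow_two, ← hl, hY.letter_pow]
  rw [isTwist_iff]
  refine ⟨?_, ?_, ?_, ?_⟩
  · refine isUnit_one_add_of_mul_self ?_
    have h1 := hY.fst_pow (k := k) i
    rw [hi, pow_two] at h1
    rw [smul_mul_smul_comm, mul_assoc, ← mul_assoc (Q.snd u Y j), hY.snd_mul_fst, smul_mul_assoc,
      mul_smul_comm, mul_assoc, ← mul_assoc (fst k Y i), h1, zero_mul, smul_zero, smul_zero]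
  · rw [leg₂₃_bosExp hc hij, leg₁₂_bosExp, hY.idComul_bosExp, hY.comulId_bosExp]
    have h1 := hY.pair_commute hc hij ha 1 2 0 i
    have h2 := hY.pair_commute hc hij ha 1 2 1 j
    have e1 : Q.letter u Y 1 i * Q.letter u Y 2 j *
        (Q.letter u Y 0 i * (Q.letter u Y 1 j + Q.letter u Y 2 j)) =
        Q.letter u Y 0 i * Q.letter u Y 1 j * (Q.letter u Y 1 i * Q.letter u Y 2 j) := by
      rw [← mul_assoc, h1.eq, mul_assoc, mul_add, h2.eq, mul_assoc (Q.letter u Y 1 i),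
        hsq j hj, mul_zero, add_zero, ← mul_assoc]
    have e2 : Q.letter u Y 0 i * Q.letter u Y 1 j *
        ((Q.letter u Y 0 i + Q.letter u Y 1 i) * Q.letter u Y 2 j) =
        Q.letter u Y 0 i * Q.letter u Y 1 j * (Q.letter u Y 1 i * Q.letter u Y 2 j) := by
      rw [add_mul, mul_add, ← mul_assoc _ (Q.letter u Y 0 i),
        (hY.pair_commute hc hij ha 0 1 0 i).eq, ← mul_assoc (Q.letter u Y 0 i), hsq i hi, zero_mul,
        zero_mul, zero_add]
    have e : ∀ s t : H ⊗[k] (H ⊗[k] H), (1 + s) * (1 + t) = 1 + (s + t) + s * t :=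
      fun s t => by noncomm_ring
    rw [e, e, smul_mul_smul_comm, smul_mul_smul_comm, e1, e2, ← smul_add, ← smul_add, mul_add,
      add_mul]
    congr 3
    abel
  · have : idCounit ε (Q.snd u Y j) = 0 := by simp [idCounit, snd, hY.counit_gen]
    rw [bosExp, map_add, map_one, map_smul, map_mul, this, mul_zero, smul_zero, add_zero]
  · have : counitId ε (fst k Y i) = 0 := by simp [counitId, fst, hY.counit_gen]
    rw [bosExp, map_add, map_one, map_smul, map_mul, this, zero_mul, smul_zero, add_zero]

/-- A factor of type ξ commutes with the letters of other indices, and each such index occurs once.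
A factor of type a_ij commutes with all letters. A later factor therefore always commutes with the
coproducts of an earlier one. -/
theorem isTwist_bosList_prod (hc : IsCompatible Q ξ a) :
    IsTwist Δ.toLinearMap ε.toLinearMap (Q.bosList u Y ξ a).prod := by
  refine isTwist_list_prod ?_ ?_
  · intro J hJ
    rcases List.mem_append.mp hJ with hJ | hJ
    · obtain ⟨i, _, rfl⟩ := List.mem_map.mp hJ
      exact hY.isTwist_bosξ hc i
    · obtain ⟨⟨i, j⟩, hp, rfl⟩ := List.mem_map.mp hJ
      exact hY.isTwist_bosExp hc (by simpa using (List.mem_filter.mp hp).2)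
  · refine List.pairwise_append.mpr ⟨?_, ?_, ?_⟩
    · refine List.pairwise_map.mpr ((List.nodup_finRange θ).imp fun {i l} hil => ?_)
      exact ⟨(hY.commute_bosξ fun p => (hY.bosξ_commute_letter hc (Ne.symm hil) p).1).1,
        (hY.commute_bosξ fun p => (hY.bosξ_commute_letter hc (Ne.symm hil) p).2).2⟩
    · refine List.pairwise_map.mpr (List.pairwise_of_forall_mem_list ?_)
      rintro p _ ⟨i, j⟩ hp
      have hij : i ≠ j := by simpa using (List.mem_filter.mp hp).2
      exact ⟨(hY.commute_bosExp fun p l => (hY.bosExp_commute_letter hc hij p l).1).1,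
        (hY.commute_bosExp fun p l => (hY.bosExp_commute_letter hc hij p l).2).2⟩
    · intro J hJ J' hJ'
      obtain ⟨l, _, rfl⟩ := List.mem_map.mp hJ
      obtain ⟨⟨i, j⟩, hp, rfl⟩ := List.mem_map.mp hJ'
      have hij : i ≠ j := by simpa using (List.mem_filter.mp hp).2
      exact ⟨(hY.commute_bosξ fun p => (hY.bosExp_commute_letter hc hij p l).1).1,
        (hY.commute_bosξ fun p => (hY.bosExp_commute_letter hc hij p l).2).2⟩

end IsHopfBosonized

end Twist

end QuantumLinearSpace

/-! ### Transport of twists along bialgebra maps, and the product with a twist of a subgroup. -/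

section MapTwist

variable {k L H : Type*} [Field k] [Ring L] [Algebra k L] [Ring H] [Algebra k H]
  {Δ : L →ₐ[k] L ⊗[k] L} {ε : L →ₐ[k] k} {Δ' : H →ₐ[k] H ⊗[k] H} {ε' : H →ₐ[k] k} (φ : L →ₐ[k] H)

theorem leg₂₃_map (X : L ⊗[k] L) : leg₂₃ k H (Algebra.TensorProduct.map φ φ X) =
    Algebra.TensorProduct.map φ (Algebra.TensorProduct.map φ φ) (leg₂₃ k L X) := by
  simp [leg₂₃]

theorem leg₁₂_map (X : L ⊗[k] L) : leg₁₂ k H (Algebra.TensorProduct.map φ φ X) =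
    Algebra.TensorProduct.map φ (Algebra.TensorProduct.map φ φ) (leg₁₂ k L X) := by
  induction X using TensorProduct.induction_on with
  | zero => simp only [map_zero]
  | add X Y hX hY => simp only [map_add, hX, hY]
  | tmul a b => simp [leg₁₂]

variable {φ}

theorem idComul_map (hΔ : ∀ a, Δ' (φ a) = Algebra.TensorProduct.map φ φ (Δ a)) (X : L ⊗[k] L) :
    idComul Δ' (Algebra.TensorProduct.map φ φ X) =
      Algebra.TensorProduct.map φ (Algebra.TensorProduct.map φ φ) (idComul Δ X) := by
  induction X using TensorProduct.induction_on with
  | zero => simp only [map_zero]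
  | add X Y hX hY => simp only [map_add, hX, hY]
  | tmul a b => simp [idComul, hΔ]

theorem comulId_map (hΔ : ∀ a, Δ' (φ a) = Algebra.TensorProduct.map φ φ (Δ a)) (X : L ⊗[k] L) :
    comulId Δ' (Algebra.TensorProduct.map φ φ X) =
      Algebra.TensorProduct.map φ (Algebra.TensorProduct.map φ φ) (comulId Δ X) := by
  induction X using TensorProduct.induction_on with
  | zero => simp only [map_zero]
  | add X Y hX hY => simp only [map_add, hX, hY]
  | tmul a b =>
    simp only [comulId, AlgHom.comp_apply, Algebra.TensorProduct.map_tmul, hΔ, AlgHom.id_apply]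
    induction Δ a using TensorProduct.induction_on with
    | zero => simp only [map_zero, TensorProduct.zero_tmul]
    | add X Y hX hY => simp only [map_add, TensorProduct.add_tmul, hX, hY]
    | tmul a b => simp

theorem IsTwist.map (hΔ : ∀ a, Δ' (φ a) = Algebra.TensorProduct.map φ φ (Δ a))
    (hε : ∀ a, ε' (φ a) = ε a) {J : L ⊗[k] L} (h : IsTwist Δ.toLinearMap ε.toLinearMap J) :
    IsTwist Δ'.toLinearMap ε'.toLinearMap (Algebra.TensorProduct.map φ φ J) := by
  have e1 : (idCounit ε').comp (Algebra.TensorProduct.map φ φ) = φ.comp (idCounit ε) := by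
    ext <;> simp [idCounit, hε]
  have e2 : (counitId ε').comp (Algebra.TensorProduct.map φ φ) = φ.comp (counitId ε) := by
    ext <;> simp [counitId, hε]
  rw [isTwist_iff] at *
  refine ⟨h.1.map _, ?_, ?_, ?_⟩
  · rw [leg₂₃_map, leg₁₂_map, idComul_map hΔ, comulId_map hΔ, ← map_mul, ← map_mul, h.2.1]
  · rw [← AlgHom.comp_apply, e1, AlgHom.comp_apply, h.2.2.1, map_one]
  · rw [← AlgHom.comp_apply, e2, AlgHom.comp_apply, h.2.2.2, map_one]

theorem commute_leg₂₃_idComul {P : H ⊗[k] H} (h : ∀ a, Commute P (Δ' (φ a))) (X : L ⊗[k] L) :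
    Commute (leg₂₃ k H P) (idComul Δ' (Algebra.TensorProduct.map φ φ X)) := by
  induction X using TensorProduct.induction_on with
  | zero => simp only [map_zero, Commute.zero_right]
  | add X Y hX hY => rw [map_add, map_add]; exact hX.add_right hY
  | tmul a b =>
    simp only [idComul, Algebra.TensorProduct.map_tmul, leg₂₃,
      Algebra.TensorProduct.includeRight_apply, AlgHom.id_apply, Commute, SemiconjBy,
      Algebra.TensorProduct.tmul_mul_tmul, one_mul, mul_one, (h b).eq]

theorem commute_leg₁₂_comulId {P : H ⊗[k] H} (h : ∀ a, Commute P (Δ' (φ a))) (X : L ⊗[k] L) :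
    Commute (leg₁₂ k H P) (comulId Δ' (Algebra.TensorProduct.map φ φ X)) := by
  induction X using TensorProduct.induction_on with
  | zero => simp only [map_zero, Commute.zero_right]
  | add X Y hX hY => rw [map_add, map_add]; exact hX.add_right hY
  | tmul a b =>
    refine Commute.map (x := P ⊗ₜ[k] (1 : H)) ?_ (Algebra.TensorProduct.assoc k k k H H H).toAlgHom
    rw [Algebra.TensorProduct.map_tmul]
    change Commute (P ⊗ₜ[k] (1 : H)) (Δ' (φ a) ⊗ₜ[k] φ b)
    simp only [Commute, SemiconjBy, Algebra.TensorProduct.tmul_mul_tmul, one_mul, mul_one, (h a).eq]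

/-- A twist of a subalgebra and a twist that commutes with the comultiplication of the subalgebra
have a twist as product. -/
theorem IsTwist.map_mul (hΔ : ∀ a, Δ' (φ a) = Algebra.TensorProduct.map φ φ (Δ a))
    (hε : ∀ a, ε' (φ a) = ε a) {J : L ⊗[k] L} (h : IsTwist Δ.toLinearMap ε.toLinearMap J)
    {P : H ⊗[k] H} (hP : IsTwist Δ'.toLinearMap ε'.toLinearMap P)
    (hc : ∀ a, Commute P (Δ' (φ a))) :
    IsTwist Δ'.toLinearMap ε'.toLinearMap (Algebra.TensorProduct.map φ φ J * P) :=
  (h.map hΔ hε).mul hP (commute_leg₂₃_idComul hc J) (commute_leg₁₂_comulId hc J)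

end MapTwist

namespace BraidedData

variable {k G R : Type*} [Field k] [Group G] [Ring R] [Algebra k R] {D : BraidedData k G R}

variable (D) in
/-- The inclusion of `k[F]` in the bosonization as an algebra map. -/
def ofGroupHom (F : Subgroup G) : MonoidAlgebra k F →ₐ[k] Smash D.act :=
  MonoidAlgebra.lift k (Smash D.act) F (D.grp.comp F.subtype)

theorem ofGroupHom_single (F : Subgroup G) (f : F) :
    D.ofGroupHom F (MonoidAlgebra.of k F f) = D.grp f := by
  rw [ofGroupHom, MonoidAlgebra.lift_of]; rfl

variable [Finite G]

theorem IsBialg.bosComul_grp (hD : D.IsBialg) (g : G) :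
    D.bosComul (D.grp g) = D.grp g ⊗ₜ D.grp g := by
  have : D.bosComul (Smash.inc D.act g 1) = _ := bosComul_inc g 1
  rw [hD.comul_one, hD.bosTensor_one, one_mul] at this
  exact this

omit [Finite G] in
theorem IsBialg.bosCounit_grp (hD : D.IsBialg) (g : G) : D.bosCounit (D.grp g) = 1 :=
  (bosCounit_inc g 1).trans hD.counit_one

theorem comul_ofGroupHom (hD : D.IsBialg) {F : Subgroup G} (a : MonoidAlgebra k F) :
    hD.comulHom (D.ofGroupHom F a) = Algebra.TensorProduct.map (D.ofGroupHom F) (D.ofGroupHom F)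
      (Bialgebra.comulAlgHom k (MonoidAlgebra k F) a) := by
  induction a using MonoidAlgebra.induction_on with
  | of f =>
    have h : Bialgebra.comulAlgHom k (MonoidAlgebra k F) (MonoidAlgebra.of k F f) =
        MonoidAlgebra.of k F f ⊗ₜ[k] MonoidAlgebra.of k F f := by
      simp [MonoidAlgebra.of_apply]
    rw [h, Algebra.TensorProduct.map_tmul, ofGroupHom_single]
    exact hD.bosComul_grp _
  | add a b ha hb => simp only [map_add, ha, hb]
  | smul c a ha => simp only [map_smul, ha]

omit [Finite G] in
theorem counit_ofGroupHom (hD : D.IsBialg) {F : Subgroup G} (a : MonoidAlgebra k F) :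
    hD.counitHom (D.ofGroupHom F a) = Bialgebra.counitAlgHom k (MonoidAlgebra k F) a := by
  induction a using MonoidAlgebra.induction_on with
  | of f =>
    have h : Bialgebra.counitAlgHom k (MonoidAlgebra k F) (MonoidAlgebra.of k F f) = 1 := by
      simp [MonoidAlgebra.of_apply]
    rw [h, ofGroupHom_single]
    exact hD.bosCounit_grp _
  | add a b ha hb => simp only [map_add, ha, hb]
  | smul c a ha => simp only [map_smul, ha]

/-- Commuting with each Δ(f) = f ⊗ f means commuting with Δ of all of kF. This is the condition
under which the twist of kF and that of R can be multiplied. -/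
theorem isTwist_bosTwist (hD : D.IsBialg) {F : Subgroup G} {J : R ⊗[k] R}
    {T : MonoidAlgebra k F ⊗[k] MonoidAlgebra k F}
    (hT : IsTwist (Coalgebra.comul (R := k)) (Coalgebra.counit (R := k)) T)
    (hJ : IsTwist D.bosComul D.bosCounit (D.bosTensor J))
    (hc : ∀ f ∈ F, Commute (D.bosTensor J) (D.grp f ⊗ₜ D.grp f)) :
    IsTwist D.bosComul D.bosCounit (D.bosTwist J T) := by
  have h : ∀ a, Commute (D.bosTensor J) (hD.comulHom (D.ofGroupHom F a)) := by
    intro a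
    induction a using MonoidAlgebra.induction_on with
    | of f =>
      rw [ofGroupHom_single, hD.comulHom_apply, hD.bosComul_grp]
      exact hc f f.2
    | add a b ha hb => rw [map_add, map_add]; exact ha.add_right hb
    | smul c a ha => rw [map_smul, map_smul]; exact ha.smul_right c
  exact IsTwist.map_mul (Δ := Bialgebra.comulAlgHom k (MonoidAlgebra k F))
    (ε := Bialgebra.counitAlgHom k (MonoidAlgebra k F)) (Δ' := hD.comulHom) (ε' := hD.counitHom)
    (φ := D.ofGroupHom F) (comul_ofGroupHom hD) (counit_ofGroupHom hD) hT hJ h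

end BraidedData

/-! ### Invariance and coinvariance of the twist. -/

namespace QuantumLinearSpace

section

variable {k G H : Type*} [Field k] [Group G] [Ring H] [Algebra k H] {θ : ℕ}
  {Q : QuantumLinearSpace k G θ} {u : G →* H} {Y : Fin θ → H} {ξ : Fin θ → k}
  {a : Fin θ → Fin θ → k}

/-- Conjugation by f ⊗ f multiplies the letters of index i by χ_i(f), so a factor with ξ_i ≠ 0 sees
χ_i(f)^N_i = 1 and one with a_ij ≠ 0 sees χ_i(f) χ_j(f) = 1. -/
theorem IsBosonized.commute_bosList_prod (hY : IsBosonized Q u Y) {f : G}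
    (hξ : ∀ i, ξ i ≠ 0 → Q.χ i f ^ Q.N i = 1)
    (ha : ∀ i j, i ≠ j → a i j ≠ 0 → Q.χ i f * Q.χ j f = 1) :
    Commute (Q.bosList u Y ξ a).prod (u f ⊗ₜ[k] u f) := by
  have hm : ∀ i, Y i * u f = ((Q.χ i f)⁻¹ : kˣ) • (u f * Y i) := fun i => by
    rw [eq_inv_smul_iff, hY.grp_mul]; rfl
  have h1 : ∀ i, fst k Y i * (u f ⊗ₜ[k] u f) =
      (((Q.χ i f)⁻¹ : kˣ) : k) • ((u f ⊗ₜ[k] u f) * fst k Y i) := fun i => by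
    simp [fst, hm, Units.smul_def, ← TensorProduct.smul_tmul']
  have h2 : ∀ i, Q.snd u Y i * (u f ⊗ₜ[k] u f) =
      (((Q.χ i f)⁻¹ : kˣ) : k) • ((u f ⊗ₜ[k] u f) * Q.snd u Y i) := fun i => by
    simp [snd, hm, Units.smul_def, grp_mul_grp]
  refine Commute.list_prod_left _ _ fun s hs => ?_
  rcases List.mem_append.mp hs with hs | hs
  · obtain ⟨i, _, rfl⟩ := List.mem_map.mp hs
    by_cases h : ξ i = 0
    · rw [bosξ, h, zero_smul, add_zero]; exact Commute.one_left _
    · refine (Commute.one_left _).add_left ((expMul_commute_of_mul_eq (h1 i) (h2 i) ?_).smul_left _)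
      rw [← Units.val_pow_eq_pow_val, inv_pow, hξ i h, inv_one, Units.val_one]
  · obtain ⟨⟨i, j⟩, hp, rfl⟩ := List.mem_map.mp hs
    have hij : i ≠ j := by simpa using (List.mem_filter.mp hp).2
    by_cases h : a i j = 0
    · rw [bosExp, h, zero_smul, add_zero]; exact Commute.one_left _
    · refine (Commute.one_left _).add_left (Commute.smul_left ?_ _)
      have := ha i j hij h
      rw [Commute, SemiconjBy, mul_assoc, h2, mul_smul_comm, ← mul_assoc, h1, smul_mul_assoc,
        smul_smul, ← Units.val_mul, ← mul_inv, mul_comm (Q.χ j f), this, inv_one, Units.val_one,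
        one_smul, mul_assoc]

end

section

variable {k G R : Type*} [Field k] [Group G] [Ring R] [Algebra k R] {θ : ℕ}
  {Q : QuantumLinearSpace k G θ} {D : BraidedData k G R} {y : Fin θ → R} {ξ : Fin θ → k}
  {a : Fin θ → Fin θ → k} [Finite G]

theorem IsRealization.isHopfBosonized (hD : D.IsBialg) (hy : Q.IsRealization D y) :
    IsHopfBosonized Q hD.comulHom hD.counitHom D.grp (D.incHom ∘ y) where
  grp_mul g i := (hy.diag i).grp_mul g
  pow_N i := by rw [Function.comp_apply, ← map_pow, hy.pow_N, map_zero]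
  comm i j h := by simp only [Function.comp_apply, ← map_mul, hy.comm i j h, map_smul]
  comul_grp g := hD.bosComul_grp g
  comul_gen i := (hy.diag i).bosComul hD.toIsGraded
  counit_gen i := (BraidedData.bosCounit_inc 1 (y i)).trans (hy.diag i).counit

theorem IsRealization.bosTensor_twistD (hD : D.IsBialg) (hy : Q.IsRealization D y)
    (hc : IsCompatible Q ξ a) :
    D.bosTensor (Q.twistD D y ξ a) = (Q.bosList D.grp (D.incHom ∘ y) ξ a).prod := by
  rw [QuantumLinearSpace.bosTensor_twistD hD, twistList, List.map_append, List.map_map,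
    List.map_map, bosList]
  congr 2
  · exact List.map_congr_left fun i _ => hy.bosTensor_twistξ hD i
  · refine List.map_congr_left fun p hp => hy.bosTensor_twistExp hD hc ?_
    simpa using (List.mem_filter.mp hp).2

theorem IsRealization.isTwist_bosTensor (hD : D.IsBialg) (hy : Q.IsRealization D y)
    (hc : IsCompatible Q ξ a) : IsTwist D.bosComul D.bosCounit (D.bosTensor (Q.twistD D y ξ a)) := by
  rw [hy.bosTensor_twistD hD hc]
  exact (hy.isHopfBosonized hD).isTwist_bosList_prod hc

theorem IsRealization.commute_bosTensor (hD : D.IsBialg) (hy : Q.IsRealization D y)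
    (hc : IsCompatible Q ξ a) {f : G} (hξ : ∀ i, ξ i ≠ 0 → Q.χ i f ^ Q.N i = 1)
    (ha : ∀ i j, i ≠ j → a i j ≠ 0 → Q.χ i f * Q.χ j f = 1) :
    Commute (D.bosTensor (Q.twistD D y ξ a)) (D.grp f ⊗ₜ D.grp f) := by
  rw [hy.bosTensor_twistD hD hc]
  exact (hy.isHopfBosonized hD).toIsBosonized.commute_bosList_prod hξ ha

/-- The tensors x_i^n ⊗ x_i^(N_i - n) and x_i ⊗ x_j have degrees g_i^N_i and g_i g_j, which are 1
whenever their coefficients are nonzero. -/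
theorem IsRealization.twistD_mem_hom2 (hD : D.IsGraded) (hy : Q.IsRealization D y)
    (hc : IsCompatible Q ξ a) : Q.twistD D y ξ a ∈ D.hom2 1 := by
  have h1 : (1 : R) ⊗ₜ[k] (1 : R) ∈ D.hom2 1 :=
    D.tmul_mem_hom2 hD.one_mem hD.one_mem (one_mul 1)
  have key : ∀ l : List (R ⊗[k] R), (∀ s ∈ l, s ∈ D.hom2 1) →
      l.foldr (fun s t => D.braidedMul s t) (1 ⊗ₜ 1) ∈ D.hom2 1 := by
    intro l hl
    induction l with
    | nil => exact h1
    | cons s l ih =>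
      have := hD.braidedMul_mem_hom2 (hl s (by simp)) (ih fun t ht => hl t (by simp [ht]))
      rwa [one_mul] at this
  refine key _ fun s hs => ?_
  rcases List.mem_append.mp hs with hs | hs
  · obtain ⟨i, _, rfl⟩ := List.mem_map.mp hs
    refine add_mem h1 ?_
    by_cases h : ξ i = 0
    · rw [h, zero_smul]; exact zero_mem _
    · refine Submodule.smul_mem _ _ (Submodule.sum_mem _ fun n hn => Submodule.smul_mem _ _ ?_)
      refine D.tmul_mem_hom2 (hD.pow_mem (hy.diag i).mem n) (hD.pow_mem (hy.diag i).mem _) ?_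
      rw [← pow_add, Nat.add_sub_cancel' (Finset.mem_Ioo.mp hn).2.le, hc.ξ_coinvariant i h]
  · obtain ⟨⟨i, j⟩, hp, rfl⟩ := List.mem_map.mp hs
    have hij : i ≠ j := by simpa using (List.mem_filter.mp hp).2
    refine Submodule.sum_mem _ fun n hn => Submodule.smul_mem _ _ ?_
    have ha : a i j • (y i ⊗ₜ[k] y j) ∈ D.hom2 1 := by
      by_cases h : a i j = 0
      · rw [h, zero_smul]; exact zero_mem _
      · exact Submodule.smul_mem _ _ (D.tmul_mem_hom2 (hy.diag i).mem (hy.diag j).mem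
          (hc.a_coinvariant i j hij h))
    clear hn
    induction n with
    | zero => exact h1
    | succ n ih =>
      have := hD.braidedMul_mem_hom2 ha ih
      rw [one_mul] at this
      rwa [Function.iterate_succ_apply']

end

end QuantumLinearSpace

/-! ### Twists as 2-cocycles on the dual. -/

section DualCocycle

variable {k H : Type*} [Field k] [Ring H] [Algebra k H]

/-- The bilinear form on the dual space defined by an element of the tensor square. -/
def pairing (T : H ⊗[k] H) : Module.Dual k H ⊗[k] Module.Dual k H →ₗ[k] k :=
  (TensorProduct.dualDistrib k H H).flip T

theorem pairing_apply (T : H ⊗[k] H) (X : Module.Dual k H ⊗[k] Module.Dual k H) :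
    pairing T X = TensorProduct.dualDistrib k H H X T := rfl

theorem convolve_pairing_tmul (a b c d : H) (F K : Module.Dual k H ⊗[k] Module.Dual k H) :
    convolve (pairing (a ⊗ₜ b)) (pairing (c ⊗ₜ d)) F K =
      TensorProduct.dualDistrib k H H F (a ⊗ₜ c) * TensorProduct.dualDistrib k H H K (b ⊗ₜ d) := by
  rw [convolve]
  induction F using TensorProduct.induction_on with
  | zero => simp
  | add F F' h h' => simp only [TensorProduct.add_tmul, map_add, LinearMap.add_apply, add_mul, h, h']
  | tmul f f' =>
    induction K using TensorProduct.induction_on with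
    | zero => simp
    | add K K' h h' => simp only [TensorProduct.tmul_add, map_add, LinearMap.add_apply, mul_add, h, h']
    | tmul g g' => simp [pairing_apply]; ring

/-- The coproduct of the dual is the transposed multiplication, so convolution of evaluations is
evaluation on the product. The coproducts F and K are given, so finite dimension plays no role. -/
theorem convolve_pairing {f g : Module.Dual k H} {F K : Module.Dual k H ⊗[k] Module.Dual k H}
    (hF : IsDualComul f F) (hK : IsDualComul g K) (S T : H ⊗[k] H) :
    convolve (pairing S) (pairing T) F K =
      TensorProduct.dualDistrib k H H (f ⊗ₜ g) (S * T) := by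
  have add_left : ∀ σ σ' τ : Module.Dual k H ⊗[k] Module.Dual k H →ₗ[k] k,
      convolve (σ + σ') τ F K = convolve σ τ F K + convolve σ' τ F K := fun σ σ' τ => by
    simp [convolve, TensorProduct.map_add_left]
  have add_right : ∀ σ τ τ' : Module.Dual k H ⊗[k] Module.Dual k H →ₗ[k] k,
      convolve σ (τ + τ') F K = convolve σ τ F K + convolve σ τ' F K := fun σ σ' τ => by
    simp [convolve, TensorProduct.map_add_right]
  have padd : ∀ S T : H ⊗[k] H, pairing (S + T) = pairing S + pairing T := fun S T =>
    map_add (TensorProduct.dualDistrib k H H).flip S T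
  have pzero : pairing (0 : H ⊗[k] H) = 0 := map_zero (TensorProduct.dualDistrib k H H).flip
  induction S using TensorProduct.induction_on with
  | zero => simp [pzero, convolve]
  | add S S' h h' => rw [padd, add_left, h, h', add_mul, map_add]
  | tmul a b =>
    induction T using TensorProduct.induction_on with
    | zero => simp [pzero, convolve]
    | add S S' h h' => rw [padd, add_right, h, h', mul_add, map_add]
    | tmul c d => rw [convolve_pairing_tmul, hF, hK]; simp

/-- The product of the dual is the transposed coproduct: the form (f, g) ↦ σ(f g, h) is again an
evaluation, on (Δ ⊗ id)(T) contracted with h in the last slot. -/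
theorem lift_dualMul_right (Δ : H →ₗ[k] H ⊗[k] H) (T : H ⊗[k] H) (h : Module.Dual k H) :
    TensorProduct.lift ((dualMul Δ).compr₂ (pairing T ∘ₗ (TensorProduct.mk k _ _).flip h)) =
      pairing (TensorProduct.rid k _ (h.lTensor _ (Δ.rTensor H T))) := by
  refine TensorProduct.ext' fun f g => ?_
  change TensorProduct.dualDistrib k H H (dualMul Δ f g ⊗ₜ h) T =
    TensorProduct.dualDistrib k H H (f ⊗ₜ g) _
  induction T using TensorProduct.induction_on with
  | zero => simp
  | add S S' h h' => simp only [map_add, h, h']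
  | tmul a b => simp [dualMul, mul_comm]

theorem lift_dualMul_left (Δ : H →ₗ[k] H ⊗[k] H) (T : H ⊗[k] H) (f : Module.Dual k H) :
    TensorProduct.lift ((dualMul Δ).compr₂ (pairing T ∘ₗ TensorProduct.mk k _ _ f)) =
      pairing (TensorProduct.lid k _ (f.rTensor _ (Δ.lTensor H T))) := by
  refine TensorProduct.ext' fun g h => ?_
  change TensorProduct.dualDistrib k H H (f ⊗ₜ dualMul Δ g h) T =
    TensorProduct.dualDistrib k H H (g ⊗ₜ h) _
  induction T using TensorProduct.induction_on with
  | zero => simp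
  | add S S' h h' => simp only [map_add, h, h']
  | tmul a b => simp [dualMul]

theorem mul_rid_lTensor {A : Type*} [Ring A] [Algebra k A] (h : Module.Dual k H) (T : A)
    (X : A ⊗[k] H) : T * TensorProduct.rid k A (h.lTensor A X) =
      TensorProduct.rid k A (h.lTensor A ((T ⊗ₜ 1) * X)) := by
  induction X using TensorProduct.induction_on with
  | zero => simp
  | add S S' h h' => simp only [map_add, mul_add, h, h']
  | tmul a b => simp

theorem mul_lid_rTensor {A : Type*} [Ring A] [Algebra k A] (h : Module.Dual k H) (T : A)
    (X : H ⊗[k] A) : T * TensorProduct.lid k A (h.rTensor A X) =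
      TensorProduct.lid k A (h.rTensor A ((1 ⊗ₜ T) * X)) := by
  induction X using TensorProduct.induction_on with
  | zero => simp
  | add S S' h h' => simp only [map_add, mul_add, h, h']
  | tmul a b => simp

theorem dualDistrib_assoc (f g h : Module.Dual k H) (X : (H ⊗[k] H) ⊗[k] H) :
    TensorProduct.dualDistrib k H H (g ⊗ₜ h)
        (TensorProduct.lid k _ (f.rTensor _ (TensorProduct.assoc k H H H X))) =
      TensorProduct.dualDistrib k H H (f ⊗ₜ g) (TensorProduct.rid k _ (h.lTensor _ X)) := by
  induction X using TensorProduct.induction_on with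
  | zero => simp
  | add S S' h h' => simp only [map_add, h, h']
  | tmul X c =>
    induction X using TensorProduct.induction_on with
    | zero => simp
    | add S S' h h' => simp only [map_add, TensorProduct.add_tmul, h, h']
    | tmul a b => simp; ring

/-- A twist defines a 2-cocycle on the dual Hopf algebra. -/
theorem IsTwist.isDualCocycle {Δ : H →ₗ[k] H ⊗[k] H} {ε : H →ₗ[k] k} {T : H ⊗[k] H}
    (hT : IsTwist Δ ε T) : IsDualCocycle Δ ε (pairing T) where
  convolution_invertible := by
    obtain ⟨S, hTS, hST⟩ := isUnit_iff_exists.mp hT.invertible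
    refine ⟨pairing S, fun f g F K hF hK => ?_⟩
    rw [convolve_pairing hF hK, convolve_pairing hF hK, hTS, hST, Algebra.TensorProduct.one_def,
      TensorProduct.dualDistrib_apply]
    exact ⟨rfl, rfl⟩
  one_left f := by
    rw [← hT.counit_left, pairing_apply]
    clear hT
    induction T using TensorProduct.induction_on with
    | zero => simp
    | add S S' h h' => simp only [map_add, h, h']
    | tmul a b => simp
  one_right f := by
    rw [← hT.counit_right, pairing_apply]
    clear hT
    induction T using TensorProduct.induction_on with
    | zero => simp
    | add S S' h h' => simp only [map_add, h, h']
    | tmul a b => simp [mul_comm]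
  cocycle f g h F K L hF hK hL := by
    -- Both sides become the value of f ⊗ g ⊗ h on one side of the twist equation.
    rw [lift_dualMul_left, lift_dualMul_right, convolve_pairing hF hK, convolve_pairing hK hL,
      mul_rid_lTensor, mul_lid_rTensor, hT.twist, dualDistrib_assoc]

end DualCocycle

/-! ### Balanced cocycles from coinvariant twists. -/

namespace BraidedData

variable {k G R : Type*} [Field k] [Group G] [Finite G] [Ring R] [Algebra k R]
  {D : BraidedData k G R} (hD : D.IsBialg)

omit [Finite G] in
theorem dualInr_inc (α : G → k) (h : G) (r : R) :
    D.dualInr α (Smash.inc D.act h r) = α h * D.counit r :=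
  Smash.lift_inc ..

omit [Finite G] in
theorem dualInl_inc (f : Module.Dual k R) (h : G) (r : R) :
    D.dualInl f (Smash.inc D.act h r) = f r :=
  Smash.lift_inc ..

theorem dualMul_inc (f g : Module.Dual k (Smash D.act)) (h : G) (r : R) :
    dualMul D.bosComul f g (Smash.inc D.act h r) =
      TensorProduct.dualDistrib k _ _ (f ⊗ₜ g) (D.bosTensor (D.comul r) * D.grp h ⊗ₜ D.grp h) := by
  rw [← bosComul_inc]; rfl

include hD

/-- α contains the counit of R, which keeps only the components of Δ(r) with second leg in degree 1;
these leave r # h and the value α(h). -/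
theorem dualMul_dualInr (α : G → k) (f : Module.Dual k (Smash D.act)) (h : G) (r : R) :
    dualMul D.bosComul f (D.dualInr α) (Smash.inc D.act h r) = α h * f (Smash.inc D.act h r) := by
  have : TensorProduct.dualDistrib k _ _ (f ⊗ₜ D.dualInr α) ∘ₗ
      LinearMap.mulRight k (D.grp h ⊗ₜ[k] D.grp h) ∘ₗ D.bosTensor =
      α h • (f ∘ₗ Smash.inc D.act h ∘ₗ (TensorProduct.rid k R).toLinearMap ∘ₗ D.counit.lTensor R) :=
    tensor_hom_ext hD.iSup_hom fun a b r hr s hs => by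
      by_cases hb : b = 1
      · subst hb
        simp [bosTensor_tmul hs, inc_mul_grp, dualInr_inc]
        ring
      · simp [bosTensor_tmul hs, inc_mul_grp, dualInr_inc, hD.counit_hom hs hb]
  rw [dualMul_inc]
  exact (LinearMap.congr_fun this _).trans (by simp [hD.rid_comul])

/-- Now the counit forces the first leg of Δ(r) into degree 1, so the second leg has the full degree
c, and α is evaluated at the group part c h of the first factor. -/
theorem dualInr_dualMul (α : G → k) (g : Module.Dual k (Smash D.act)) (h : G) {c : G} {r : R}
    (hr : r ∈ D.hom c) :
    dualMul D.bosComul (D.dualInr α) g (Smash.inc D.act h r) =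
      α (c * h) * g (Smash.inc D.act h r) := by
  have : ∀ X ∈ D.hom2 c, TensorProduct.dualDistrib k _ _ (D.dualInr α ⊗ₜ g)
      (D.bosTensor X * D.grp h ⊗ₜ D.grp h) =
      α (c * h) * g (Smash.inc D.act h (TensorProduct.lid k R (D.counit.rTensor R X))) := by
    intro X hX
    induction hX using Submodule.span_induction with
    | zero => simp
    | add X Y _ _ hX hY => simp only [map_add, add_mul, mul_add, hX, hY]
    | smul x X _ hX => simp only [map_smul, smul_mul_assoc, hX, smul_eq_mul, mul_left_comm]
    | mem X hX =>
      obtain ⟨a, b, r, s, hr', hs, rfl, rfl⟩ := hX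
      by_cases ha : a = 1
      · subst ha
        simp [bosTensor_tmul hs, inc_mul_grp, dualInr_inc]
        ring
      · simp [bosTensor_tmul hs, inc_mul_grp, dualInr_inc, hD.counit_hom hr' ha]
  rw [dualMul_inc, this _ (hD.comul_mem hr), hD.lid_comul]

/-- For r of degree a and s of degree b with a b = 1, the form is evaluation on r # b ⊗ s # 1.
Inserting α between the arguments gives α(b) from either side, on the far left it gives α(a b) =
α(1), and on the far right α(1). -/
theorem isBalancedDualCocycle {J : R ⊗[k] R} (hJ : J ∈ D.hom2 1)
    (hT : IsTwist D.bosComul D.bosCounit (D.bosTensor J)) :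
    D.IsBalancedDualCocycle (pairing (D.bosTensor J)) where
  toIsDualCocycle := hT.isDualCocycle
  balanced α f g := by
    simp only [pairing_apply]
    clear * - hD hJ
    induction hJ using Submodule.span_induction with
    | zero => simp
    | add X Y _ _ hX hY => simp only [map_add, hX, hY]
    | smul x X _ hX => simp only [map_smul, hX]
    | mem X hX =>
      obtain ⟨a, b, r, s, hr, hs, _, rfl⟩ := hX
      simp only [bosTensor_tmul hs, TensorProduct.dualDistrib_apply, dualMul_dualInr hD,
        dualInr_dualMul hD α g 1 hs, mul_one]
      ring
  left_linear α f g := by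
    simp only [pairing_apply]
    clear * - hD hJ
    induction hJ using Submodule.span_induction with
    | zero => simp
    | add X Y _ _ hX hY => simp only [map_add, mul_add, hX, hY]
    | smul x X _ hX => simp only [map_smul, hX, smul_eq_mul, mul_left_comm]
    | mem X hX =>
      obtain ⟨a, b, r, s, hr, hs, hab, rfl⟩ := hX
      simp only [bosTensor_tmul hs, TensorProduct.dualDistrib_apply,
        dualInr_dualMul hD α f b hr, hab]
      ring
  right_linear α f g := by
    simp only [pairing_apply]
    clear * - hD hJ
    induction hJ using Submodule.span_induction with
    | zero => simp
    | add X Y _ _ hX hY => simp only [map_add, add_mul, hX, hY]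
    | smul x X _ hX => simp only [map_smul, hX, smul_eq_mul, mul_assoc]
    | mem X hX =>
      obtain ⟨a, b, r, s, hr, hs, _, rfl⟩ := hX
      simp only [bosTensor_tmul hs, TensorProduct.dualDistrib_apply, dualMul_dualInr hD]
      ring

theorem isTwistOfCocycle (J : R ⊗[k] R) : D.IsTwistOfCocycle (pairing (D.bosTensor J)) J := by
  intro f g
  have : TensorProduct.dualDistrib k R R (f ⊗ₜ g) =
      TensorProduct.dualDistrib k _ _ (D.dualInl f ⊗ₜ D.dualInl g) ∘ₗ D.bosTensor :=
    tensor_hom_ext hD.iSup_hom fun a b r hr s hs => by simp [bosTensor_tmul hs, dualInl_inc]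
  exact LinearMap.congr_fun this J

end BraidedData

/-! ### Braided bialgebras whose action is inner: untwisting the braided tensor square. -/

namespace BraidedData

variable {k Γ H : Type*} [Field k] [Group Γ] [Ring H] [Algebra k H] (E : BraidedData k Γ H)

section Shift

variable {A : Type*} [Ring A] [Algebra k A]

/-- `x ⊗ y ↦ x v(y₍₋₁₎) ⊗ y₍₀₎` -/
def shift (v : Γ →* A) : A ⊗[k] H →ₗ[k] A ⊗[k] H :=
  ∑ᶠ g : Γ, TensorProduct.map (LinearMap.mulRight k (v g)) (E.pr g)

/-- `x ⊗ y ↦ x v(y₍₋₁₎)⁻¹ ⊗ y₍₀₎` -/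
def unshift (v : Γ →* A) : A ⊗[k] H →ₗ[k] A ⊗[k] H :=
  ∑ᶠ g : Γ, TensorProduct.map (LinearMap.mulRight k (v g⁻¹)) (E.pr g)

variable {E} [Finite Γ]

theorem shift_tmul (v : Γ →* A) {g : Γ} {y : H} (hy : y ∈ E.hom g) (x : A) :
    E.shift v (x ⊗ₜ y) = (x * v g) ⊗ₜ y := by
  have := Fintype.ofFinite Γ
  rw [shift, finsum_eq_sum_of_fintype, LinearMap.sum_apply, Finset.sum_eq_single g]
  · simp [pr_of_mem hy]
  · intro h _ hne
    simp [pr_of_mem_ne hy hne]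
  · simp

theorem unshift_tmul (v : Γ →* A) {g : Γ} {y : H} (hy : y ∈ E.hom g) (x : A) :
    E.unshift v (x ⊗ₜ y) = (x * v g⁻¹) ⊗ₜ y := by
  have := Fintype.ofFinite Γ
  rw [unshift, finsum_eq_sum_of_fintype, LinearMap.sum_apply, Finset.sum_eq_single g]
  · simp [pr_of_mem hy]
  · intro h _ hne
    simp [pr_of_mem_ne hy hne]
  · simp

omit [Finite Γ] in
theorem right_hom_ext (hE : ⨆ g, E.hom g = ⊤) {N : Type*} [AddCommGroup N] [Module k N]
    {f f' : A ⊗[k] H →ₗ[k] N} (hf : ∀ g, ∀ y ∈ E.hom g, ∀ x, f (x ⊗ₜ y) = f' (x ⊗ₜ y)) : f = f' :=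
  TensorProduct.ext <| LinearMap.ext fun x => hom_ext hE fun g y hy => hf g y hy x

theorem unshift_shift (hE : ⨆ g, E.hom g = ⊤) (v : Γ →* A) (X : A ⊗[k] H) :
    E.unshift v (E.shift v X) = X := by
  have : E.unshift v ∘ₗ E.shift v = LinearMap.id := right_hom_ext hE fun g y hy x => by
    rw [LinearMap.comp_apply, shift_tmul v hy, unshift_tmul v hy, mul_assoc, ← map_mul,
      mul_inv_cancel, map_one, mul_one, LinearMap.id_apply]
  exact LinearMap.congr_fun this X

theorem shift_unshift (hE : ⨆ g, E.hom g = ⊤) (v : Γ →* A) (X : A ⊗[k] H) :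
    E.shift v (E.unshift v X) = X := by
  have : E.shift v ∘ₗ E.unshift v = LinearMap.id := right_hom_ext hE fun g y hy x => by
    rw [LinearMap.comp_apply, unshift_tmul v hy, shift_tmul v hy, mul_assoc, ← map_mul,
      inv_mul_cancel, map_one, mul_one, LinearMap.id_apply]
  exact LinearMap.congr_fun this X

theorem shift_injective (hE : ⨆ g, E.hom g = ⊤) (v : Γ →* A) : Function.Injective (E.shift v) :=
  Function.LeftInverse.injective (unshift_shift hE v)

end Shift

section Collapse

variable {E} {u : Γ →* H} (hu : ∀ g x, u g * x = E.act g x * u g)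

/-- If the action of `Γ` on `H` is the conjugation by `u : Γ →* H`, then `x # g ↦ x u(g)` is an
algebra map from the smash product to `H`. -/
def collapse : Smash E.act →ₐ[k] H :=
  AlgHom.ofLinearMap (Smash.lift E.act fun g => LinearMap.mulRight k (u g))
    (by simp [Smash.one_def, Smash.lift_inc])
    (fun x y => by
      induction x using Smash.induction with
      | h0 => simp
      | hadd a b ha hb => simp only [add_mul, map_add, ha, hb]
      | hinc g r =>
        induction y using Smash.induction with
        | h0 => simp
        | hadd a b ha hb => simp only [mul_add, map_add, ha, hb]
        | hinc h s =>
          simp only [Smash.inc_mul_inc, Smash.lift_inc, LinearMap.mulRight_apply, map_mul]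
          rw [mul_assoc, ← mul_assoc (E.act g s), ← hu]
          simp only [mul_assoc])

theorem collapse_inc (g : Γ) (x : H) : collapse hu (Smash.inc E.act g x) = x * u g :=
  Smash.lift_inc ..

theorem collapse_grp (g : Γ) : collapse hu (E.grp g) = u g :=
  (collapse_inc hu g 1).trans (one_mul _)

variable (E u) in
/-- The relation `u(g) # 1 = 1 # g`. -/
def collapseRel (s t : Smash E.act) : Prop :=
  ∃ g : Γ, s = Smash.inc E.act 1 (u g) ∧ t = Smash.inc E.act g 1

theorem collapse_rel {s t : Smash E.act} (h : E.collapseRel u s t) :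
    collapse hu s = collapse hu t := by
  obtain ⟨g, rfl, rfl⟩ := h
  rw [collapse_inc, collapse_inc, map_one, mul_one, one_mul]

/-- The quotient of the smash product by the relation `u(g) # 1 = 1 # g` is `H`. -/
def collapseEquiv : RingQuot (E.collapseRel u) ≃ₐ[k] H :=
  AlgEquiv.ofAlgHom (RingQuot.liftAlgHom k ⟨collapse hu, fun _ _ h => collapse_rel hu h⟩)
    ((RingQuot.mkAlgHom k (E.collapseRel u)).comp E.incHom)
    (AlgHom.ext fun x => by
      simp only [AlgHom.comp_apply, RingQuot.liftAlgHom_mkAlgHom_apply, incHom_apply, collapse_inc,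
        map_one, mul_one, AlgHom.id_apply])
    (RingQuot.ringQuot_ext' k _ _ (AlgHom.toLinearMap_injective
      (Smash.hom_ext E.act fun g x => by
        -- In the quotient x # g = (x # 1)(1 # g) = (x # 1)(u(g) # 1) = x u(g) # 1, so every class
        -- comes from H.
        have h : RingQuot.mkAlgHom k (E.collapseRel u) (Smash.inc E.act 1 (u g)) =
            RingQuot.mkAlgHom k (E.collapseRel u) (Smash.inc E.act g 1) :=
          RingQuot.mkAlgHom_rel k ⟨g, rfl, rfl⟩
        simp only [AlgHom.toLinearMap_apply, AlgHom.comp_apply, RingQuot.liftAlgHom_mkAlgHom_apply,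
          collapse_inc, map_mul, AlgHom.id_apply]
        rw [incHom_apply, incHom_apply, h, ← map_mul, Smash.inc_mul_inc, one_mul, map_one, mul_one])))

theorem collapseEquiv_mk (s : Smash E.act) :
    collapseEquiv hu (RingQuot.mkAlgHom k (E.collapseRel u) s) = collapse hu s :=
  RingQuot.liftAlgHom_mkAlgHom_apply k _ _ _

variable [Finite Γ]

/-- This exhibits `shift u` as a composite of two multiplicative maps. It is also bijective, so the
braided tensor square is isomorphic to the ordinary one. -/
theorem collapse_bosTensor (hE : ⨆ g, E.hom g = ⊤) (X : H ⊗[k] H) :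
    Algebra.TensorProduct.map (collapse hu) (collapse hu) (E.bosTensor X) = E.shift u X := by
  have : (Algebra.TensorProduct.map (collapse hu) (collapse hu)).toLinearMap ∘ₗ E.bosTensor =
      E.shift u := right_hom_ext hE fun g y hy x => by
    rw [LinearMap.comp_apply, bosTensor_tmul hy, shift_tmul u hy, AlgHom.toLinearMap_apply,
      Algebra.TensorProduct.map_tmul, collapse_inc, collapse_inc, map_one, mul_one]
  exact LinearMap.congr_fun this X

include hu

theorem shift_braidedMul (hE : E.IsGraded) (X Y : H ⊗[k] H) :
    E.shift u (E.braidedMul X Y) = E.shift u X * E.shift u Y := by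
  simp only [← collapse_bosTensor hu hE.iSup_hom, hE.bosTensor_mul, map_mul]

theorem shift_one (hE : E.IsGraded) : E.shift u (1 ⊗ₜ 1) = 1 := by
  rw [← collapse_bosTensor hu hE.iSup_hom, hE.bosTensor_one, map_one]

theorem shift_map_act (hE : E.IsGraded) (g : Γ) (X : H ⊗[k] H) :
    u g ⊗ₜ u g * E.shift u X =
      E.shift u (TensorProduct.map (E.act g).toLinearMap (E.act g).toLinearMap X) *
        u g ⊗ₜ u g := by
  have := congrArg (Algebra.TensorProduct.map (collapse hu) (collapse hu))
    (grp_tmul_mul_bosTensor hE g X)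
  rwa [map_mul, map_mul, collapse_bosTensor hu hE.iSup_hom, collapse_bosTensor hu hE.iSup_hom,
    Algebra.TensorProduct.map_tmul, collapse_grp] at this

/-- `shift u` is an isomorphism of algebras from the braided tensor square to H ⊗ H, with inverse
`unshift u`. -/
theorem isUnit_shift (hE : E.IsGraded) {J : H ⊗[k] H} :
    IsUnit (E.shift u J) ↔ ∃ K, E.IsBraidedInverse J K := by
  constructor
  · intro h
    obtain ⟨S, h1, h2⟩ := isUnit_iff_exists.mp h
    refine ⟨E.unshift u S, ?_, ?_⟩ <;> apply shift_injective hE.iSup_hom u <;>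
      rw [shift_braidedMul hu hE, shift_unshift hE.iSup_hom, shift_one hu hE] <;> assumption
  · rintro ⟨K, h1, h2⟩
    refine isUnit_iff_exists.mpr ⟨E.shift u K, ?_, ?_⟩ <;>
      rw [← shift_braidedMul hu hE, ← shift_one hu hE] <;> congr 1

theorem shift_braidedInv (hE : E.IsGraded) {J : H ⊗[k] H} (hJ : IsUnit (E.shift u J)) :
    E.shift u (E.braidedInv J) = Ring.inverse (E.shift u J) := by
  have hex := (isUnit_shift hu hE).mp hJ
  have h : E.IsBraidedInverse J (E.braidedInv J) := by
    rw [braidedInv, dif_pos hex]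
    exact hex.choose_spec
  have h1 : E.shift u J * E.shift u (E.braidedInv J) = 1 := by
    rw [← shift_braidedMul hu hE, h.1, shift_one hu hE]
  rw [← Ring.inverse_mul_cancel_left _ (E.shift u (E.braidedInv J)) hJ, h1, mul_one]

end Collapse

section Coinvariant

variable {E} [Finite Γ]

theorem sum_pr_of_mem_hom2 {X : H ⊗[k] H} {g : Γ} (hX : X ∈ E.hom2 g) :
    ∑ᶠ a : Γ, TensorProduct.map (E.pr a) (E.pr (a⁻¹ * g)) X = X := by
  have := Fintype.ofFinite Γ
  rw [finsum_eq_sum_of_fintype]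
  induction hX using Submodule.span_induction with
  | zero => simp
  | add X Y _ _ hX hY => simp only [map_add, Finset.sum_add_distrib, hX, hY]
  | smul c X _ hX => simp only [map_smul, ← Finset.smul_sum, hX]
  | mem X hX =>
    obtain ⟨a, b, r, s, hr, hs, rfl, rfl⟩ := hX
    rw [Finset.sum_eq_single a]
    · simp [pr_of_mem hr, pr_of_mem hs]
    · intro h _ hne
      simp [pr_of_mem_ne hr hne]
    · simp

theorem sum_pr_of_mem_hom2_ne {X : H ⊗[k] H} {g h : Γ} (hX : X ∈ E.hom2 h) (hne : g ≠ h) :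
    ∑ᶠ a : Γ, TensorProduct.map (E.pr a) (E.pr (a⁻¹ * g)) X = 0 := by
  have := Fintype.ofFinite Γ
  rw [finsum_eq_sum_of_fintype]
  induction hX using Submodule.span_induction with
  | zero => simp
  | add X Y _ _ hX hY => simp only [map_add, Finset.sum_add_distrib, hX, hY, add_zero]
  | smul c X _ hX => simp only [map_smul, ← Finset.smul_sum, hX, smul_zero]
  | mem X hX =>
    obtain ⟨a, b, r, s, hr, hs, rfl, rfl⟩ := hX
    refine Finset.sum_eq_zero fun c _ => ?_
    by_cases hc : c = a
    · have : c⁻¹ * g ≠ b := fun e => hne (by rw [← e, hc]; group)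
      simp [pr_of_mem_ne hs this]
    · simp [pr_of_mem_ne hr hc]

end Coinvariant

/-- `E` is a bialgebra in Yetter-Drinfeld modules over `k[Γ]` that lives on a bialgebra `H`: the
action is the conjugation by group-like elements `u(g)`, and
`Δ(x) = x₍₁₎ u(x₍₂₎₍₋₁₎) ⊗ x₍₂₎₍₀₎`. -/
structure IsInner (E : BraidedData k Γ H) (Δ : H →ₐ[k] H ⊗[k] H) (ε : H →ₐ[k] k) (u : Γ →* H) :
    Prop extends E.IsGraded where
  grp_mul : ∀ g x, u g * x = E.act g x * u g
  comul_mem : ∀ {g x}, x ∈ E.hom g → E.comul x ∈ E.hom2 g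
  counit_hom : ∀ {g x}, x ∈ E.hom g → g ≠ 1 → ε x = 0
  comul_grp : ∀ g, Δ (u g) = u g ⊗ₜ u g
  counit_grp : ∀ g, ε (u g) = 1
  comul_eq : ∀ x, Δ x = E.shift u (E.comul x)
  counit_eq : E.counit = ε.toLinearMap

namespace IsInner

variable {E} [Finite Γ] {Δ : H →ₐ[k] H ⊗[k] H} {ε : H →ₐ[k] k} {u : Γ →* H}
  (hE : IsInner E Δ ε u) {J : H ⊗[k] H}

include hE

/-- `x ⊗ y ⊗ z ↦ x u(y₍₋₁₎) u(z₍₋₁₎) ⊗ y₍₀₎ u(z₍₋₁₎) ⊗ z₍₀₎` -/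
theorem exists_shift₃ : ∃ θ : (H ⊗[k] H) ⊗[k] H →ₗ[k] (H ⊗[k] H) ⊗[k] H, Function.Injective θ ∧
    ∀ X : H ⊗[k] H, ∀ g, ∀ z ∈ E.hom g, θ (X ⊗ₜ z) = (E.shift u X * u g ⊗ₜ u g) ⊗ₜ z := by
  let v : Γ →* H ⊗[k] H :=
    { toFun := fun g => u g ⊗ₜ u g
      map_one' := by simp [Algebra.TensorProduct.one_def]
      map_mul' := fun g h => by simp }
  refine ⟨E.shift v ∘ₗ (E.shift u).rTensor H, ?_, fun X g z hz => ?_⟩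
  · refine (shift_injective hE.iSup_hom v).comp
      (Function.LeftInverse.injective (g := (E.unshift u).rTensor H) fun X => ?_)
    have : E.unshift u ∘ₗ E.shift u = LinearMap.id :=
      LinearMap.ext fun X => unshift_shift hE.iSup_hom u X
    rw [← LinearMap.comp_apply, ← LinearMap.rTensor_comp, this, LinearMap.rTensor_id,
      LinearMap.id_apply]
  · rw [LinearMap.comp_apply, LinearMap.rTensor_tmul, shift_tmul v hz]
    rfl

/-- The counit sees only second legs of degree 1, where the shift does nothing. For the first leg
the reason is ε(u(g)) = 1. -/
theorem rid_shift (X : H ⊗[k] H) : TensorProduct.rid k H (ε.toLinearMap.lTensor H (E.shift u X)) =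
    TensorProduct.rid k H (E.counit.lTensor H X) := by
  have : (TensorProduct.rid k H).toLinearMap ∘ₗ ε.toLinearMap.lTensor H ∘ₗ E.shift u =
      (TensorProduct.rid k H).toLinearMap ∘ₗ E.counit.lTensor H :=
    right_hom_ext hE.iSup_hom fun g y hy x => by
      by_cases hg : g = 1
      · subst hg
        simp [shift_tmul u hy, hE.counit_eq]
      · simp [shift_tmul u hy, hE.counit_eq, hE.counit_hom hy hg]
  exact LinearMap.congr_fun this X

theorem lid_shift (X : H ⊗[k] H) : TensorProduct.lid k H (ε.toLinearMap.rTensor H (E.shift u X)) =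
    TensorProduct.lid k H (E.counit.rTensor H X) := by
  have : (TensorProduct.lid k H).toLinearMap ∘ₗ ε.toLinearMap.rTensor H ∘ₗ E.shift u =
      (TensorProduct.lid k H).toLinearMap ∘ₗ E.counit.rTensor H :=
    right_hom_ext hE.iSup_hom fun g y hy x => by
      simp [shift_tmul u hy, hE.counit_eq, hE.counit_grp]
  exact LinearMap.congr_fun this X

/-- Each condition is the image of an ordinary one under `shift u`. Invariance is commutation with
u(g) ⊗ u(g), and the twist equation is compared in the tensor cube by the injective threefold shift.
-/
theorem isBraidedTwist (hJ : J ∈ E.hom2 1)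
    (hT : IsTwist Δ.toLinearMap ε.toLinearMap (E.shift u J))
    (hc : ∀ g, Commute (E.shift u J) (u g ⊗ₜ u g)) : E.IsBraidedTwist J where
  invariant g := by
    apply shift_injective hE.iSup_hom u
    have h := shift_map_act hE.grp_mul hE.toIsGraded g J
    rw [← (hc g).eq] at h
    have hu : IsUnit (u g ⊗ₜ[k] u g) := isUnit_iff_exists.mpr ⟨u g⁻¹ ⊗ₜ u g⁻¹, by
      simp [← map_mul, Algebra.TensorProduct.one_def]⟩
    exact (hu.mul_right_cancel h).symm
  coinvariant_one := by simpa using sum_pr_of_mem_hom2 hJ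
  coinvariant_ne g hg := sum_pr_of_mem_hom2_ne hJ hg
  invertible := (isUnit_shift hE.grp_mul hE.toIsGraded).mp hT.invertible
  counit_right := by rw [← hE.rid_shift, hT.counit_right]
  counit_left := by rw [← hE.lid_shift, hT.counit_left]
  twist := by
    obtain ⟨θ, hθ, hθ_tmul⟩ := hE.exists_shift₃
    have hmul : ∀ x, E.shift u (E.braidedMul J (E.comul x)) = E.shift u J * Δ x := fun x => by
      rw [shift_braidedMul hE.grp_mul hE.toIsGraded, hE.comul_eq]
    have h1 : θ ∘ₗ (E.braidedMul J ∘ₗ E.comul).rTensor H =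
        LinearMap.mulLeft k (E.shift u J ⊗ₜ[k] (1 : H)) ∘ₗ Δ.toLinearMap.rTensor H ∘ₗ
          E.shift u := right_hom_ext hE.iSup_hom fun g y hy x => by
      simp only [LinearMap.comp_apply, LinearMap.rTensor_tmul, hθ_tmul _ _ _ hy, hmul,
        shift_tmul u hy, AlgHom.toLinearMap_apply, LinearMap.mulLeft_apply,
        Algebra.TensorProduct.tmul_mul_tmul, map_mul, hE.comul_grp, one_mul, mul_assoc]
    -- The threefold shift in the other bracketing: the first leg collects the total degree of the
    -- last two.
    have h2 : ∀ g, ∀ P ∈ E.hom2 g, ∀ x, θ ((TensorProduct.assoc k H H H).symm (x ⊗ₜ P)) =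
        (TensorProduct.assoc k H H H).symm ((x * u g) ⊗ₜ E.shift u P) := by
      intro g P hP x
      induction hP using Submodule.span_induction with
      | zero => simp
      | add P P' _ _ h h' => simp only [TensorProduct.tmul_add, map_add, h, h']
      | smul c P _ h => simp only [TensorProduct.tmul_smul, map_smul, h]
      | mem P hP =>
        obtain ⟨a, b, r, s, hr, hs, rfl, rfl⟩ := hP
        simp only [TensorProduct.assoc_symm_tmul, hθ_tmul _ _ _ hs, shift_tmul u hr,
          shift_tmul u hs, Algebra.TensorProduct.tmul_mul_tmul, map_mul, mul_assoc]
    have h3 : θ ∘ₗ (TensorProduct.assoc k H H H).symm.toLinearMap ∘ₗ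
        (E.braidedMul J ∘ₗ E.comul).lTensor H = (TensorProduct.assoc k H H H).symm.toLinearMap ∘ₗ
          LinearMap.mulLeft k ((1 : H) ⊗ₜ[k] E.shift u J) ∘ₗ Δ.toLinearMap.lTensor H ∘ₗ
            E.shift u := right_hom_ext hE.iSup_hom fun g y hy x => by
      -- J is coinvariant, so multiplication by J preserves the total degree.
      have hm : E.braidedMul J (E.comul y) ∈ E.hom2 g := by
        simpa using hE.braidedMul_mem_hom2 hJ (hE.comul_mem hy)
      simp only [LinearMap.comp_apply, LinearMap.lTensor_tmul, LinearEquiv.coe_coe,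
        h2 _ _ hm, hmul, shift_tmul u hy, AlgHom.toLinearMap_apply, LinearMap.mulLeft_apply,
        Algebra.TensorProduct.tmul_mul_tmul, one_mul]
    apply (TensorProduct.assoc k H H H).symm.injective
    rw [LinearEquiv.symm_apply_apply]
    apply hθ
    refine (LinearMap.congr_fun h3 J).trans (Eq.trans ?_ (LinearMap.congr_fun h1 J).symm)
    exact (LinearEquiv.symm_apply_eq _).mpr hT.twist

/-- The shift turns the braided product J Δ(x) J⁻¹ into the product in H ⊗ H. The factor u(g) ⊗ u(g)
from Δ(u(g)) then passes the inverse of the twist, since it commutes with the twist. -/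
theorem collapse_bosComul_twisted
    (hT : IsUnit (E.shift u J)) (hc : ∀ g, Commute (E.shift u J) (u g ⊗ₜ u g))
    (hu : ∀ g x, u g * x = (E.twisted J).act g x * u g) (s : Smash (E.twisted J).act) :
    Algebra.TensorProduct.map (collapse hu) (collapse hu) ((E.twisted J).bosComul s) =
      twistComul Δ.toLinearMap (E.shift u J) (collapse hu s) := by
  induction s using Smash.induction with
  | h0 => simp
  | hadd a b ha hb => simp only [map_add, ha, hb]
  | hinc g x =>
    have h : (E.twisted J).shift u ((E.twisted J).comul x) =
        E.shift u J * (Δ x * Ring.inverse (E.shift u J)) := by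
      change E.shift u (E.braidedMul J (E.braidedMul (E.comul x) (E.braidedInv J))) = _
      rw [shift_braidedMul hE.grp_mul hE.toIsGraded, shift_braidedMul hE.grp_mul hE.toIsGraded,
        ← hE.comul_eq, shift_braidedInv hE.grp_mul hE.toIsGraded hT]
    have hinv : Commute (Ring.inverse (E.shift u J)) (u g ⊗ₜ[k] u g) := by
      obtain ⟨T, hT⟩ := hT
      rw [← hT, Ring.inverse_unit]
      exact Commute.units_inv_left (hT ▸ hc g)
    rw [bosComul_inc, map_mul, collapse_bosTensor hu hE.iSup_hom, h, Algebra.TensorProduct.map_tmul,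
      collapse_grp, collapse_inc, twistComul, LinearMap.comp_apply, LinearMap.comp_apply,
      LinearMap.mulLeft_apply, LinearMap.mulRight_apply, AlgHom.toLinearMap_apply, map_mul,
      hE.comul_grp, mul_assoc, mul_assoc, mul_assoc, hinv.eq]

omit [Finite Γ] in
theorem collapse_bosCounit_twisted (hu : ∀ g x, u g * x = (E.twisted J).act g x * u g)
    (s : Smash (E.twisted J).act) : ε (collapse hu s) = (E.twisted J).bosCounit s := by
  induction s using Smash.induction with
  | h0 => simp
  | hadd a b ha hb => simp only [map_add, ha, hb]
  | hinc g x =>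
    rw [collapse_inc, map_mul, hE.counit_grp, mul_one, bosCounit_inc]
    exact (LinearMap.congr_fun hE.counit_eq x).symm

end IsInner

end BraidedData

/-! ### Reduction of the grading to the central subgroup Γ, and ℛ(V, G) as a bialgebra with inner
action. -/

namespace YDModule

variable {k G V : Type*} [Field k] [Group G] [Finite G] [AddCommGroup V] [Module k V]
  (M : YDModule k G V)

/-- V generates the algebra and is supported in Γ, and Γ is closed under products. -/
theorem iSup_hom_subgroup (Γ : Subgroup G) (hΓ : ∀ g ∉ Γ, M.pr g = 0) :
    ⨆ γ : Γ, M.nichols.hom (γ : G) = ⊤ := by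
  classical
  have hT := M.tensorData_isGraded
  have hK : ⨆ g, (if g ∈ Γ then M.tensorData.hom g else ⊥) = ⊤ := by
    refine M.iSup_eq_top_of_mul_mem ?_ ?_ ?_
    · rw [if_pos Γ.one_mem]; exact hT.one_mem
    · intro g v
      by_cases hg : g ∈ Γ
      · rw [if_pos hg]; exact M.ι_mem_hom (M.pr_pr_self g v)
      · simp [hΓ g hg]
    · intro g h a b ha hb
      by_cases hg : g ∈ Γ
      · by_cases hh : h ∈ Γ
        · rw [if_pos hg] at ha
          rw [if_pos hh] at hb
          rw [if_pos (Γ.mul_mem hg hh)]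
          exact hT.mul_mem ha hb
        · rw [if_neg hh, Submodule.mem_bot] at hb
          rw [hb, mul_zero]
          exact zero_mem _
      · rw [if_neg hg, Submodule.mem_bot] at ha
        rw [ha, zero_mul]
        exact zero_mem _
  refine eq_top_iff.mpr fun r _ => ?_
  obtain ⟨a, rfl⟩ := M.toNichols_surjective r
  refine Submodule.iSup_induction _
    (motive := fun a => M.toNichols a ∈ ⨆ γ : Γ, M.nichols.hom (γ : G)) (hK ▸ Submodule.mem_top)
    (fun g a ha => ?_) (by simp) (fun a b ha hb => by rw [map_add]; exact add_mem ha hb)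
  by_cases hg : g ∈ Γ
  · rw [if_pos hg] at ha
    exact Submodule.mem_iSup_of_mem (⟨g, hg⟩ : Γ) (M.isYDHom_toNichols.map_mem ha)
  · rw [if_neg hg, Submodule.mem_bot] at ha
    rw [ha, map_zero]
    exact zero_mem _

end YDModule

namespace BraidedData

variable {k G R : Type*} [Field k] [Group G] [Ring R] [Algebra k R] {D : BraidedData k G R}
  {Γ : Subgroup G}

theorem eq_zero_of_mem_hom (hsup : ⨆ γ : Γ, D.hom (γ : G) = ⊤) {g : G} (hg : g ∉ Γ) {r : R}
    (hr : r ∈ D.hom g) : r = 0 := by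
  rw [← pr_of_mem hr]
  exact Submodule.iSup_induction _ (motive := fun r => D.pr g r = 0)
    (hsup ▸ Submodule.mem_top : r ∈ ⨆ γ : Γ, D.hom (γ : G))
    (fun γ s hs => pr_of_mem_ne hs fun e => hg (e ▸ γ.2)) (map_zero _)
    (fun a b ha hb => by rw [map_add, ha, hb, add_zero])

theorem tensor_ext_subgroup (hsup : ⨆ γ : Γ, D.hom (γ : G) = ⊤) {N : Type*} [AddCommGroup N]
    [Module k N] {f f' : R ⊗[k] R →ₗ[k] N}
    (h : ∀ r, ∀ γ : Γ, ∀ s ∈ D.hom (γ : G), f (r ⊗ₜ s) = f' (r ⊗ₜ s)) : f = f' :=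
  TensorProduct.ext' fun r s => Submodule.iSup_induction _
    (motive := fun s => f (r ⊗ₜ s) = f' (r ⊗ₜ s)) (hsup ▸ Submodule.mem_top) (fun γ s hs => h r γ s hs)
    (by simp) (fun a b ha hb => by rw [TensorProduct.tmul_add, map_add, map_add, ha, hb])

variable (hΓ : Γ ≤ Subgroup.center G)

theorem overCentral_act_inc (γ : Γ) (g : G) (r : R) :
    (D.overCentral Γ hΓ).act γ (Smash.inc D.act g r) = Smash.inc D.act g (D.act γ r) :=
  Smash.lift_inc ..

theorem overCentral_pr_inc (γ : Γ) (g : G) (r : R) :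
    (D.overCentral Γ hΓ).pr γ (Smash.inc D.act g r) = Smash.inc D.act g (D.pr γ r) :=
  Smash.lift_inc ..

theorem overCentral_comul_inc (g : G) (r : R) :
    (D.overCentral Γ hΓ).comul (Smash.inc D.act g r) =
      TensorProduct.map (Smash.inc D.act g) (Smash.inc D.act g) (D.comul r) :=
  Smash.lift_inc ..

theorem inc_mem_hom {γ : Γ} {r : R} (hr : r ∈ D.hom (γ : G)) (g : G) :
    Smash.inc D.act g r ∈ (D.overCentral Γ hΓ).hom γ := by
  refine ⟨?_, fun δ hδ => ?_⟩
  · rw [overCentral_pr_inc, pr_of_mem hr]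
  · rw [overCentral_pr_inc, pr_of_mem_ne hr fun e => hδ (Subtype.ext e), map_zero]

theorem overCentral_hom_induction (hsup : ⨆ g, D.hom g = ⊤) {γ : Γ} {p : Smash D.act → Prop}
    (h0 : p 0) (hadd : ∀ x y, p x → p y → p (x + y))
    (hinc : ∀ g, ∀ r ∈ D.hom (γ : G), p (Smash.inc D.act g r)) {x : Smash D.act}
    (hx : x ∈ (D.overCentral Γ hΓ).hom γ) : p x := by
  rw [← pr_of_mem hx]
  clear hx
  induction x using Smash.induction with
  | h0 => rwa [map_zero]
  | hadd x y hx hy => rw [map_add]; exact hadd _ _ hx hy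
  | hinc g r =>
    rw [overCentral_pr_inc]
    exact hinc g _ (pr_mem_hom hsup _ _)

theorem map_inc_mem_hom2 (hsup : ⨆ γ : Γ, D.hom (γ : G) = ⊤) {γ : Γ} {X : R ⊗[k] R}
    (hX : X ∈ D.hom2 (γ : G)) (g h : G) :
    TensorProduct.map (Smash.inc D.act g) (Smash.inc D.act h) X ∈ (D.overCentral Γ hΓ).hom2 γ := by
  induction hX using Submodule.span_induction with
  | zero => rw [map_zero]; exact zero_mem _
  | add X Y _ _ hX hY => rw [map_add]; exact add_mem hX hY
  | smul c X _ hX => rw [map_smul]; exact Submodule.smul_mem _ c hX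
  | mem X hX =>
    obtain ⟨a, b, r, s, hr, hs, hab, rfl⟩ := hX
    rw [TensorProduct.map_tmul]
    by_cases ha : a ∈ Γ
    · by_cases hb : b ∈ Γ
      · exact tmul_mem_hom2 _ (inc_mem_hom hΓ (γ := ⟨a, ha⟩) hr g)
          (inc_mem_hom hΓ (γ := ⟨b, hb⟩) hs h) (Subtype.ext hab)
      · rw [eq_zero_of_mem_hom hsup hb hs, map_zero, TensorProduct.tmul_zero]
        exact zero_mem _
    · rw [eq_zero_of_mem_hom hsup ha hr, map_zero, TensorProduct.zero_tmul]
      exact zero_mem _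

theorem overCentral_isGraded (hD : D.IsGraded) (hsup : ⨆ γ : Γ, D.hom (γ : G) = ⊤) :
    (D.overCentral Γ hΓ).IsGraded where
  iSup_hom := by
    refine eq_top_iff.mpr fun x _ => ?_
    induction x using Smash.induction with
    | h0 => exact zero_mem _
    | hadd x y hx hy => exact add_mem (hx trivial) (hy trivial)
    | hinc g r =>
      exact Submodule.iSup_induction _
        (motive := fun r => Smash.inc D.act g r ∈ ⨆ γ, (D.overCentral Γ hΓ).hom γ)
        (hsup ▸ Submodule.mem_top)
        (fun γ s hs => Submodule.mem_iSup_of_mem γ (inc_mem_hom hΓ hs g))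
        (by rw [map_zero]; exact zero_mem _) (fun a b ha hb => by rw [map_add]; exact add_mem ha hb)
  one_mem := inc_mem_hom hΓ (γ := 1) hD.one_mem 1
  mul_mem {γ δ x y} hx hy := by
    refine overCentral_hom_induction hΓ hD.iSup_hom (p := fun x => x * y ∈ _) ?_ ?_ ?_ hx
    · rw [zero_mul]; exact zero_mem _
    · intro a b ha hb; rw [add_mul]; exact add_mem ha hb
    intro g r hr
    refine overCentral_hom_induction hΓ hD.iSup_hom (p := fun y => _ * y ∈ _) ?_ ?_ ?_ hy
    · rw [mul_zero]; exact zero_mem _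
    · intro a b ha hb; rw [mul_add]; exact add_mem ha hb
    intro h s hs
    rw [Smash.inc_mul_inc]
    refine inc_mem_hom hΓ (γ := γ * δ) (hD.mul_mem hr ?_) _
    -- The twisted product r (g · s) has the expected degree because g δ g⁻¹ = δ for central δ.
    have := hD.act_mem g hs
    rwa [Subgroup.mem_center_iff.mp (hΓ δ.2) g, mul_inv_cancel_right] at this
  act_mem {γ x} δ hx := by
    refine overCentral_hom_induction hΓ hD.iSup_hom
      (p := fun x => (D.overCentral Γ hΓ).act δ x ∈ _) ?_ ?_ ?_ hx
    · rw [map_zero]; exact zero_mem _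
    · intro a b ha hb; rw [map_add]; exact add_mem ha hb
    intro g r hr
    rw [overCentral_act_inc]
    exact inc_mem_hom hΓ (γ := δ * γ * δ⁻¹) (hD.act_mem _ hr) _

section

variable [Finite G]

/-- The braided bialgebra over a central subgroup `Γ` lives on the bosonization. -/
theorem IsBialg.isInner_overCentral (hD : D.IsBialg) (hsup : ⨆ γ : Γ, D.hom (γ : G) = ⊤) :
    IsInner (D.overCentral Γ hΓ) hD.comulHom hD.counitHom (D.grp.comp Γ.subtype) where
  toIsGraded := overCentral_isGraded hΓ hD.toIsGraded hsup
  grp_mul γ x := by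
    change D.grp (γ : G) * x = (D.overCentral Γ hΓ).act γ x * D.grp (γ : G)
    induction x using Smash.induction with
    | h0 => rw [map_zero, mul_zero, zero_mul]
    | hadd x y hx hy => rw [map_add, mul_add, add_mul, hx, hy]
    | hinc g r =>
      rw [grp_mul_inc, overCentral_act_inc, inc_mul_grp, Subgroup.mem_center_iff.mp (hΓ γ.2) g]
  comul_mem {γ x} hx := by
    refine overCentral_hom_induction hΓ hD.iSup_hom
      (p := fun x => (D.overCentral Γ hΓ).comul x ∈ _) ?_ ?_ ?_ hx
    · rw [map_zero]; exact zero_mem _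
    · intro a b ha hb; rw [map_add]; exact add_mem ha hb
    intro g r hr
    rw [overCentral_comul_inc]
    exact map_inc_mem_hom2 hΓ hsup (hD.comul_mem hr) g g
  counit_hom {γ x} hx hne := by
    refine overCentral_hom_induction hΓ hD.iSup_hom (p := fun x => D.bosCounit x = 0) ?_ ?_ ?_ hx
    · rw [map_zero]
    · intro a b ha hb; rw [map_add, ha, hb, add_zero]
    intro g r hr
    rw [bosCounit_inc, hD.counit_hom hr fun e => hne (Subtype.ext e)]
  comul_grp γ := hD.bosComul_grp γ
  counit_grp γ := hD.bosCounit_grp γ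
  counit_eq := rfl
  comul_eq x := by
    rw [hD.comulHom_apply]
    induction x using Smash.induction with
    | h0 => rw [map_zero, map_zero, map_zero]
    | hadd x y hx hy => rw [map_add, map_add, map_add, hx, hy]
    | hinc g r =>
      -- If s has degree γ, both sides send r ⊗ s to r # γ g ⊗ s # g; the shift produces g γ instead
      -- of γ g, and γ is central.
      have : LinearMap.mulRight k (D.grp g ⊗ₜ[k] D.grp g) ∘ₗ D.bosTensor =
          (D.overCentral Γ hΓ).shift (D.grp.comp Γ.subtype) ∘ₗ
            TensorProduct.map (Smash.inc D.act g) (Smash.inc D.act g) :=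
        tensor_ext_subgroup hsup fun r γ s hs => by
          rw [LinearMap.comp_apply, LinearMap.comp_apply, bosTensor_tmul hs, TensorProduct.map_tmul,
            LinearMap.mulRight_apply, Algebra.TensorProduct.tmul_mul_tmul, inc_mul_grp, inc_mul_grp,
            one_mul]
          refine Eq.trans ?_ (shift_tmul _ (inc_mem_hom hΓ hs g) _).symm
          rw [MonoidHom.comp_apply, Subgroup.subtype_apply, inc_mul_grp,
            Subgroup.mem_center_iff.mp (hΓ γ.2) g]
      rw [bosComul_inc, overCentral_comul_inc]
      exact LinearMap.congr_fun this (D.comul r)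

omit [Finite G] in
theorem ofGroup_mem_hom (hD : D.IsGraded) {F : Subgroup G} (a : MonoidAlgebra k F) :
    D.ofGroup F a ∈ (D.overCentral Γ hΓ).hom 1 := by
  change D.ofGroupHom F a ∈ _
  induction a using MonoidAlgebra.induction_on with
  | of f =>
    rw [ofGroupHom_single]
    exact inc_mem_hom hΓ (γ := 1) hD.one_mem f
  | add a b ha hb => rw [map_add]; exact add_mem ha hb
  | smul c a ha => rw [map_smul]; exact Submodule.smul_mem _ c ha

omit [Finite G] in
theorem map_ofGroup_mem_hom2 (hD : D.IsGraded) {F : Subgroup G}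
    (T : MonoidAlgebra k F ⊗[k] MonoidAlgebra k F) :
    TensorProduct.map (D.ofGroup F) (D.ofGroup F) T ∈ (D.overCentral Γ hΓ).hom2 1 := by
  induction T using TensorProduct.induction_on with
  | zero => rw [map_zero]; exact zero_mem _
  | add a b ha hb => rw [map_add]; exact add_mem ha hb
  | tmul a b =>
    exact tmul_mem_hom2 _ (ofGroup_mem_hom hΓ hD a) (ofGroup_mem_hom hΓ hD b) (one_mul 1)

/-- Γ coacts on the factor R only, so kF lies in degree 1 and is not moved by the shift. -/
theorem shift_map_ofGroup (hD : D.IsGraded) {F : Subgroup G}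
    (T : MonoidAlgebra k F ⊗[k] MonoidAlgebra k F) :
    (D.overCentral Γ hΓ).shift (D.grp.comp Γ.subtype)
      (TensorProduct.map (D.ofGroup F) (D.ofGroup F) T) =
      TensorProduct.map (D.ofGroup F) (D.ofGroup F) T := by
  induction T using TensorProduct.induction_on with
  | zero => rw [map_zero]; exact map_zero _
  | add a b ha hb => rw [map_add]; exact (map_add _ _ _).trans (congrArg₂ _ ha hb)
  | tmul a b =>
    refine (shift_tmul _ (ofGroup_mem_hom hΓ hD b) _).trans ?_
    rw [map_one, mul_one]; rfl

theorem shift_map_inc (hsup : ⨆ γ : Γ, D.hom (γ : G) = ⊤) (X : R ⊗[k] R) :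
    (D.overCentral Γ hΓ).shift (D.grp.comp Γ.subtype)
      (TensorProduct.map (Smash.inc D.act 1) (Smash.inc D.act 1) X) = D.bosTensor X := by
  have : (D.overCentral Γ hΓ).shift (D.grp.comp Γ.subtype) ∘ₗ
      TensorProduct.map (Smash.inc D.act 1) (Smash.inc D.act 1) = D.bosTensor :=
    tensor_ext_subgroup hsup fun r γ s hs => by
      rw [bosTensor_tmul hs]
      refine (shift_tmul _ (inc_mem_hom hΓ hs 1) _).trans ?_
      rw [MonoidHom.comp_apply, Subgroup.subtype_apply, inc_mul_grp, one_mul]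
  exact LinearMap.congr_fun this X

/-- The shift fixes the group part and acts as `bosTensor` on the part from R, so the braided
product that defines 𝒥_{𝒟,F} becomes the ordinary product that defines 𝒥_𝒟 # J_F. -/
theorem shift_braidedMul_ofGroup (hD : D.IsBialg) (hsup : ⨆ γ : Γ, D.hom (γ : G) = ⊤)
    {F : Subgroup G} (T : MonoidAlgebra k F ⊗[k] MonoidAlgebra k F) (X : R ⊗[k] R) :
    (D.overCentral Γ hΓ).shift (D.grp.comp Γ.subtype) ((D.overCentral Γ hΓ).braidedMul
      (TensorProduct.map (D.ofGroup F) (D.ofGroup F) T)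
      (TensorProduct.map (Smash.inc D.act 1) (Smash.inc D.act 1) X)) = D.bosTwist X T := by
  have hE := hD.isInner_overCentral hΓ hsup
  refine (shift_braidedMul hE.grp_mul hE.toIsGraded _ _).trans ?_
  exact congrArg₂ (· * ·) (shift_map_ofGroup hΓ hD.toIsGraded T) (shift_map_inc hΓ hsup X)

end

end BraidedData

/-! ### Comparison of the twists of 𝔅(W) over Γ and of 𝔅(V) over G. -/

namespace BraidedData

variable {k G R : Type*} [Field k] [Group G] [Ring R] [Algebra k R] (D : BraidedData k G R)

/-- Lets 0 stand in for the generators x_i that are not in W. -/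
theorem isDiag_zero (g : G) (χ : G →* kˣ) : D.IsDiag g χ 0 where
  mem := zero_mem _
  act h := by simp
  comul := by simp
  counit := map_zero _

end BraidedData

namespace QuantumLinearSpace

section

variable {k G Γ R R' : Type*} [Field k] [Group G] [Finite G] [Group Γ] [Finite Γ] {θ : ℕ}
  [Ring R] [Algebra k R] [Ring R'] [Algebra k R']
  {Q' : QuantumLinearSpace k Γ θ} {Q : QuantumLinearSpace k G θ} {D' : BraidedData k Γ R'}
  {D : BraidedData k G R} {φ : Γ →* G} {f : R' →ₐ[k] R} {y' : Fin θ → R'} {y : Fin θ → R}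
  {ξ : Fin θ → k} {a : Fin θ → Fin θ → k}

/-- A factor with zero scalar is 1 ⊗ 1 whatever the generators are, so f has to match generators
only where the scalars are nonzero. -/
theorem map_twistD (hD' : D'.IsGraded) (hf : BraidedData.IsYDHom D' D φ f)
    (hq : ∀ i j, Q'.q i j = Q.q i j) (hξ : ∀ i, ξ i ≠ 0 → f (y' i) = y i)
    (ha : ∀ i j, i ≠ j → a i j ≠ 0 → f (y' i) = y i ∧ f (y' j) = y j) :
    TensorProduct.map f.toLinearMap f.toLinearMap (Q'.twistD D' y' ξ a) = Q.twistD D y ξ a := by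
  have hN : ∀ i, Q'.N i = Q.N i := fun i => by rw [N, N, hq]
  have key : ∀ l : List (R' ⊗[k] R'), TensorProduct.map f.toLinearMap f.toLinearMap
      (l.foldr (fun s t => D'.braidedMul s t) (1 ⊗ₜ 1)) =
        (l.map (TensorProduct.map f.toLinearMap f.toLinearMap)).foldr
          (fun s t => D.braidedMul s t) (1 ⊗ₜ 1) := by
    intro l
    induction l with
    | nil => simp
    | cons s l ih => rw [List.foldr_cons, hf.map_braidedMul hD', ih, List.map_cons, List.foldr_cons]
  rw [twistD, key, twistD, twistList, twistList, List.map_append, List.map_map, List.map_map]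
  congr 2
  · refine List.map_congr_left fun i _ => ?_
    rw [Function.comp_apply, twistξ, twistξ, map_add, map_smul, map_sum, hN, hq]
    by_cases h : ξ i = 0
    · simp [h]
    · simp [hξ i h]
  · refine List.map_congr_left fun p hp => ?_
    obtain ⟨i, j⟩ := p
    have hij : i ≠ j := by simpa using (List.mem_filter.mp hp).2
    change TensorProduct.map f.toLinearMap f.toLinearMap (Q'.twistExp D' y' a i j) =
      Q.twistExp D y a i j
    by_cases h : a i j = 0
    · rw [twistExp_of_eq_zero h, twistExp_of_eq_zero h]; simp
    · rw [twistExp, twistExp, map_sum, hN, hq]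
      refine Finset.sum_congr rfl fun n hn => ?_
      rw [map_smul]
      congr 1
      clear hn
      induction n with
      | zero => simp
      | succ n ih =>
        rw [Function.iterate_succ_apply', Function.iterate_succ_apply', hf.map_braidedMul hD', ih]
        simp [ha i j hij h]

end

variable {k G : Type*} [Field k] [Group G] {θ : ℕ} (Q : QuantumLinearSpace k G θ)

theorem g_mem_Γ (i : Fin θ) : Q.g i ∈ Q.Γ := Subgroup.subset_closure ⟨i, rfl⟩

/-- The quantum linear space over the subgroup `Γ` generated by its support. -/
def restrict : QuantumLinearSpace k Q.Γ θ where
  g i := ⟨Q.g i, Q.g_mem_Γ i⟩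
  χ i := (Q.χ i).comp Q.Γ.subtype
  g_central i := Subgroup.mem_center_iff.mpr fun h =>
    Subtype.ext (Subgroup.mem_center_iff.mp (Q.g_central i) h)
  q_self := Q.q_self
  q_symm := Q.q_symm

variable [Finite G]

theorem V_act_single (h : G) (i : Fin θ) :
    Q.V.act h (Pi.single i 1) = (Q.χ i h : k) • Pi.single i 1 := by
  ext j
  by_cases hj : j = i
  · subst hj; simp [V]
  · simp [V, hj]

theorem V_pr_single (i : Fin θ) : Q.V.pr (Q.g i) (Pi.single i 1) = Pi.single i 1 := by
  ext j
  by_cases hj : j = i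
  · subst hj; simp [V]
  · by_cases hg : Q.g j = Q.g i <;> simp [V, hj, hg]

theorem V_pr_eq_zero {h : G} (hh : h ∉ Q.Γ) : Q.V.pr h = 0 := by
  ext v j
  have : Q.g j ≠ h := fun e => hh (e ▸ Q.g_mem_Γ j)
  simp [V, this]

theorem isBialg_B : Q.B.IsBialg := Q.V.nichols_isBialg

theorem iSup_hom_B : ⨆ γ : Q.Γ, Q.B.hom (γ : G) = ⊤ :=
  Q.V.iSup_hom_subgroup Q.Γ fun _ hg => Q.V_pr_eq_zero hg

theorem isRealization_x : Q.IsRealization Q.B Q.x where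
  diag i := Q.V.isDiag_ofV (Q.V_pr_single i) fun h => Q.V_act_single h i
  pow_N i := Q.V.ofV_pow (Q.V_pr_single i) (fun h => Q.V_act_single h i) (Q.isQRoot i)
  comm i j h := Q.V.ofV_mul (Q.V_pr_single i) (fun h => Q.V_act_single h i) (Q.V_pr_single j)
    (fun h => Q.V_act_single h j) (Subgroup.mem_center_iff.mp (Q.g_central j) _) (Q.q_mul_q h)

end QuantumLinearSpace

/-! ### Application to the datum: the twist of 𝔅(W), the twist of 𝔅(V) # kG and the algebra A. -/

namespace MombelliDatum

variable {k G : Type*} [Field k] [Group G] [Finite G] {θ : ℕ} {Q : QuantumLinearSpace k G θ}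
  (M : MombelliDatum Q)

theorem isCompatible : QuantumLinearSpace.IsCompatible Q M.ξ M.a where
  ξ_coinvariant := M.ξ_coinvariant
  a_coinvariant := M.a_coinvariant
  a_invariant i j hij ha l := M.a_invariant i j hij ha _ (M.Γ_le (Q.g_mem_Γ l))

theorem isCompatible_restrict : QuantumLinearSpace.IsCompatible Q.restrict M.ξ M.a where
  ξ_coinvariant i h := Subtype.ext (M.ξ_coinvariant i h)
  a_coinvariant i j hij h := Subtype.ext (M.a_coinvariant i j hij h)
  a_invariant i j hij ha l := M.a_invariant i j hij ha _ (M.Γ_le (Q.g_mem_Γ l))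

theorem isHom_subtype : YDModule.IsHom M.ydW Q.V Q.Γ.subtype M.W.subtype where
  map_act _ _ := rfl
  pr_map g w := Q.V.pr_pr_self g w

open Classical in
/-- The element `x_i` of `𝔅(W)` if `x_i` is in `W`, and `0` otherwise. -/
def xW (i : Fin θ) : M.ydW.Nichols :=
  if h : Pi.single i 1 ∈ M.W then M.ydW.ofV ⟨Pi.single i 1, h⟩ else 0

theorem xW_of_mem {i : Fin θ} (h : Pi.single i 1 ∈ M.W) :
    M.xW i = M.ydW.ofV ⟨Pi.single i 1, h⟩ := dif_pos h

theorem xW_of_not_mem {i : Fin θ} (h : Pi.single i 1 ∉ M.W) : M.xW i = 0 := dif_neg h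

theorem isBialg_BW : M.BW.IsBialg := M.ydW.nichols_isBialg

/-- For indices with x_i in W these are relations of the Nichols algebra 𝔅(W); for the others they
are trivial because the element is 0. -/
theorem isRealization_xW : Q.restrict.IsRealization M.BW M.xW := by
  have hpr : ∀ i (h : Pi.single i 1 ∈ M.W),
      M.ydW.pr (Q.restrict.g i) ⟨Pi.single i 1, h⟩ = ⟨Pi.single i 1, h⟩ :=
    fun i h => Subtype.ext (Q.V_pr_single i)
  have hact : ∀ i (h : Pi.single i 1 ∈ M.W) (γ : Q.Γ),
      M.ydW.act γ ⟨Pi.single i 1, h⟩ = (Q.restrict.χ i γ : k) • ⟨Pi.single i 1, h⟩ :=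
    fun i h γ => Subtype.ext (Q.V_act_single γ i)
  refine ⟨fun i => ?_, fun i => ?_, fun i j hij => ?_⟩
  · by_cases h : Pi.single i 1 ∈ M.W
    · rw [M.xW_of_mem h]
      exact M.ydW.isDiag_ofV (hpr i h) (hact i h)
    · rw [M.xW_of_not_mem h]
      exact M.BW.isDiag_zero _ _
  · by_cases h : Pi.single i 1 ∈ M.W
    · rw [M.xW_of_mem h]
      exact M.ydW.ofV_pow (hpr i h) (hact i h) (Q.restrict.isQRoot i)
    · rw [M.xW_of_not_mem h, zero_pow (Q.restrict.isQRoot i).pos.ne']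
  · by_cases h : Pi.single i 1 ∈ M.W
    · by_cases h' : Pi.single j 1 ∈ M.W
      · rw [M.xW_of_mem h, M.xW_of_mem h']
        exact M.ydW.ofV_mul (hpr i h) (hact i h) (hpr j h') (hact j h')
          (Subgroup.mem_center_iff.mp (Q.restrict.g_central j) _) (Q.restrict.q_mul_q hij)
      · rw [M.xW_of_not_mem h', mul_zero, zero_mul, smul_zero]
    · rw [M.xW_of_not_mem h, mul_zero, zero_mul, smul_zero]

/-- The algebra map `𝔅(W) → 𝔅(V)` that extends the inclusion. -/
def nicholsMap : M.ydW.Nichols →ₐ[k] Q.V.Nichols := M.isHom_subtype.nicholsMap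

theorem nicholsMap_ofV (w : M.W) : M.nicholsMap (M.ydW.ofV w) = Q.V.ofV w :=
  M.isHom_subtype.nicholsMap_ofV w

theorem nicholsMap_xW {i : Fin θ} (h : Pi.single i 1 ∈ M.W) : M.nicholsMap (M.xW i) = Q.x i := by
  rw [M.xW_of_mem h]; exact M.nicholsMap_ofV _

/-- The braided twist for `𝔅(W)` defined by the scalars. -/
def JW : M.ydW.Nichols ⊗[k] M.ydW.Nichols := Q.restrict.twistD M.BW M.xW M.ξ M.a

theorem JW_mem_hom2 : M.JW ∈ M.BW.hom2 1 :=
  M.isRealization_xW.twistD_mem_hom2 M.isBialg_BW.toIsGraded M.isCompatible_restrict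

theorem isTwist_bosTensor_JW : IsTwist M.BW.bosComul M.BW.bosCounit (M.BW.bosTensor M.JW) :=
  M.isRealization_xW.isTwist_bosTensor M.isBialg_BW M.isCompatible_restrict

theorem map_JW :
    TensorProduct.map M.nicholsMap.toLinearMap M.nicholsMap.toLinearMap M.JW = M.JD :=
  QuantumLinearSpace.map_twistD (Q := Q) (D := Q.B) M.isBialg_BW.toIsGraded
    M.isHom_subtype.isYDHom_nicholsMap (fun _ _ => rfl)
    (fun i h => M.nicholsMap_xW (M.ξ_mem i h))
    (fun i j hij h => ⟨M.nicholsMap_xW (M.a_mem i j hij h).1, M.nicholsMap_xW (M.a_mem i j hij h).2⟩)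

theorem JD_mem_hom2 : M.JD ∈ Q.B.hom2 1 :=
  Q.isRealization_x.twistD_mem_hom2 Q.isBialg_B.toIsGraded M.isCompatible

theorem commute_bosTensor_JD {f : G} (hf : f ∈ M.F) :
    Commute (Q.B.bosTensor M.JD) (Q.B.grp f ⊗ₜ Q.B.grp f) :=
  Q.isRealization_x.commute_bosTensor Q.isBialg_B M.isCompatible
    (fun i h => M.ξ_invariant i h f hf) (fun i j hij h => M.a_invariant i j hij h f hf)

/-- The twist `𝒥_𝒟 # J_F` of the bosonization. -/
def twist : Smash Q.B.act ⊗[k] Smash Q.B.act := Q.B.bosTwist M.JD M.JF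

theorem isTwist_twist : IsTwist Q.B.bosComul Q.B.bosCounit M.twist :=
  BraidedData.isTwist_bosTwist Q.isBialg_B M.JF_twist
    (Q.isRealization_x.isTwist_bosTensor Q.isBialg_B M.isCompatible)
    fun _ hf => M.commute_bosTensor_JD hf

/-- The part J_F commutes with h ⊗ h because Γ is central in G, the part 𝒥_𝒟 because it is
F-invariant and Γ ≤ F. -/
theorem commute_twist (h : Q.Γ) :
    Commute M.twist (Q.B.grp (h : G) ⊗ₜ Q.B.grp (h : G)) := by
  refine Commute.mul_left ?_ (M.commute_bosTensor_JD (M.Γ_le h.2))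
  have hc : ∀ a, Commute (Q.B.ofGroup M.F a) (Q.B.grp (h : G)) := by
    intro a
    change Commute (Q.B.ofGroupHom M.F a) _
    induction a using MonoidAlgebra.induction_on with
    | of f =>
      rw [BraidedData.ofGroupHom_single, Commute, SemiconjBy, ← map_mul, ← map_mul,
        Subgroup.mem_center_iff.mp (Q.Γ_le_center h.2)]
    | add a b ha hb => rw [map_add]; exact ha.add_left hb
    | smul c a ha => rw [map_smul]; exact ha.smul_left c
  induction M.JF using TensorProduct.induction_on with
  | zero => rw [map_zero]; exact Commute.zero_left _
  | add a b ha hb => rw [map_add]; exact ha.add_left hb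
  | tmul a b =>
    rw [TensorProduct.map_tmul, Commute, SemiconjBy, Algebra.TensorProduct.tmul_mul_tmul,
      Algebra.TensorProduct.tmul_mul_tmul, (hc a).eq, (hc b).eq]

/-- `Γ` in the bosonization. -/
def grpΓ (Q : QuantumLinearSpace k G θ) : Q.Γ →* Smash Q.B.act := Q.B.grp.comp Q.Γ.subtype

theorem isInner_R (Q : QuantumLinearSpace k G θ) :
    BraidedData.IsInner Q.R Q.isBialg_B.comulHom Q.isBialg_B.counitHom (grpΓ Q) :=
  Q.isBialg_B.isInner_overCentral Q.Γ_le_center Q.iSup_hom_B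

theorem shift_JDF : Q.R.shift (grpΓ Q) M.JDF = M.twist :=
  BraidedData.shift_braidedMul_ofGroup Q.Γ_le_center Q.isBialg_B Q.iSup_hom_B M.JF M.JD

theorem JDF_mem_hom2 : M.JDF ∈ Q.R.hom2 1 := by
  have := (isInner_R Q).braidedMul_mem_hom2
    (BraidedData.map_ofGroup_mem_hom2 Q.Γ_le_center Q.isBialg_B.toIsGraded M.JF)
    (BraidedData.map_inc_mem_hom2 Q.Γ_le_center Q.iSup_hom_B (γ := 1) M.JD_mem_hom2 1 1)
  rwa [one_mul] at this

theorem isBraidedTwist_JDF : Q.R.IsBraidedTwist M.JDF := by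
  refine (isInner_R Q).isBraidedTwist M.JDF_mem_hom2 ?_ fun h => ?_
  · rw [M.shift_JDF]; exact M.isTwist_twist
  · rw [M.shift_JDF]; exact M.commute_twist h

theorem grp_mul_RJ (h : Q.Γ) (x : Smash Q.B.act) :
    grpΓ Q h * x = M.RJ.act h x * grpΓ Q h := (isInner_R Q).grp_mul h x

/-- The isomorphism from `A(V, G, W, F, J_F, 𝒟)` to the bosonization. -/
def equivA : M.A ≃ₐ[k] Smash Q.B.act := BraidedData.collapseEquiv M.grp_mul_RJ

theorem equivA_proj (s : Smash M.RJ.act) :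
    M.equivA (M.proj s) = BraidedData.collapse M.grp_mul_RJ s :=
  BraidedData.collapseEquiv_mk M.grp_mul_RJ s

theorem map_equivA_bosComul (s : Smash M.RJ.act) :
    TensorProduct.map M.equivA.toLinearMap M.equivA.toLinearMap
      (TensorProduct.map M.proj.toLinearMap M.proj.toLinearMap (M.RJ.bosComul s)) =
      twistComul Q.B.bosComul M.twist (M.equivA (M.proj s)) := by
  have hT : IsUnit (Q.R.shift (grpΓ Q) M.JDF) := by rw [M.shift_JDF]; exact M.isTwist_twist.invertible
  have hc : ∀ h, Commute (Q.R.shift (grpΓ Q) M.JDF) (grpΓ Q h ⊗ₜ grpΓ Q h) := fun h => by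
    rw [M.shift_JDF]; exact M.commute_twist h
  have := (isInner_R Q).collapse_bosComul_twisted hT hc M.grp_mul_RJ s
  rw [M.shift_JDF] at this
  rw [M.equivA_proj]
  refine Eq.trans ?_ this
  have h : M.equivA.toLinearMap ∘ₗ M.proj.toLinearMap =
      (BraidedData.collapse M.grp_mul_RJ).toLinearMap := LinearMap.ext M.equivA_proj
  rw [← LinearMap.comp_apply, ← TensorProduct.map_comp, h]
  rfl

/-- The comultiplication of `A(V, G, W, F, J_F, 𝒟)`. -/
def comulA : M.A →ₗ[k] M.A ⊗[k] M.A :=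
  TensorProduct.map M.equivA.symm.toLinearMap M.equivA.symm.toLinearMap ∘ₗ
    twistComul Q.B.bosComul M.twist ∘ₗ M.equivA.toLinearMap

/-- The counit of `A(V, G, W, F, J_F, 𝒟)`. -/
def counitA : M.A →ₗ[k] k := Q.B.bosCounit ∘ₗ M.equivA.toLinearMap

theorem map_equivA_comulA : TensorProduct.map M.equivA.toLinearMap M.equivA.toLinearMap ∘ₗ M.comulA =
    twistComul Q.B.bosComul M.twist ∘ₗ M.equivA.toLinearMap := by
  have h : M.equivA.toLinearMap ∘ₗ M.equivA.symm.toLinearMap = LinearMap.id :=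
    LinearMap.ext M.equivA.apply_symm_apply
  rw [comulA, ← LinearMap.comp_assoc, ← TensorProduct.map_comp, h, TensorProduct.map_id,
    LinearMap.id_comp]

/-- The structure carried over from the twisted bosonization is the one induced on the quotient,
because the collapse map is already compatible with the coproducts and counits before passing to the
quotient. -/
theorem isHopfStructure : M.IsHopfStructure M.comulA M.counitA where
  comul := LinearMap.ext fun s => by
    have h : M.equivA.symm.toLinearMap ∘ₗ M.equivA.toLinearMap = LinearMap.id :=
      LinearMap.ext M.equivA.symm_apply_apply
    change TensorProduct.map M.equivA.symm.toLinearMap M.equivA.symm.toLinearMap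
      (twistComul Q.B.bosComul M.twist (M.equivA (M.proj s))) = _
    rw [← M.map_equivA_bosComul, ← LinearMap.comp_apply, ← TensorProduct.map_comp, h,
      TensorProduct.map_id]
    rfl
  counit := LinearMap.ext fun s =>
    (congrArg Q.B.bosCounit (M.equivA_proj s)).trans
      ((isInner_R Q).collapse_bosCounit_twisted M.grp_mul_RJ s)

end MombelliDatum

end QLS

end

theorem mainTheorem4 {k : Type*} [Field k] [IsAlgClosed k] [CharZero k]
    {G : Type*} [Group G] [Finite G] {θ : ℕ} (Q : QLS.QuantumLinearSpace k G θ)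
    (M : QLS.MombelliDatum Q) :
    Q.R.IsBraidedTwist M.JDF ∧
    ∃ (Δ : M.A →ₗ[k] M.A ⊗[k] M.A) (ε : M.A →ₗ[k] k), M.IsHopfStructure Δ ε ∧
    ∃ ι : M.ydW.Nichols →ₐ[k] Q.V.Nichols, (∀ w : M.W, ι (M.ydW.ofV w) = Q.V.ofV w) ∧
    ∃ (σ : Module.Dual k (QLS.Smash M.BW.act) ⊗[k] Module.Dual k (QLS.Smash M.BW.act) →ₗ[k] k)
      (J : M.ydW.Nichols ⊗[k] M.ydW.Nichols) (T : QLS.Smash Q.B.act ⊗[k] QLS.Smash Q.B.act),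
      M.BW.IsBalancedDualCocycle σ ∧
      M.BW.IsTwistOfCocycle σ J ∧
      T = Q.B.bosTwist (TensorProduct.map ι.toLinearMap ι.toLinearMap J) M.JF ∧
      QLS.IsTwist Q.B.bosComul Q.B.bosCounit T ∧
      ∃ Φ : M.A ≃ₐ[k] QLS.Smash Q.B.act,
        (∀ (v : Q.V.Nichols) (g : G) (h : Q.Γ),
          Φ (M.proj (QLS.Smash.inc M.RJ.act h (QLS.Smash.inc Q.B.act g v))) =
            QLS.Smash.inc Q.B.act (g * h) v) ∧
        TensorProduct.map Φ.toLinearMap Φ.toLinearMap ∘ₗ Δ =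
          QLS.twistComul Q.B.bosComul T ∘ₗ Φ.toLinearMap ∧
        Q.B.bosCounit ∘ₗ Φ.toLinearMap = ε := by
  -- σ is evaluation on the image in (𝔅(W) # kΓ) ⊗ (𝔅(W) # kΓ) of the braided twist of 𝔅(W); hence
  -- 𝒥(σ) is that braided twist, and 𝔅(W) → 𝔅(V) sends it to 𝒥_𝒟.
  refine ⟨M.isBraidedTwist_JDF, M.comulA, M.counitA, M.isHopfStructure, M.nicholsMap,
    M.nicholsMap_ofV, QLS.pairing (M.BW.bosTensor M.JW), M.JW, M.twist,
    QLS.BraidedData.isBalancedDualCocycle M.isBialg_BW M.JW_mem_hom2 M.isTwist_bosTensor_JW,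
    QLS.BraidedData.isTwistOfCocycle M.isBialg_BW M.JW, ?_, M.isTwist_twist, M.equivA,
    fun v g h => ?_, M.map_equivA_comulA, rfl⟩
  · rw [M.map_JW]; rfl
  · rw [M.equivA_proj, QLS.BraidedData.collapse_inc]
    exact QLS.BraidedData.inc_mul_grp (D := Q.B) (h : G) g v
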